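/- All graphs are finite, without loops or parallel edges. A \emph{mass} on a graph $G$ is a function $\mu$ assigning a real number $\mu(X)$ to every $X\subseteq V(G)$ such that $\mu(\emptyset)=0$, $\mu(V(G))=1$, $\mu(X)\le\mu(Y)$ whenever $X\subseteq Y$, and $\mu(X\cup Y)\le\mu(X)+\mu(Y)$ for all disjoint $X,Y\subseteq V(G)$; the pair $(G,\mu)$ is then a \emph{massed graph}. Two disjoint sets $A,B\subseteq V(G)$ are \emph{anticomplete} if there is no edge of $G$ between $A$ and $B$. For $\varepsilon>0$, a massed graph $(G,\mu)$ is \emph{$\varepsilon$-coherent} if $\mu(\{v\})<\varepsilon$ and $\mu(N(v))<\varepsilon$ for every vertex $v$ (where $N(v)$ is the set of neighbours of $v$), and $\min(\mu(A),\mu(B))<\varepsilon$ for every two anticomplete sets $A,B$ of vertices. For a graph $H$ and a path $P$ of $H$ (a subgraph, not necessarily induced, with at least one vertex), a \emph{$P$-filleting} of $H$ is any graph isomorphic to one obtained from $H$ by subdividing at least once every edge of $H$ not in $E(P)$ and not subdividing the edges in $E(P)$. For every graph $H$ and every path $P$ of $H$, there exists $\varepsilon>0$ such that for every $\varepsilon$-coherent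 massed graph $(G,\mu)$, some induced subgraph of $G$ is a $P$-filleting of $H$. -/

import Mathlib

universe u v

namespace PureInduced

/-- A realization of `J` as a subdivision of `H`: the vertices of `H` are placed injectively in
`J`, and `J` is the union of these vertices and of paths of `J`, one for each edge of `H` (given for
both orientations of the edge, one being the reverse of the other), that join the ends of the edge
and are disjoint from each other and from the vertices of `H` except for their ends. The edge `uv`
of `H` has been subdivided `(path h).length - 1` times. -/
structure Subdivision {V : Type u} {W : Type v} (H : SimpleGraph V) (J : SimpleGraph W) where
  branch : V ↪ W
  path : ∀ {a b : V}, H.Adj a b → J.Walk (branch a) (branch b)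
  isPath : ∀ {a b : V} (h : H.Adj a b), (path h).IsPath
  path_symm : ∀ {a b : V} (h : H.Adj a b), path h.symm = (path h).reverse
  /-- No path has a vertex of `H` as an internal vertex. -/
  branch_mem : ∀ {a b : V} (h : H.Adj a b) (c : V),
    branch c ∈ (path h).support → c = a ∨ c = b
  /-- The paths of distinct edges meet only in vertices of `H`. -/
  internally_disjoint : ∀ {a b c d : V} (h : H.Adj a b) (h' : H.Adj c d),
    s(a, b) ≠ s(c, d) → ∀ x : W, x ∈ (path h).support → x ∈ (path h').support →
      x ∈ Set.range branch
  vertex_cover : ∀ x : W,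
    x ∈ Set.range branch ∨ ∃ (a b : V) (h : H.Adj a b), x ∈ (path h).support
  edge_cover : ∀ e ∈ J.edgeSet, ∃ (a b : V) (h : H.Adj a b), e ∈ (path h).edges

/-- `J` is a `P`-filleting of `H`: it is obtained from `H` by subdividing at least once every edge
that is not in `E(P)` and not subdividing the edges in `E(P)`. -/
def IsFilleting {V : Type u} {W : Type v} {H : SimpleGraph V} {s t : V} (P : H.Walk s t)
    (J : SimpleGraph W) : Prop :=
  ∃ D : Subdivision H J, ∀ (a b : V) (h : H.Adj a b),
    (s(a, b) ∈ P.edges → (D.path h).length = 1) ∧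
    (s(a, b) ∉ P.edges → 2 ≤ (D.path h).length)

/-- `μ` is a mass on a graph with vertex set `W`. -/
structure IsMass {W : Type v} (μ : Set W → ℝ) : Prop where
  empty : μ ∅ = 0
  univ : μ Set.univ = 1
  mono : ∀ X Y : Set W, X ⊆ Y → μ X ≤ μ Y
  subadditive : ∀ X Y : Set W, Disjoint X Y → μ (X ∪ Y) ≤ μ X + μ Y

/-- Anticomplete sets of vertices are disjoint, with no edge between them. -/
def Anticomplete {W : Type v} (G : SimpleGraph W) (A B : Set W) : Prop :=
  Disjoint A B ∧ ∀ a ∈ A, ∀ b ∈ B, ¬ G.Adj a b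

/-- The condition of `ε`-coherence for a graph `G` with a mass `μ`. -/
structure IsCoherent {W : Type v} (G : SimpleGraph W) (μ : Set W → ℝ) (ε : ℝ) : Prop where
  vertex_lt : ∀ x : W, μ {x} < ε
  neighborSet_lt : ∀ x : W, μ (G.neighborSet x) < ε
  min_lt : ∀ A B : Set W, Anticomplete G A B → min (μ A) (μ B) < ε

end PureInduced

namespace PureInduced

/-! Put the vertices of `H` on a line so that the edges of `P` are exactly the pairs at consecutive
places. It is then enough to find in `G` distinct vertices, one for each vertex of `H`, adjacent
exactly when their places are consecutive, and for every edge outside `P` a connected set touching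
just the two representatives of its ends, these sets being pairwise anticomplete (`Conf`). Chordless
paths through these sets then give an induced `P`-filleting (`Conf.exists_filleting`).

The representatives are taken from the spine of a caterpillar: an induced path each of whose
vertices carries many pendant connected blobs, all pairwise anticomplete. A non-path edge `uw` is
realised by joining a blob at `u` to a blob at `w`.

Many caterpillars are grown at once. Each has a heavy set of candidates for its root, or of starting
points of short paths to such roots. By coherence heavy sets see one another, so a set drawn from
one object can be enlarged gradually until it first touches a fair share of some object, while
sparing most of all others (`exists_trim`). If the touched vertices are roots of another object, the
set either supplies a blob there or lets the first caterpillar be prolonged; if they lie earlier on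
the short paths, the first caterpillar moves there and gets a shorter path. Each move costs a
constant factor of weight. What remains is a finite game, won by a potential argument and induction
on the pairs (position, rank) (`Game.exists_rank`).

To join the blobs, two cases are distinguished. If every heavy set contains a heavy ball of radius
five, blobs are cut out of balls: they have large neighbourhoods, and any point of them is reached
by a connected subset with light neighbourhood, so they can be joined greedily afterwards
(`exists_links`). Otherwise some heavy set induces a graph in which all such balls are light. There,
light sets called cores are chosen together with connections between every two of them before the
game (`exists_fabric`); the game is played away from the connections and every blob contains a core,
so the needed connections are already present at the end. -/

/-- The closed neighbourhood of a set of vertices. -/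
def nb {W : Type v} (G : SimpleGraph W) (X : Set W) : Set W :=
  {y | ∃ x ∈ X, y = x ∨ G.Adj x y}

/-- No vertex of `A` is equal or adjacent to a vertex of `B`. -/
def AC {W : Type v} (G : SimpleGraph W) (A B : Set W) : Prop :=
  ∀ a ∈ A, ∀ b ∈ B, a ≠ b ∧ ¬ G.Adj a b

/-- `X` induces a connected subgraph: every proper nonempty part sends an edge to the rest. -/
def Conn {W : Type v} (G : SimpleGraph W) (X : Set W) : Prop :=
  X.Nonempty ∧ ∀ A ⊆ X, A.Nonempty → (X \ A).Nonempty → ∃ a ∈ A, ∃ b ∈ X \ A, G.Adj a b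

/-- A subadditive weight for which closed neighbourhoods of vertices are light, and of two
anticomplete sets one is light. -/
structure Wt {W : Type v} (G : SimpleGraph W) (μ : Set W → ℝ) (ε : ℝ) : Prop where
  empty : μ ∅ = 0
  mono : ∀ {X Y : Set W}, X ⊆ Y → μ X ≤ μ Y
  union_le : ∀ X Y : Set W, μ (X ∪ Y) ≤ μ X + μ Y
  nb_le : ∀ x, μ (nb G {x}) ≤ ε
  ac : ∀ A B : Set W, AC G A B → μ A < ε ∨ μ B < ε

/-! ### Neighbourhoods, anticomplete sets and connected sets. -/

section Basics

variable {W : Type v} {G : SimpleGraph W} {A B C X Y : Set W} {x y : W}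

theorem subset_nb : X ⊆ nb G X := fun x hx => ⟨x, hx, Or.inl rfl⟩

theorem nb_mono (h : X ⊆ Y) : nb G X ⊆ nb G Y := fun _ ⟨x, hx, hy⟩ => ⟨x, h hx, hy⟩

theorem nb_union : nb G (X ∪ Y) = nb G X ∪ nb G Y := by
  ext z; constructor
  · rintro ⟨x, hx | hx, h⟩
    · exact Or.inl ⟨x, hx, h⟩
    · exact Or.inr ⟨x, hx, h⟩
  · rintro (⟨x, hx, h⟩ | ⟨x, hx, h⟩)
    · exact ⟨x, Or.inl hx, h⟩
    · exact ⟨x, Or.inr hx, h⟩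

theorem mem_nb_singleton : y ∈ nb G {x} ↔ y = x ∨ G.Adj x y := by simp [nb]

theorem mem_nb_singleton_comm : y ∈ nb G {x} ↔ x ∈ nb G {y} := by
  rw [mem_nb_singleton, mem_nb_singleton, G.adj_comm, eq_comm]

theorem mem_nb_of_adj (hx : x ∈ X) (h : G.Adj x y) : y ∈ nb G X := ⟨x, hx, Or.inr h⟩

theorem mem_nb_iff : y ∈ nb G X ↔ ∃ x ∈ X, y ∈ nb G {x} := by
  simp only [mem_nb_singleton]; rfl

theorem ac_iff : AC G A B ↔ ∀ b ∈ B, b ∉ nb G A := by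
  constructor
  · rintro h b hb ⟨a, ha, rfl | h'⟩
    · exact (h _ ha _ hb).1 rfl
    · exact (h _ ha _ hb).2 h'
  · intro h a ha b hb
    exact ⟨fun e => h b hb ⟨a, ha, Or.inl e.symm⟩, fun e => h b hb ⟨a, ha, Or.inr e⟩⟩

theorem AC.symm (h : AC G A B) : AC G B A :=
  fun b hb a ha => ⟨(h a ha b hb).1.symm, fun e => (h a ha b hb).2 e.symm⟩

theorem AC.mono (h : AC G A B) (hX : X ⊆ A) (hY : Y ⊆ B) : AC G X Y :=
  fun a ha b hb => h a (hX ha) b (hY hb)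

theorem AC.union_left (h : AC G A C) (h' : AC G B C) : AC G (A ∪ B) C := by
  rintro a (ha | ha)
  · exact h a ha
  · exact h' a ha

theorem AC.union_right (h : AC G C A) (h' : AC G C B) : AC G C (A ∪ B) :=
  (AC.union_left h.symm h'.symm).symm

theorem AC.disjoint (h : AC G A B) : Disjoint A B :=
  Set.disjoint_left.2 fun a ha hb => (h a ha a hb).1 rfl

theorem ac_empty_left : AC G ∅ A := fun _ h => h.elim

theorem ac_of_forall_singleton (h : ∀ a ∈ A, AC G {a} B) : AC G A B :=
  fun a ha => h a ha a rfl

theorem AC.singleton_of_mem (h : AC G A B) (hx : x ∈ A) : AC G {x} B :=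
  h.mono (by simpa using hx) subset_rfl

theorem conn_singleton (x : W) : Conn G {x} := by
  refine ⟨⟨x, rfl⟩, fun A hA ⟨a, ha⟩ ⟨b, hb, hb'⟩ => ?_⟩
  have h1 := hA ha
  rw [Set.mem_singleton_iff] at h1 hb
  subst h1; subst hb
  exact (hb' ha).elim

theorem Conn.nonempty (h : Conn G X) : X.Nonempty := h.1

/-- A union of connected sets that all touch a common connected part is connected. -/
theorem Conn.iUnion {ι : Type*} {Z : Set W} {π : ι → Set W} (hZ : Conn G Z)
    (h : ∀ i, Conn G (π i)) (ht : ∀ i, ∃ x ∈ Z, x ∈ nb G (π i)) :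
    Conn G (Z ∪ ⋃ i, π i) := by
  refine ⟨hZ.1.mono Set.subset_union_left, fun A hA ⟨a, ha⟩ ⟨b, hb, hb'⟩ => ?_⟩
  by_contra hcon
  push Not at hcon
  have key : ∀ Q ⊆ Z ∪ ⋃ i, π i, Conn G Q → (∃ q ∈ Q, q ∈ A) → Q ⊆ A := by
    rintro Q hQ hc ⟨q, hq, hqA⟩ z hz
    by_contra hzA
    obtain ⟨x, hx, y, hy, hxy⟩ := hc.2 (Q ∩ A) Set.inter_subset_left ⟨q, hq, hqA⟩
      ⟨z, hz, fun h => hzA h.2⟩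
    exact hcon x hx.2 y ⟨hQ hy.1, fun h => hy.2 ⟨hy.1, h⟩⟩ hxy
  have hpi : ∀ i, π i ⊆ Z ∪ ⋃ i, π i := fun i =>
    (Set.subset_iUnion π i).trans Set.subset_union_right
  have link : ∀ x ∈ Z ∪ ⋃ i, π i, ∀ y ∈ Z ∪ ⋃ i, π i, G.Adj x y → x ∈ A → y ∈ A := by
    intro x _ y hy hxy hx
    by_contra h
    exact hcon x hx y ⟨hy, h⟩ hxy
  have step1 : ∀ i, (∃ q ∈ π i, q ∈ A) → Z ⊆ A := by
    intro i hi
    have := key _ (hpi i) (h i) hi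
    obtain ⟨x, hx, y, hy, hxy⟩ := ht i
    refine key _ Set.subset_union_left hZ ⟨x, hx, ?_⟩
    rcases hxy with rfl | hxy
    · exact this hy
    · exact link y (hpi i hy) x (Or.inl hx) hxy (this hy)
  have hZA : Z ⊆ A := by
    rcases hA ha with h1 | h1
    · exact key _ Set.subset_union_left hZ ⟨a, h1, ha⟩
    · obtain ⟨i, hi⟩ := Set.mem_iUnion.1 h1
      exact step1 i ⟨a, hi, ha⟩
  rcases hb with h1 | h1
  · exact hb' (hZA h1)
  · obtain ⟨i, hi⟩ := Set.mem_iUnion.1 h1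
    obtain ⟨x, hx, y, hy, hxy⟩ := ht i
    refine hb' (key _ (hpi i) (h i) ⟨y, hy, ?_⟩ hi)
    rcases hxy with rfl | hxy
    · exact hZA hx
    · exact link x (Or.inl hx) y (hpi i hy) hxy.symm (hZA hx)

theorem Conn.union (hX : Conn G X) (hY : Conn G Y) (h : ∃ x ∈ X, x ∈ nb G Y) :
    Conn G (X ∪ Y) := by
  have := Conn.iUnion (ι := Unit) (π := fun _ => Y) hX (fun _ => hY) (fun _ => h)
  simpa [Set.iUnion_const] using this

theorem Conn.insert (hX : Conn G X) (h : ∃ x ∈ X, G.Adj x y) : Conn G (insert y X) := by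
  obtain ⟨x, hx, hxy⟩ := h
  exact (conn_singleton y).union hX ⟨y, rfl, mem_nb_of_adj hx hxy⟩

theorem Conn.exists_adj_diff (hX : Conn G X) (hY : Y.Nonempty) (hYX : Y ⊆ X) (hne : Y ≠ X) :
    ∃ x ∈ X \ Y, ∃ y ∈ Y, G.Adj y x := by
  obtain ⟨a, ha, b, hb, hab⟩ := hX.2 Y hYX hY (by
    rw [Set.sdiff_nonempty]; exact fun h => hne (hYX.antisymm h))
  exact ⟨b, hb, a, ha, hab⟩

/-- A maximal connected subset of `B` through a given point is anticomplete to the rest. -/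
theorem exists_component [Finite W] (hx : x ∈ B) :
    ∃ Z ⊆ B, x ∈ Z ∧ Conn G Z ∧ AC G Z (B \ Z) := by
  obtain ⟨Z, hZ⟩ := (Set.toFinite {Z : Set W | Z ⊆ B ∧ x ∈ Z ∧ Conn G Z}).exists_maximal
    ⟨{x}, by simpa using hx, rfl, conn_singleton x⟩
  refine ⟨Z, hZ.1.1, hZ.1.2.1, hZ.1.2.2, fun a ha b hb => ⟨fun e => hb.2 (e ▸ ha), fun h => ?_⟩⟩
  exact hb.2 (hZ.2 (y := Insert.insert b Z) ⟨Set.insert_subset hb.1 hZ.1.1, Or.inr hZ.1.2.1,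
    hZ.1.2.2.insert ⟨a, ha, h⟩⟩ (Set.subset_insert _ _) (Set.mem_insert _ _))

end Basics

/-! ### Weights: heavy sets, gradual growth and separation. -/

section Weight

variable {W : Type v} {G : SimpleGraph W} {μ : Set W → ℝ} {ε : ℝ}

namespace Wt

theorem pos (h : Wt G μ ε) : 0 < ε := by
  rcases h.ac ∅ ∅ ac_empty_left with h' | h' <;> rwa [h.empty] at h'

theorem nonempty_of_pos (h : Wt G μ ε) {X : Set W} (hX : 0 < μ X) : X.Nonempty := by
  by_contra hne
  rw [Set.not_nonempty_iff_eq_empty] at hne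
  rw [hne, h.empty] at hX
  exact lt_irrefl _ hX

theorem sub_le_diff (h : Wt G μ ε) (X Y : Set W) : μ X - μ Y ≤ μ (X \ Y) := by
  have := h.union_le (X \ Y) Y
  have := h.mono (X := X) (Y := X \ Y ∪ Y) (by simp)
  linarith

theorem exists_inter_nb (h : Wt G μ ε) {X Y : Set W} (hX : ε ≤ μ X) (hY : ε ≤ μ Y) :
    ∃ y ∈ Y, y ∈ nb G X := by
  by_contra hcon
  push Not at hcon
  rcases h.ac X Y (ac_iff.2 hcon) with h' | h' <;> linarith

theorem compl_nb_lt (h : Wt G μ ε) {X : Set W} (hX : ε ≤ μ X) : μ (nb G X)ᶜ < ε := by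
  rcases h.ac X (nb G X)ᶜ (ac_iff.2 fun _ hb => hb) with h' | h'
  · linarith
  · exact h'

theorem biUnion_le (h : Wt G μ ε) {ι : Type*} (s : Finset ι) (f : ι → Set W) (c : ℝ)
    (hf : ∀ i ∈ s, μ (f i) ≤ c) : μ (⋃ i ∈ s, f i) ≤ s.card * c := by
  classical
  induction s using Finset.induction_on with
  | empty => simp [h.empty]
  | insert a s ha ih =>
    rw [Finset.set_biUnion_insert, Finset.card_insert_of_notMem ha]
    have h1 := h.union_le (f a) (⋃ i ∈ s, f i)
    have h2 := ih fun i hi => hf i (Finset.mem_insert_of_mem hi)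
    have h3 := hf a (Finset.mem_insert_self _ _)
    push_cast
    linarith

/-- A set of large weight contains a connected set of large weight. -/
theorem exists_conn [Finite W] (h : Wt G μ ε) {B : Set W} {κ : ℝ} (hκ : ε ≤ κ)
    (hB : 3 * κ ≤ μ B) : ∃ Z ⊆ B, Conn G Z ∧ κ ≤ μ Z := by
  by_contra hcon
  push Not at hcon
  have hpos := h.pos
  -- `X` is a maximal part of weight below `κ` with no edges to the rest of `B`. Adding one more
  -- component, itself lighter than `κ`, gives weight between `κ` and `2 * κ`; more than `κ` is left
  -- over on the other side, against coherence.
  obtain ⟨X, ⟨hXB, hXac, hXκ⟩, hmax⟩ :=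
    (Set.toFinite {X : Set W | X ⊆ B ∧ AC G X (B \ X) ∧ μ X < κ}).exists_maximal
      ⟨∅, Set.empty_subset _, ac_empty_left, by rw [h.empty]; linarith⟩
  have h1 := h.sub_le_diff B X
  obtain ⟨v, hv⟩ := h.nonempty_of_pos (X := B \ X) (by linarith)
  obtain ⟨Z, hZB, hvZ, hZc, hZac⟩ := exists_component (G := G) hv
  have h2 := hcon Z (hZB.trans Set.sdiff_subset) hZc
  have hac : AC G (X ∪ Z) (B \ (X ∪ Z)) := by
    refine AC.union_left (hXac.mono subset_rfl ?_) (hZac.mono subset_rfl ?_)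
    · exact Set.sdiff_subset_sdiff_right Set.subset_union_left
    · rw [Set.sdiff_sdiff]
  have h3 := h.union_le X Z
  have h4 := h.sub_le_diff B (X ∪ Z)
  have h5 : κ ≤ μ (X ∪ Z) := by
    by_contra hlt
    exact (hZB hvZ).2 (hmax ⟨Set.union_subset hXB (hZB.trans Set.sdiff_subset), hac,
      not_le.1 hlt⟩ Set.subset_union_left (Or.inr hvZ))
  rcases h.ac _ _ hac with h' | h' <;> linarith

end Wt

/-- Growing an admissible set step by step until one of finitely many functionals gets large. -/
theorem exists_trim {ι α : Type*} [Finite α] (adm : Set α → Prop) (F : ι → Set α → ℝ) (J : Set ι)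
    {X₀ X₁ : Set α} {η c : ℝ} (hX₀ : adm X₀) (h01 : X₀ ⊆ X₁) (h0 : ∀ j ∈ J, F j X₀ < η)
    (h1 : ∃ j ∈ J, η ≤ F j X₁)
    (hgrow : ∀ X, adm X → X₀ ⊆ X → X ⊆ X₁ → X ≠ X₁ →
      ∃ Y, adm Y ∧ X ⊆ Y ∧ X ≠ Y ∧ Y ⊆ X₁ ∧ ∀ j ∈ J, F j Y ≤ F j X + c) :
    ∃ Y, adm Y ∧ X₀ ⊆ Y ∧ Y ⊆ X₁ ∧ (∃ j ∈ J, η ≤ F j Y) ∧ ∀ j ∈ J, F j Y ≤ η + c := by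
  -- Take a maximal admissible set with every functional below `η`. One further growth step must
  -- reach `η` somewhere, yet raises each functional by at most `c`.
  obtain ⟨X, ⟨hXa, h0X, hXX, hXF⟩, hmax⟩ :=
    (Set.toFinite {X : Set α | adm X ∧ X₀ ⊆ X ∧ X ⊆ X₁ ∧ ∀ j ∈ J, F j X < η}).exists_maximal
      ⟨X₀, hX₀, subset_rfl, h01, h0⟩
  obtain ⟨Y, hY, hXY, hne, hYX, hF⟩ := hgrow X hXa h0X hXX (by
    rintro rfl
    obtain ⟨j, hj, h⟩ := h1
    exact (hXF j hj).not_ge h)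
  refine ⟨Y, hY, h0X.trans hXY, hYX, ?_, fun j hj => (hF j hj).trans (by
    have := hXF j hj; linarith)⟩
  by_contra hcon
  push Not at hcon
  exact hne (hXY.antisymm (hmax ⟨hY, h0X.trans hXY, hYX, hcon⟩ hXY))

/-- Heavy sets can be shrunk so that given maps with light fibres take distinct values on
distinct ones of them. -/
theorem Wt.exists_separate [Finite W] (h : Wt G μ ε) {ι : Type*} (I : Finset ι) :
    ∀ (S : ι → Set W) (g : ι → W → W) (θ : ℝ),
      (∀ a ∈ I, θ ≤ μ (S a)) → (∀ a ∈ I, ∀ y, μ {e ∈ S a | g a e = y} ≤ ε) →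
      ε * (4 * 2 ^ I.card) ≤ θ →
      ∃ T : ι → Set W, (∀ a, T a ⊆ S a) ∧ (∀ a ∈ I, θ / (4 * 2 ^ I.card) ≤ μ (T a)) ∧
        ∀ a ∈ I, ∀ b ∈ I, a ≠ b → ∀ e ∈ T a, ∀ e' ∈ T b, g a e ≠ g b e' := by
  classical
  induction hn : I.card generalizing I with
  | zero =>
    intro S g θ _ _ _
    rw [Finset.card_eq_zero] at hn
    subst hn
    exact ⟨S, fun _ => subset_rfl, by simp, by simp⟩
  | succ n ih =>
    intro S g θ hS hg hθ
    have hpos := h.pos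
    have h2n : (1 : ℝ) ≤ 2 ^ n := one_le_pow₀ (by norm_num)
    rw [pow_succ] at hθ ⊢
    have hθpos : 0 < θ := lt_of_lt_of_le (by positivity) hθ
    have hεθ : ε * 8 ≤ θ := by nlinarith
    -- Values are collected one by one into `Y` until some `a₀` has a quarter of its weight over
    -- `Y`. Then `a₀` keeps the part over `Y` and all others the part off `Y`, still of weight at
    -- least `θ / 2`, and the induction continues with those.
    obtain ⟨Y, -, -, -, ⟨a₀, ha₀, hY₀⟩, hY⟩ := exists_trim (α := W) (fun _ => True)
      (fun a Y => μ {e ∈ S a | g a e ∈ Y}) (I : Set ι) (X₀ := ∅) (X₁ := Set.univ)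
      (η := θ / 4) (c := ε) trivial (Set.empty_subset _)
      (by intro j _; simp [h.empty]; linarith)
      (by
        obtain ⟨a, ha⟩ := (Finset.card_pos (s := I)).1 (by omega)
        exact ⟨a, ha, by simpa using le_trans (by linarith) (hS a ha)⟩)
      (by
        intro X _ _ _ hX
        obtain ⟨y, hy⟩ := (Set.ne_univ_iff_exists_notMem X).1 hX
        refine ⟨insert y X, trivial, Set.subset_insert _ _, fun e => hy (e ▸ Set.mem_insert _ _),
          Set.subset_univ _, fun j hj => ?_⟩
        have : {e ∈ S j | g j e ∈ insert y X} =
            {e ∈ S j | g j e ∈ X} ∪ {e ∈ S j | g j e = y} := by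
          ext e; simp only [Set.mem_insert_iff, Set.mem_ofPred_eq, Set.mem_union]; tauto
        rw [this]
        exact (h.union_le _ _).trans (by linarith [hg j hj y]))
    have hn' : (I.erase a₀).card = n := by
      rw [Finset.card_erase_of_mem (by simpa using ha₀), hn]; rfl
    obtain ⟨T, hTS, hTμ, hT⟩ := ih (I.erase a₀) hn' (fun a => S a \ {e ∈ S a | g a e ∈ Y}) g (θ / 2)
      (by
        intro a ha
        have h1 := h.sub_le_diff (S a) {e ∈ S a | g a e ∈ Y}
        have h2 := hS a (Finset.mem_of_mem_erase ha)
        have h3 := hY a (Finset.mem_of_mem_erase ha)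
        linarith)
      (by
        intro a ha y
        refine (h.mono ?_).trans (hg a (Finset.mem_of_mem_erase ha) y)
        rintro e ⟨h1, h2⟩
        exact ⟨h1.1, h2⟩)
      (by linarith)
    have hbound : θ / (4 * (2 ^ n * 2)) = θ / 2 / (4 * 2 ^ n) := by field_simp
    refine ⟨fun a => if a = a₀ then {e ∈ S a | g a e ∈ Y} else T a, ?_, ?_, ?_⟩
    · intro a
      by_cases ha : a = a₀
      · simp only [ha, if_true]; exact fun e he => he.1
      · simp only [ha, if_false]; exact (hTS a).trans Set.sdiff_subset
    · intro a ha
      by_cases ha' : a = a₀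
      · subst ha'
        simp only [if_true]
        refine le_trans ?_ hY₀
        apply div_le_div_of_nonneg_left hθpos.le (by norm_num) (by nlinarith)
      · simp only [ha', if_false]
        rw [hbound]
        exact hTμ a (Finset.mem_erase.2 ⟨ha', ha⟩)
    · intro a ha b hb hab e he e' he'
      by_cases ha' : a = a₀
      · subst ha'
        simp only [if_true] at he
        simp only [hab.symm, if_false] at he'
        intro heq
        exact (hTS b he').2 ⟨(hTS b he').1, heq ▸ he.2⟩
      · by_cases hb' : b = a₀
        · subst hb'
          simp only [if_true] at he'
          simp only [hab, if_false] at he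
          intro heq
          exact (hTS a he).2 ⟨(hTS a he).1, heq ▸ he'.2⟩
        · simp only [ha', hb', if_false] at he he'
          exact hT a (Finset.mem_erase.2 ⟨ha', ha⟩) b (Finset.mem_erase.2 ⟨hb', hb⟩) hab e he e' he'

end Weight

/-! ### The combinatorial game. -/

/-- The rules of a game on finitely many objects `j`, each with a position `p j` and a rank `r j`.
A rank is complete if it is `m` modulo `m + 1`. -/
structure Game {ι : Type*} [DecidableEq ι] (m F : ℕ)
    (Good : ℕ → Finset ι → (ι → ℕ) → (ι → ℕ) → Prop) : Prop where
  drop : ∀ {n J p r}, Good n J p r → ∀ J' ⊆ J, Good n J' p r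
  feed : ∀ {n J p r}, n < F → Good n J p r → ∀ s ∈ J, (∃ t ∈ J, t ≠ s) → ∃ t ∈ J, t ≠ s ∧
    ((r t % (m + 1) < m → Good (n + 1) (J.erase s) p (Function.update r t (r t + 1))) ∨
      ∃ i < p t, Good (n + 1) J (Function.update p s i) (Function.update r s 1))
  push : ∀ {n J p r}, n < F → Good n J p r → ∀ s ∈ J, (∃ t ∈ J, t ≠ s) → r s % (m + 1) = m →
    (∃ t ∈ J, t ≠ s ∧ Good (n + 1) (J.erase s) p (Function.update r t (r s + 1)) ∧
      (r t % (m + 1) < m → Good (n + 1) (J.erase s) p (Function.update r t (r t + 1)))) ∨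
    ∃ i, (∃ t ∈ J, i < p t) ∧
      Good (n + 1) J (Function.update p s i) (Function.update r s (r s + 1))

section Game

variable {ι : Type*} [DecidableEq ι]

theorem sum_erase_update (w : ℕ → ℕ → ℕ) {J : Finset ι} {p r : ι → ℕ} {s t : ι} (hs : s ∈ J)
    (ht : t ∈ J) (hts : t ≠ s) (a : ℕ) :
    ∃ c, ∑ j ∈ J, w (p j) (r j) = w (p s) (r s) + w (p t) (r t) + c ∧
      ∑ j ∈ J.erase s, w (p j) (Function.update r t a j) = w (p t) a + c := by
  have ht' : t ∈ J.erase s := Finset.mem_erase.2 ⟨hts, ht⟩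
  refine ⟨∑ j ∈ (J.erase s).erase t, w (p j) (r j), ?_, ?_⟩
  · rw [← Finset.add_sum_erase J _ hs, ← Finset.add_sum_erase _ _ ht', add_assoc]
  · rw [← Finset.add_sum_erase _ _ ht', Function.update_self]
    congr 1
    refine Finset.sum_congr rfl fun j hj => ?_
    rw [Function.update_of_ne (Finset.ne_of_mem_erase hj)]

theorem sum_update_update (w : ℕ → ℕ → ℕ) {J : Finset ι} {p r : ι → ℕ} {s : ι} (hs : s ∈ J)
    (i a : ℕ) :
    ∃ c, ∑ j ∈ J, w (p j) (r j) = w (p s) (r s) + c ∧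
      ∑ j ∈ J, w (Function.update p s i j) (Function.update r s a j) = w i a + c := by
  refine ⟨∑ j ∈ J.erase s, w (p j) (r j), ?_, ?_⟩
  · rw [← Finset.add_sum_erase J _ hs]
  · rw [← Finset.add_sum_erase _ _ hs, Function.update_self, Function.update_self]
    congr 1
    refine Finset.sum_congr rfl fun j hj => ?_
    rw [Function.update_of_ne (Finset.ne_of_mem_erase hj),
      Function.update_of_ne (Finset.ne_of_mem_erase hj)]

/-- The type `(k, a)` lies strictly beyond `(k₀, r₀)`. -/
def Beyond (k₀ r₀ k a : ℕ) : Prop := k < k₀ ∨ (k = k₀ ∧ r₀ < a)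

/-- The weight that does not decrease in the game. -/
def potential (k₀ r₀ k a : ℕ) : ℕ := if k = k₀ ∧ a = r₀ then 1 else 3 ^ a

/-- The weight that decreases in the game. -/
def remaining (k₀ r₀ R k a : ℕ) : ℕ := if k = k₀ ∧ a = r₀ then 2 * R + 3 else R + 1 - a

theorem potential_le (k₀ r₀ k a : ℕ) : potential k₀ r₀ k a ≤ 3 ^ a := by
  unfold potential
  split_ifs
  · exact Nat.one_le_pow _ _ (by norm_num)
  · exact le_rfl

theorem potential_of_beyond {k₀ r₀ k a : ℕ} (h : Beyond k₀ r₀ k a) :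
    potential k₀ r₀ k a = 3 ^ a :=
  if_neg (by rintro ⟨rfl, rfl⟩; rcases h with h | h <;> omega)

theorem remaining_of_beyond {k₀ r₀ R k a : ℕ} (h : Beyond k₀ r₀ k a) :
    remaining k₀ r₀ R k a = R + 1 - a :=
  if_neg (by rintro ⟨rfl, rfl⟩; rcases h with h | h <;> omega)

theorem le_remaining (k₀ r₀ R k a : ℕ) : R + 1 - a ≤ remaining k₀ r₀ R k a := by
  unfold remaining; split_ifs <;> omega

/-- Play until no object has the starting type and no rank is complete, or a rank reaches `R`. The
moves can be chosen so that the potential never decreases: absorbing a starting object costs `1`,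
and `3 ^ a + 3 ^ b ≤ 3 ^ (c + 1)` whenever `a, b ≤ c`. The other weight drops with each move, so its
initial value bounds the number of moves. -/
theorem Game.run {m F : ℕ} {Good : ℕ → Finset ι → (ι → ℕ) → (ι → ℕ) → Prop}
    (hG : Game m F Good) {k₀ r₀ R n₀ : ℕ} (hn₀ : 3 ^ R < n₀) :
    ∀ (M n : ℕ) (J : Finset ι) (p r : ι → ℕ), Good n J p r →
      (∀ j ∈ J, (p j = k₀ ∧ r j = r₀) ∨ Beyond k₀ r₀ (p j) (r j)) →
      n₀ ≤ ∑ j ∈ J, potential k₀ r₀ (p j) (r j) →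
      ∑ j ∈ J, remaining k₀ r₀ R (p j) (r j) ≤ M → n + M ≤ F →
      ∃ n' J' p' r', n' ≤ n + M ∧ Good n' J' p' r' ∧ ((∃ j ∈ J', R ≤ r' j) ∨
        ((∀ j ∈ J', Beyond k₀ r₀ (p' j) (r' j) ∧ r' j < R) ∧
          n₀ ≤ ∑ j ∈ J', potential k₀ r₀ (p' j) (r' j))) := by
  intro M
  induction M with
  | zero =>
    intro n J p r hgood hty hΨ hM hF
    refine ⟨n, J, p, r, le_rfl, hgood, Or.inl ?_⟩
    have hne : J.Nonempty := by
      rw [Finset.nonempty_iff_ne_empty]; rintro rfl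
      exact Nat.not_lt_zero _ (hn₀.trans_le (by simpa using hΨ))
    obtain ⟨j, hj⟩ := hne
    have h1 := Finset.single_le_sum (f := fun j => remaining k₀ r₀ R (p j) (r j))
      (fun _ _ => Nat.zero_le _) hj
    have h2 := le_remaining k₀ r₀ R (p j) (r j)
    exact ⟨j, hj, by omega⟩
  | succ M ih =>
    intro n J p r hgood hty hΨ hM hF
    by_cases hbig : ∃ j ∈ J, R ≤ r j
    · exact ⟨n, J, p, r, by omega, hgood, Or.inl hbig⟩
    push Not at hbig
    have hpow : ∀ a b, a ≤ b → 3 ^ a ≤ 3 ^ b := fun a b h => Nat.pow_le_pow_right (by norm_num) h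
    have hpos3 : ∀ a, 1 ≤ 3 ^ a := fun a => Nat.one_le_pow _ _ (by norm_num)
    -- A single object of rank below `R` cannot carry a potential above `3 ^ R`.
    have hother : ∀ s ∈ J, ∃ t ∈ J, t ≠ s := by
      intro s hs
      by_contra hcon
      push Not at hcon
      have hJ : J = {s} := Finset.eq_singleton_iff_unique_mem.2 ⟨hs, hcon⟩
      rw [hJ, Finset.sum_singleton] at hΨ
      have := potential_le k₀ r₀ (p s) (r s)
      have := hpow _ _ (hbig s hs).le
      omega
    -- applying the induction hypothesis after a root move
    have root : ∀ s ∈ J, ∀ t ∈ J, t ≠ s → ∀ a,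
        Good (n + 1) (J.erase s) p (Function.update r t a) → r t < a →
        potential k₀ r₀ (p s) (r s) + potential k₀ r₀ (p t) (r t) ≤ 3 ^ a →
        ∃ n' J' p' r', n' ≤ n + (M + 1) ∧ Good n' J' p' r' ∧ ((∃ j ∈ J', R ≤ r' j) ∨
        ((∀ j ∈ J', Beyond k₀ r₀ (p' j) (r' j) ∧ r' j < R) ∧
          n₀ ≤ ∑ j ∈ J', potential k₀ r₀ (p' j) (r' j))) := by
      intro s hs t ht hts a hg hta hpot
      have hb : Beyond k₀ r₀ (p t) a := by
        rcases hty t ht with h | h | h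
        · exact Or.inr ⟨h.1, by omega⟩
        · exact Or.inl h
        · exact Or.inr ⟨h.1, by omega⟩
      obtain ⟨c, hc1, hc2⟩ := sum_erase_update (potential k₀ r₀) (p := p) (r := r) hs ht hts a
      obtain ⟨d, hd1, hd2⟩ := sum_erase_update (remaining k₀ r₀ R) (p := p) (r := r) hs ht hts a
      rw [potential_of_beyond hb] at hc2
      rw [remaining_of_beyond hb] at hd2
      have h1 := le_remaining k₀ r₀ R (p s) (r s)
      have h2 := le_remaining k₀ r₀ R (p t) (r t)
      have h3 := hbig s hs
      have h4 := hbig t ht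
      obtain ⟨n', J', p', r', hn', h⟩ := ih (n + 1) (J.erase s) p (Function.update r t a) hg
        (by
          intro j hj
          by_cases hjt : j = t
          · subst hjt; rw [Function.update_self]; exact Or.inr hb
          · rw [Function.update_of_ne hjt]; exact hty j (Finset.mem_of_mem_erase hj))
        (by omega) (by omega) (by omega)
      exact ⟨n', J', p', r', by omega, h⟩
    have lower : ∀ s ∈ J, ∀ i, (∃ t ∈ J, i < p t) → ∀ a,
        Good (n + 1) J (Function.update p s i) (Function.update r s a) →
        potential k₀ r₀ (p s) (r s) ≤ 3 ^ a → R + 1 - a < remaining k₀ r₀ R (p s) (r s) →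
        ∃ n' J' p' r', n' ≤ n + (M + 1) ∧ Good n' J' p' r' ∧ ((∃ j ∈ J', R ≤ r' j) ∨
        ((∀ j ∈ J', Beyond k₀ r₀ (p' j) (r' j) ∧ r' j < R) ∧
          n₀ ≤ ∑ j ∈ J', potential k₀ r₀ (p' j) (r' j))) := by
      rintro s hs i ⟨t, ht, hit⟩ a hg hpot hrem
      have hb : Beyond k₀ r₀ i a := by
        rcases hty t ht with h | h | h
        · exact Or.inl (by omega)
        · exact Or.inl (by omega)
        · exact Or.inl (by omega)
      obtain ⟨c, hc1, hc2⟩ := sum_update_update (potential k₀ r₀) (p := p) (r := r) hs i a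
      obtain ⟨d, hd1, hd2⟩ := sum_update_update (remaining k₀ r₀ R) (p := p) (r := r) hs i a
      rw [potential_of_beyond hb] at hc2
      rw [remaining_of_beyond hb] at hd2
      obtain ⟨n', J', p', r', hn', h⟩ := ih (n + 1) J (Function.update p s i)
        (Function.update r s a) hg
        (by
          intro j hj
          by_cases hjt : j = s
          · subst hjt; rw [Function.update_self, Function.update_self]; exact Or.inr hb
          · rw [Function.update_of_ne hjt, Function.update_of_ne hjt]; exact hty j hj)
        (by omega) (by omega) (by omega)
      exact ⟨n', J', p', r', by omega, h⟩
    by_cases hcomp : ∃ s ∈ J, r s % (m + 1) = m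
    -- Push a complete object of greatest rank. If the object `t` that is met has larger rank, then
    -- by maximality `t` is incomplete and can take a blob; otherwise the caterpillar of `s` is
    -- prolonged. Either way the larger of the two ranks goes up by one.
    · obtain ⟨s, hs, hmax⟩ := (J.filter fun s => r s % (m + 1) = m).exists_max_image r
        (by obtain ⟨s, hs, h⟩ := hcomp; exact ⟨s, Finset.mem_filter.2 ⟨hs, h⟩⟩)
      rw [Finset.mem_filter] at hs
      have hsb := hbig s hs.1
      rcases hG.push (by omega) hgood s hs.1 (hother s hs.1) hs.2 with
        ⟨t, ht, hts, hsp, hbl⟩ | ⟨i, hi, hg⟩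
      · have h1 := potential_le k₀ r₀ (p s) (r s)
        have h2 := potential_le k₀ r₀ (p t) (r t)
        by_cases hle : r t ≤ r s
        · refine root s hs.1 t ht hts _ hsp (by omega) ?_
          have := hpow _ _ hle
          rw [pow_succ]; omega
        · refine root s hs.1 t ht hts _ (hbl ?_) (by omega) ?_
          · have h3 := Nat.mod_lt (r t) (Nat.succ_pos m)
            have h4 : r t % (m + 1) ≠ m := fun h =>
              hle (hmax t (Finset.mem_filter.2 ⟨ht, h⟩))
            simp only [Nat.succ_eq_add_one] at h3
            omega
          · have := hpow _ _ (not_le.1 hle).le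
            rw [pow_succ]; omega
      · refine lower s hs.1 i hi _ hg ?_ ?_
        · exact (potential_le _ _ _ _).trans (hpow _ _ (Nat.le_succ _))
        · have := le_remaining k₀ r₀ R (p s) (r s)
          omega
    · have hinc : ∀ j ∈ J, r j % (m + 1) < m := by
        intro j hj
        have h3 := Nat.mod_lt (r j) (Nat.succ_pos m)
        have h4 : r j % (m + 1) ≠ m := fun h => hcomp ⟨j, hj, h⟩
        simp only [Nat.succ_eq_add_one] at h3
        omega
      by_cases hA : ∃ s ∈ J, p s = k₀ ∧ r s = r₀
      · obtain ⟨s, hs, hsA⟩ := hA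
        have hps : potential k₀ r₀ (p s) (r s) = 1 := if_pos hsA
        have hrs : remaining k₀ r₀ R (p s) (r s) = 2 * R + 3 := if_pos hsA
        obtain ⟨t, ht, hts, hg | ⟨i, hi, hg⟩⟩ := hG.feed (by omega) hgood s hs (hother s hs)
        · refine root s hs t ht hts _ (hg (hinc t ht)) (by omega) ?_
          have h2 := potential_le k₀ r₀ (p t) (r t)
          have := hpos3 (r t)
          rw [pow_succ]; omega
        · exact lower s hs i ⟨t, ht, hi⟩ _ hg (by rw [hps]; norm_num) (by rw [hrs]; omega)
      · refine ⟨n, J, p, r, by omega, hgood, Or.inr ⟨fun j hj => ⟨?_, hbig j hj⟩, hΨ⟩⟩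
        exact (hty j hj).resolve_left fun h => hA ⟨j, hj, h⟩

/-- From sufficiently many objects of one type the game reaches an object of high rank. -/
theorem Game.exists_rank (ι : Type*) [DecidableEq ι] (m R : ℕ) : ∀ k₀ r₀ : ℕ,
    ∃ n₀ F₀ : ℕ, ∀ (F : ℕ) (Good : ℕ → Finset ι → (ι → ℕ) → (ι → ℕ) → Prop), Game m F Good →
      ∀ n J p r, Good n J p r → (∀ j ∈ J, p j = k₀ ∧ r j = r₀) → n₀ ≤ J.card → n + F₀ ≤ F →
      ∃ n' J' p' r', n' ≤ F ∧ Good n' J' p' r' ∧ ∃ j ∈ J', R ≤ r' j := by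
  suffices H : ∀ q : ℕ ×ₗ ℕ, ∀ k₀ r₀, toLex (k₀, R - r₀) = q →
    ∃ n₀ F₀ : ℕ, ∀ (F : ℕ) (Good : ℕ → Finset ι → (ι → ℕ) → (ι → ℕ) → Prop), Game m F Good →
      ∀ n J p r, Good n J p r → (∀ j ∈ J, p j = k₀ ∧ r j = r₀) → n₀ ≤ J.card → n + F₀ ≤ F →
      ∃ n' J' p' r', n' ≤ F ∧ Good n' J' p' r' ∧ ∃ j ∈ J', R ≤ r' j by
    exact fun k₀ r₀ => H _ k₀ r₀ rfl
  intro q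
  -- Lexicographic induction: the types beyond `(k₀, r₀)` of rank below `R` have a smaller position,
  -- or the same position and a smaller `R - r₀`.
  induction q using WellFoundedLT.induction with
  | ind q ih =>
  intro k₀ r₀ hq
  by_cases hR : R ≤ r₀
  · refine ⟨1, 0, fun F Good _ n J p r hg hty hJ hF => ⟨n, J, p, r, by omega, hg, ?_⟩⟩
    obtain ⟨j, hj⟩ := Finset.card_pos.1 hJ
    exact ⟨j, hj, by rw [(hty j hj).2]; exact hR⟩
  have ih' : ∀ k a : ℕ, ∃ n₀ F₀ : ℕ, Beyond k₀ r₀ k a → a < R →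
      ∀ (F : ℕ) (Good : ℕ → Finset ι → (ι → ℕ) → (ι → ℕ) → Prop), Game m F Good →
      ∀ n J p r, Good n J p r → (∀ j ∈ J, p j = k ∧ r j = a) → n₀ ≤ J.card → n + F₀ ≤ F →
      ∃ n' J' p' r', n' ≤ F ∧ Good n' J' p' r' ∧ ∃ j ∈ J', R ≤ r' j := by
    intro k a
    by_cases h : Beyond k₀ r₀ k a ∧ a < R
    · obtain ⟨n₀, F₀, H⟩ := ih (toLex (k, R - a)) (by
        rw [← hq, Prod.Lex.toLex_lt_toLex]
        rcases h.1 with h' | h'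
        · exact Or.inl h'
        · exact Or.inr ⟨h'.1, by simp only; omega⟩) k a rfl
      exact ⟨n₀, F₀, fun _ _ => H⟩
    · exact ⟨0, 0, fun h1 h2 => (h ⟨h1, h2⟩).elim⟩
  choose N Φ H using ih'
  set types : Finset (ℕ × ℕ) := Finset.range (k₀ + 1) ×ˢ Finset.range R with htypes
  set N₁ := types.sup fun q => N q.1 q.2 with hN₁
  set Φ₁ := types.sup fun q => Φ q.1 q.2 with hΦ₁
  -- An object of rank below `R` contributes at most `3 ^ R`, so preserving a potential of `n₀`
  -- leaves more than `types.card * N₁` objects. By pigeonhole, more than `N₁` of them share a type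
  -- that lies beyond the starting one.
  set n₀ := 3 ^ R * (types.card * N₁ + 1) + 1 with hn₀
  refine ⟨n₀, n₀ * (2 * R + 3) + Φ₁, fun F Good hG n J p r hg hty hJ hF => ?_⟩
  obtain ⟨J₁, hJ₁, hcard⟩ := Finset.exists_subset_card_eq hJ
  have hty₁ : ∀ j ∈ J₁, p j = k₀ ∧ r j = r₀ := fun j hj => hty j (hJ₁ hj)
  have hpow : 1 ≤ 3 ^ R := Nat.one_le_pow _ _ (by norm_num)
  obtain ⟨n', J', p', r', hn', hg', h⟩ := hG.run (k₀ := k₀) (R := R) (n₀ := n₀)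
    (by rw [hn₀]; nlinarith [Nat.zero_le (types.card * N₁)])
    (n₀ * (2 * R + 3)) n J₁ p r (hG.drop hg _ hJ₁) (fun j hj => Or.inl (hty₁ j hj))
    (by
      unfold potential
      rw [Finset.sum_congr rfl fun j hj => if_pos (hty₁ j hj)]
      simp [hcard])
    (by
      unfold remaining
      rw [Finset.sum_congr rfl fun j hj => if_pos (hty₁ j hj)]
      simp [hcard])
    (by omega)
  rcases h with h | ⟨hbey, hΨ⟩
  · exact ⟨n', J', p', r', by omega, hg', h⟩
  have hJ'card : types.card * N₁ < J'.card := by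
    have h1 : ∑ j ∈ J', potential k₀ r₀ (p' j) (r' j) ≤ J'.card * 3 ^ R := by
      rw [← smul_eq_mul]
      refine Finset.sum_le_card_nsmul _ _ _ fun j hj => ?_
      exact (potential_le _ _ _ _).trans
        (Nat.pow_le_pow_right (by norm_num) (hbey j hj).2.le)
    by_contra hcon
    have : J'.card * 3 ^ R ≤ types.card * N₁ * 3 ^ R := Nat.mul_le_mul_right _ (not_lt.1 hcon)
    rw [hn₀] at hΨ
    nlinarith
  obtain ⟨q, hqt, hq'⟩ := Finset.exists_lt_card_fiber_of_mul_lt_card_of_maps_to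
    (f := fun j => (p' j, r' j)) (s := J') (t := types) (n := N₁)
    (by
      intro j hj
      have h1 := (hbey j hj).1
      simp only [htypes, Finset.mem_product, Finset.mem_range]
      refine ⟨?_, (hbey j hj).2⟩
      rcases h1 with h1 | h1 <;> omega)
    hJ'card
  have hty' : ∀ j ∈ J'.filter fun j => (p' j, r' j) = q, p' j = q.1 ∧ r' j = q.2 := by
    intro j hj
    rw [Finset.mem_filter] at hj
    rw [← hj.2]
    exact ⟨rfl, rfl⟩
  obtain ⟨j₀, hj₀⟩ := Finset.card_pos.1 (lt_of_le_of_lt (Nat.zero_le _) hq')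
  have hj₀' := hty' j₀ hj₀
  have hj₀b := hbey j₀ (Finset.mem_filter.1 hj₀).1
  rw [hj₀'.1, hj₀'.2] at hj₀b
  have hNle : N q.1 q.2 ≤ N₁ := Finset.le_sup (f := fun q : ℕ × ℕ => N q.1 q.2) hqt
  have hΦle : Φ q.1 q.2 ≤ Φ₁ := Finset.le_sup (f := fun q : ℕ × ℕ => Φ q.1 q.2) hqt
  exact H q.1 q.2 hj₀b.1 hj₀b.2 F Good hG n' _ p' r'
    (hG.drop hg' _ (Finset.filter_subset _ _)) hty' (by omega) (by omega)

end Game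

/-! ### Rooted caterpillars. -/

/-- `RC G Bl m r b D`: the set `D` carries a caterpillar of rank `r` rooted at `b`. It is built
from a spine of vertices, each of which is given `m` pendant blobs before the next spine vertex is
added, and apart from these incidences everything is anticomplete. -/
inductive RC {W : Type v} (G : SimpleGraph W) (Bl : Set W → Prop) (m : ℕ) :
    ℕ → W → Set W → Prop
  | base (b : W) : RC G Bl m 0 b ∅
  | blob {r : ℕ} {b : W} {D X : Set W} : RC G Bl m r b D → r % (m + 1) < m → Bl X →
      (∃ x ∈ X, G.Adj b x) → b ∉ X → AC G D X → RC G Bl m (r + 1) b (D ∪ X)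
  | spine {r : ℕ} {b b' : W} {D : Set W} : RC G Bl m r b D → r % (m + 1) = m → G.Adj b' b →
      AC G {b'} D → RC G Bl m (r + 1) b' (insert b D)

section RC

variable {W : Type v} {G : SimpleGraph W} {Bl : Set W → Prop} {m r : ℕ} {b : W} {D : Set W}

theorem RC.conn (hBl : ∀ X, Bl X → Conn G X) (h : RC G Bl m r b D) : Conn G (insert b D) := by
  induction h with
  | base b => simpa using conn_singleton b
  | blob _ _ hX hadj _ _ ih =>
    obtain ⟨x, hx, hbx⟩ := hadj
    rw [← Set.insert_union]
    exact ih.union (hBl _ hX) ⟨_, Set.mem_insert _ _, mem_nb_of_adj hx hbx.symm⟩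
  | spine _ _ hadj _ ih => exact ih.insert ⟨_, Set.mem_insert _ _, hadj.symm⟩

/-- Since `m > 0`, the first step from rank zero must attach a blob, and later steps only enlarge
the set. In the sparse case this puts a core inside every caterpillar, so that a whole caterpillar
can serve as a blob. -/
theorem RC.exists_blob (hm : 0 < m) (h : RC G Bl m r b D) (hr : 1 ≤ r) : ∃ X ⊆ D, Bl X := by
  induction h with
  | base b => omega
  | blob _ _ hX _ _ _ _ => exact ⟨_, Set.subset_union_right, hX⟩
  | @spine r b b' D _ hmod _ _ ih =>
    obtain ⟨X, hX, h⟩ := ih (by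
      rcases Nat.eq_zero_or_pos r with rfl | h
      · simp at hmod; omega
      · exact h)
    exact ⟨X, hX.trans (Set.subset_insert _ _), h⟩

/-- The spine and the blobs of a caterpillar. -/
theorem RC.exists_path (h : RC G Bl m r b D) :
    ∃ (q : ℕ → W) (X : ℕ → ℕ → Set W), q (r / (m + 1)) = b ∧
      (∀ i < r / (m + 1), q i ∈ D) ∧
      (∀ i κ, κ < m → (i < r / (m + 1) ∨ (i = r / (m + 1) ∧ κ < r % (m + 1))) →
        Bl (X i κ) ∧ X i κ ⊆ D ∧ (∃ x ∈ X i κ, G.Adj (q i) x) ∧ q i ∉ X i κ ∧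
          ∀ j ≤ r / (m + 1), j ≠ i → AC G {q j} (X i κ)) ∧
      (∀ i κ i' κ', κ < m → (i < r / (m + 1) ∨ (i = r / (m + 1) ∧ κ < r % (m + 1))) →
        κ' < m → (i' < r / (m + 1) ∨ (i' = r / (m + 1) ∧ κ' < r % (m + 1))) →
        (i, κ) ≠ (i', κ') → AC G (X i κ) (X i' κ')) ∧
      ∀ i j, i < j → j ≤ r / (m + 1) → q i ≠ q j ∧ (G.Adj (q i) (q j) ↔ i + 1 = j) := by
  induction h with
  | base b =>
    refine ⟨fun _ => b, fun _ _ => ∅, rfl, ?_, ?_, ?_, ?_⟩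
    · intro i hi; simp at hi
    · intro i κ _ hi; simp at hi
    · intro i κ i' κ' _ hi; simp at hi
    · intro i j hij hj; simp at hj; omega
  | @blob r b D Y hrc hmod hY hadj hbY hDY ih =>
    obtain ⟨q, X, hqb, hqD, hX, hXX, hq⟩ := ih
    have hmod' : (r + 1) % (m + 1) = r % (m + 1) + 1 := by
      rw [Nat.add_mod, Nat.mod_eq_of_lt (a := 1) (by omega), Nat.mod_eq_of_lt (by omega)]
    have hdiv : (r + 1) / (m + 1) = r / (m + 1) := by
      rw [Nat.succ_div, if_neg, add_zero]
      intro hd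
      have h1 := Nat.mod_eq_zero_of_dvd hd
      omega
    rw [hdiv, hmod']
    set k := r / (m + 1)
    set c := r % (m + 1)
    have hXY : ∀ i κ, κ < m → (i < k ∨ (i = k ∧ κ < c)) → AC G (X i κ) Y := fun i κ h1 h2 =>
      hDY.mono (hX i κ h1 h2).2.1 subset_rfl
    set X' : ℕ → ℕ → Set W := fun i κ => if i = k ∧ κ = c then Y else X i κ with hX'
    have hnew : X' k c = Y := if_pos ⟨rfl, rfl⟩
    have hold : ∀ i κ, (i < k ∨ (i = k ∧ κ < c)) → X' i κ = X i κ := fun i κ h =>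
      if_neg (by omega)
    have hcase : ∀ i κ, (i < k ∨ (i = k ∧ κ < c + 1)) →
        (i < k ∨ (i = k ∧ κ < c)) ∨ (i = k ∧ κ = c) := by omega
    refine ⟨q, X', hqb, fun i hi => Or.inl (hqD i hi), ?_, ?_, hq⟩
    · intro i κ hκ hi
      rcases hcase i κ hi with h | ⟨rfl, rfl⟩
      · rw [hold i κ h]
        obtain ⟨h1, h2, h3⟩ := hX i κ hκ h
        exact ⟨h1, h2.trans Set.subset_union_left, h3⟩
      · rw [hnew, hqb]
        refine ⟨hY, Set.subset_union_right, hadj, hbY, fun j hj hjk => ?_⟩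
        exact hDY.singleton_of_mem (hqD j (by omega))
    · intro i κ i' κ' hκ hi hκ' hi' hne
      rcases hcase i κ hi with h | ⟨rfl, rfl⟩ <;> rcases hcase i' κ' hi' with h' | ⟨rfl, rfl⟩
      · rw [hold i κ h, hold i' κ' h']
        exact hXX i κ i' κ' hκ h hκ' h' hne
      · rw [hold i κ h, hnew]
        exact hXY i κ hκ h
      · rw [hold i' κ' h', hnew]
        exact (hXY i' κ' hκ' h').symm
      · exact (hne rfl).elim
  | @spine r b b' D hrc hmod hadj hac ih =>
    obtain ⟨q, X, hqb, hqD, hX, hXX, hq⟩ := ih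
    have hdvd : m + 1 ∣ r + 1 := by
      have h1 := Nat.div_add_mod r (m + 1)
      exact ⟨r / (m + 1) + 1, by rw [mul_add]; omega⟩
    have hdiv : (r + 1) / (m + 1) = r / (m + 1) + 1 := by
      rw [Nat.succ_div, if_pos hdvd]
    rw [hdiv, Nat.mod_eq_zero_of_dvd hdvd]
    set k := r / (m + 1)
    have hold : ∀ i ≤ k, Function.update q (k + 1) b' i = q i := fun i hi =>
      Function.update_of_ne (by omega) _ _
    have hqi : ∀ i ≤ k, q i ∈ insert b D := by
      intro i hi
      rcases hi.lt_or_eq with h | rfl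
      · exact Or.inr (hqD i h)
      · exact Or.inl hqb
    refine ⟨Function.update q (k + 1) b', X, Function.update_self _ _ _, ?_, ?_, ?_, ?_⟩
    · intro i hi
      rw [hold i (by omega)]
      exact hqi i (by omega)
    · intro i κ hκ hi
      obtain ⟨h1, h2, h3, h4, h5⟩ := hX i κ hκ (by omega)
      rw [hold i (by omega)]
      refine ⟨h1, h2.trans (Set.subset_insert _ _), h3, h4, fun j hj hji => ?_⟩
      rcases hj.lt_or_eq with h | rfl
      · rw [hold j (by omega)]
        exact h5 j (by omega) hji
      · rw [Function.update_self]
        exact hac.mono subset_rfl h2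
    · intro i κ i' κ' hκ hi hκ' hi'
      exact hXX i κ i' κ' hκ (by omega) hκ' (by omega)
    · intro i j hij hj
      rw [hold i (by omega)]
      rcases hj.lt_or_eq with h | rfl
      · rw [hold j (by omega)]
        exact hq i j hij (by omega)
      · rw [Function.update_self]
        rcases (Nat.lt_succ_iff.1 hij).lt_or_eq with h | rfl
        · have h1 := hac b' rfl _ (hqD i h)
          exact ⟨h1.1.symm, fun h' => (h1.2 h'.symm).elim, fun h' => by omega⟩
        · rw [hqb]
          exact ⟨hadj.ne.symm, fun _ => rfl, fun _ => hadj.symm⟩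

end RC

/-! ### Layouts and the moves between them. -/

/-- A position of the game played in a graph. Object `j` has a heavy set `S j` of vertices, for
each `e ∈ S j` a path `ln j e 0 = e, …, ln j e (p j)` whose last vertex is the root of a caterpillar
of rank `r j` inside `U j`; different objects do not interfere. -/
structure Layout {W : Type v} {ι : Type*} (G : SimpleGraph W) (μ : Set W → ℝ) (Bl : Set W → Prop)
    (m pm rm : ℕ) (Reg : Set W) (θ : ℝ) (J : Finset ι) (p r : ι → ℕ) (S U : ι → Set W)
    (ln : ι → W → ℕ → W) : Prop where
  heavy : ∀ j ∈ J, θ ≤ μ (S j)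
  pos_le : ∀ j ∈ J, p j ≤ pm
  le_rank : ∀ j ∈ J, rm ≤ r j
  acU : ∀ i ∈ J, ∀ j ∈ J, i ≠ j → AC G (U i) (U j)
  acln : ∀ i ∈ J, ∀ j ∈ J, i ≠ j → ∀ e ∈ S i, ∀ l ≤ p i, AC G {ln i e l} (U j)
  acself : ∀ i ∈ J, ∀ e ∈ S i, ∀ l < p i, AC G {ln i e l} (U i)
  rc : ∀ i ∈ J, ∀ e ∈ S i, ∃ D ⊆ U i, RC G Bl m (r i) (ln i e (p i)) D
  distinct : ∀ i ∈ J, ∀ j ∈ J, i ≠ j → ∀ e ∈ S i, ∀ e' ∈ S j, ∀ l ≤ p i, ∀ l' ≤ p j,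
    ln i e l ≠ ln j e' l'
  inner : ∀ i ∈ J, ∀ e ∈ S i, ∀ e' ∈ S i, ∀ l ≤ p i, ∀ l' ≤ p i, ln i e l = ln i e' l' → l = l'
  zero : ∀ i ∈ J, ∀ e ∈ S i, ln i e 0 = e
  adj : ∀ i ∈ J, ∀ e ∈ S i, ∀ l < p i, G.Adj (ln i e l) (ln i e (l + 1))
  lnReg : ∀ i ∈ J, ∀ e ∈ S i, ∀ l ≤ p i, ln i e l ∈ Reg
  UReg : ∀ i ∈ J, U i ⊆ Reg

/-- The existence of a layout with the given data. -/
def Good {W : Type v} {ι : Type*} (G : SimpleGraph W) (μ : Set W → ℝ) (Bl : Set W → Prop)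
    (m pm rm : ℕ) (Reg : Set W) (θ : ℝ) (J : Finset ι) (p r : ι → ℕ) : Prop :=
  ∃ (S U : ι → Set W) (ln : ι → W → ℕ → W), Layout G μ Bl m pm rm Reg θ J p r S U ln

section Layout

variable {W : Type v} {ι : Type*} {G : SimpleGraph W} {μ : Set W → ℝ} {Bl : Set W → Prop}
  {m pm rm : ℕ} {Reg : Set W} {θ : ℝ} {J : Finset ι} {p r : ι → ℕ} {S U : ι → Set W}
  {ln : ι → W → ℕ → W}

theorem Layout.mono (h : Layout G μ Bl m pm rm Reg θ J p r S U ln) {J' : Finset ι} (hJ : J' ⊆ J) :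
    Layout G μ Bl m pm rm Reg θ J' p r S U ln where
  heavy j hj := h.heavy j (hJ hj)
  pos_le j hj := h.pos_le j (hJ hj)
  le_rank j hj := h.le_rank j (hJ hj)
  acU i hi j hj := h.acU i (hJ hi) j (hJ hj)
  acln i hi j hj := h.acln i (hJ hi) j (hJ hj)
  acself i hi := h.acself i (hJ hi)
  rc i hi := h.rc i (hJ hi)
  distinct i hi j hj := h.distinct i (hJ hi) j (hJ hj)
  inner i hi := h.inner i (hJ hi)
  zero i hi := h.zero i (hJ hi)
  adj i hi := h.adj i (hJ hi)
  lnReg i hi := h.lnReg i (hJ hi)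
  UReg i hi := h.UReg i (hJ hi)

theorem Good.mono (h : Good G μ Bl m pm rm Reg θ J p r) {J' : Finset ι} (hJ : J' ⊆ J) :
    Good G μ Bl m pm rm Reg θ J' p r := by
  obtain ⟨S, U, ln, h⟩ := h
  exact ⟨S, U, ln, h.mono hJ⟩

variable (G) in
/-- The members of `S` whose path, up to position `k`, meets the closed neighbourhood of `X`. -/
def touched (S : Set W) (ln : W → ℕ → W) (k : ℕ) (X : Set W) : Set W :=
  {e ∈ S | ∃ l ≤ k, ln e l ∈ nb G X}

variable (G) in
/-- The members of `S` whose path meets the closed neighbourhood of `X` at position `i` first. -/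
def firstAt (S : Set W) (ln : W → ℕ → W) (i : ℕ) (X : Set W) : Set W :=
  {e ∈ S | ln e i ∈ nb G X ∧ ∀ l < i, ln e l ∉ nb G X}

/-- A touched path has a first touched position. There are at most three positions, so one of them
accounts for a third of the weight. Taking the first contact keeps the earlier part of the path
clear of `X`. -/
theorem exists_firstAt {ε : ℝ} (hW : Wt G μ ε) {T : Set W} {l : W → ℕ → W} {k : ℕ} (hk : k ≤ 2)
    {X : Set W} {η : ℝ} (hη : 0 ≤ η) (h : 3 * η ≤ μ (touched G T l k X)) :
    ∃ i ≤ k, η ≤ μ (firstAt G T l i X) := by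
  by_contra hcon
  push Not at hcon
  have hsub : touched G T l k X ⊆ ⋃ i ∈ Finset.range (k + 1), firstAt G T l i X := by
    classical
    rintro e ⟨he, hex⟩
    have hex' : ∃ i, i ≤ k ∧ l e i ∈ nb G X := hex
    obtain ⟨h1, h2⟩ := Nat.find_spec hex'
    simp only [Set.mem_iUnion]
    refine ⟨Nat.find hex', Finset.mem_range.2 (by omega), he, h2, fun i hi hmem => ?_⟩
    exact Nat.find_min hex' hi ⟨by omega, hmem⟩
  have h1 := h.trans (hW.mono hsub)
  have h2 : μ (⋃ i ∈ Finset.range (k + 1), firstAt G T l i X) < 3 * η := by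
    have e1 : ∀ n, ⋃ i ∈ Finset.range (n + 1), firstAt G T l i X =
        (⋃ i ∈ Finset.range n, firstAt G T l i X) ∪ firstAt G T l n X := by
      intro n
      rw [Finset.range_add_one, Finset.set_biUnion_insert, Set.union_comm]
    have e0 : μ (⋃ i ∈ Finset.range (0 + 1), firstAt G T l i X) < η := by
      have := hcon 0 (Nat.zero_le _)
      simpa using this
    interval_cases k
    · linarith
    · rw [e1 1]
      have a1 := hW.union_le (⋃ i ∈ Finset.range 1, firstAt G T l i X) (firstAt G T l 1 X)
      have a2 := hcon 1 le_rfl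
      simp only [zero_add] at e0
      linarith
    · rw [e1 2, e1 1]
      have a1 := hW.union_le (⋃ i ∈ Finset.range 2, firstAt G T l i X) (firstAt G T l 2 X)
      have a2 := hcon 2 le_rfl
      have a3 := hW.union_le (⋃ i ∈ Finset.range 1, firstAt G T l i X) (firstAt G T l 1 X)
      have a4 := hcon 1 (by norm_num)
      rw [e1 1] at a1
      simp only [zero_add] at e0
      linarith
  linarith

variable [DecidableEq ι]

/-- The source `s` is absorbed into the object `t` all of whose selected paths are touched at
their roots. -/
theorem Layout.root_move (h : Layout G μ Bl m pm rm Reg θ J p r S U ln) {s t : ι} (hs : s ∈ J)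
    (ht : t ∈ J) (hts : t ≠ s) {X : Set W} {θ' : ℝ} {ρ : ℕ} (hρ : rm ≤ ρ)
    (hX : ∀ x ∈ X, ∃ e ∈ S s, ∃ l ≤ p s, x = ln s e l)
    (hθ : ∀ j ∈ J, j ≠ s → θ' ≤ μ (S j \ touched G (S j) (ln j) (p j) X))
    (hC : θ' ≤ μ (firstAt G (S t) (ln t) (p t) X))
    (hup : ∀ e ∈ firstAt G (S t) (ln t) (p t) X, ∃ D ⊆ U t ∪ U s ∪ X,
      RC G Bl m ρ (ln t e (p t)) D) :
    Good G μ Bl m pm rm Reg θ' (J.erase s) p (Function.update r t ρ) := by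
  set C := firstAt G (S t) (ln t) (p t) X with hCdef
  -- Only candidates of `t` whose first contact with `X` is their root survive; the others discard
  -- every candidate touched by `X`. Hence `X`, together with `U s`, can be absorbed into `U t`
  -- without creating interference.
  set S' : ι → Set W := Function.update (fun j => S j \ touched G (S j) (ln j) (p j) X) t C with hS'
  set U' : ι → Set W := Function.update U t (U t ∪ U s ∪ X) with hU'
  have hCt : S' t = C := Function.update_self _ _ _
  have hUt : U' t = U t ∪ U s ∪ X := Function.update_self _ _ _
  have hSne : ∀ j, j ≠ t → S' j = S j \ touched G (S j) (ln j) (p j) X := fun j hj =>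
    Function.update_of_ne hj _ _
  have hUne : ∀ j, j ≠ t → U' j = U j := fun j hj => Function.update_of_ne hj _ _
  have hsub : ∀ j, S' j ⊆ S j := by
    intro j
    by_cases hj : j = t
    · subst hj; rw [hCt]; exact fun e he => he.1
    · rw [hSne j hj]; exact Set.sdiff_subset
  have hXU : ∀ j ∈ J, j ≠ s → AC G X (U j) := by
    intro j hj hjs
    refine ac_of_forall_singleton fun x hx => ?_
    obtain ⟨e, he, l, hl, rfl⟩ := hX x hx
    exact h.acln s hs j hj hjs.symm e he l hl
  have hunt : ∀ j, j ≠ t → ∀ e ∈ S' j, ∀ l ≤ p j, AC G {ln j e l} X := by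
    intro j hjt e he l hl
    rw [hSne j hjt] at he
    refine (ac_iff.2 ?_ : AC G X {ln j e l}).symm
    rintro _ rfl hmem
    exact he.2 ⟨he.1, l, hl, hmem⟩
  have hne : ∀ j ∈ J.erase s, j ∈ J ∧ j ≠ s := fun j hj =>
    ⟨Finset.mem_of_mem_erase hj, Finset.ne_of_mem_erase hj⟩
  refine ⟨S', U', ln, ?_⟩
  constructor
  · intro j hj
    by_cases hjt : j = t
    · subst hjt; rw [hCt]; exact hC
    · rw [hSne j hjt]; exact hθ j (hne j hj).1 (hne j hj).2
  · exact fun j hj => h.pos_le j (hne j hj).1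
  · intro j hj
    by_cases hjt : j = t
    · subst hjt; rw [Function.update_self]; exact hρ
    · rw [Function.update_of_ne hjt]; exact h.le_rank j (hne j hj).1
  · have key : ∀ j ∈ J.erase s, j ≠ t → AC G (U' t) (U' j) := by
      intro j hj hjt
      obtain ⟨hj, hjs⟩ := hne j hj
      rw [hUt, hUne j hjt]
      exact AC.union_left (AC.union_left (h.acU t ht j hj hjt.symm) (h.acU s hs j hj hjs.symm))
        (hXU j hj hjs)
    intro i hi j hj hij
    by_cases hit : i = t
    · subst hit; exact key j hj hij.symm
    · by_cases hjt : j = t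
      · subst hjt; exact (key i hi hij).symm
      · rw [hUne i hit, hUne j hjt]
        exact h.acU i (hne i hi).1 j (hne j hj).1 hij
  · intro i hi j hj hij e he l hl
    obtain ⟨hi, his⟩ := hne i hi
    obtain ⟨hj, hjs⟩ := hne j hj
    by_cases hjt : j = t
    · subst hjt
      rw [hUt]
      exact AC.union_right (AC.union_right (h.acln i hi j hj hij e (hsub i he) l hl)
        (h.acln i hi s hs his e (hsub i he) l hl)) (hunt i hij e he l hl)
    · rw [hUne j hjt]
      exact h.acln i hi j hj hij e (hsub i he) l hl
  · intro i hi e he l hl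
    obtain ⟨hi, his⟩ := hne i hi
    by_cases hit : i = t
    · subst hit
      rw [hUt]
      refine AC.union_right (AC.union_right (h.acself i hi e (hsub i he) l hl)
        (h.acln i hi s hs his e (hsub i he) l hl.le)) (ac_iff.2 ?_ : AC G X {ln i e l}).symm
      rw [hCt] at he
      rintro _ rfl
      exact he.2.2 l hl
    · rw [hUne i hit]
      exact h.acself i hi e (hsub i he) l hl
  · intro i hi e he
    obtain ⟨hi, his⟩ := hne i hi
    by_cases hit : i = t
    · subst hit
      rw [hUt, Function.update_self]
      rw [hCt] at he
      exact hup e he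
    · rw [hUne i hit, Function.update_of_ne hit]
      exact h.rc i hi e (hsub i he)
  · intro i hi j hj hij e he e' he'
    exact h.distinct i (hne i hi).1 j (hne j hj).1 hij e (hsub i he) e' (hsub j he')
  · intro i hi e he e' he'
    exact h.inner i (hne i hi).1 e (hsub i he) e' (hsub i he')
  · exact fun i hi e he => h.zero i (hne i hi).1 e (hsub i he)
  · exact fun i hi e he => h.adj i (hne i hi).1 e (hsub i he)
  · exact fun i hi e he => h.lnReg i (hne i hi).1 e (hsub i he)
  · intro i hi
    obtain ⟨hi, his⟩ := hne i hi
    by_cases hit : i = t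
    · subst hit
      rw [hUt]
      refine Set.union_subset (Set.union_subset (h.UReg i hi) (h.UReg s hs)) fun x hx => ?_
      obtain ⟨e, he, l, hl, rfl⟩ := hX x hx
      exact h.lnReg s hs e he l hl
    · rw [hUne i hit]; exact h.UReg i hi

/-- The source `s` continues along paths of `t`, from a position `i` before the root of `t`. -/
theorem Layout.lower_move (h : Layout G μ Bl m pm rm Reg θ J p r S U ln) (hpm : pm ≤ 2) {s t : ι}
    (hs : s ∈ J) (ht : t ∈ J) {X : Set W} {θ' : ℝ} {ρ i : ℕ} (hρ : rm ≤ ρ) (hi : i < p t)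
    (hX : ∀ x ∈ X, ∃ e ∈ S s, ∃ l ≤ p s, x = ln s e l)
    (hθ : ∀ j ∈ J, j ≠ s → θ' ≤ μ (S j \ touched G (S j) (ln j) (p j) X))
    (hC : θ' ≤ μ (firstAt G (S t) (ln t) i X))
    (hup : ∀ e ∈ firstAt G (S t) (ln t) i X, ∃ D ⊆ U s ∪ X, RC G Bl m ρ (ln t e i) D) :
    Good G μ Bl m pm rm Reg θ' J (Function.update p s i) (Function.update r s ρ) := by
  set C := firstAt G (S t) (ln t) i X with hCdef
  set S' : ι → Set W := Function.update (fun j => S j \ touched G (S j) (ln j) (p j) X) s C with hS'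
  set U' : ι → Set W := Function.update U s (U s ∪ X) with hU'
  set ln' : ι → W → ℕ → W := Function.update ln s (ln t) with hln'
  set p' : ι → ℕ := Function.update p s i with hp'
  have hCs : S' s = C := Function.update_self _ _ _
  have hUs : U' s = U s ∪ X := Function.update_self _ _ _
  have hls : ln' s = ln t := Function.update_self _ _ _
  have hps : p' s = i := Function.update_self _ _ _
  have hCsub : C ⊆ S t := fun e he => he.1
  have hSne : ∀ j, j ≠ s → S' j = S j \ touched G (S j) (ln j) (p j) X := fun j hj =>
    Function.update_of_ne hj _ _
  have hUne : ∀ j, j ≠ s → U' j = U j := fun j hj => Function.update_of_ne hj _ _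
  have hlne : ∀ j, j ≠ s → ln' j = ln j := fun j hj => Function.update_of_ne hj _ _
  have hpne : ∀ j, j ≠ s → p' j = p j := fun j hj => Function.update_of_ne hj _ _
  have hsub : ∀ j, j ≠ s → S' j ⊆ S j := by
    intro j hj
    rw [hSne j hj]; exact Set.sdiff_subset
  have hXU : ∀ j ∈ J, j ≠ s → AC G X (U j) := by
    intro j hj hjs
    refine ac_of_forall_singleton fun x hx => ?_
    obtain ⟨e, he, l, hl, rfl⟩ := hX x hx
    exact h.acln s hs j hj hjs.symm e he l hl
  have hunt : ∀ j, j ≠ s → ∀ e ∈ S' j, ∀ l ≤ p j, AC G {ln j e l} X := by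
    intro j hjt e he l hl
    rw [hSne j hjt] at he
    refine (ac_iff.2 ?_ : AC G X {ln j e l}).symm
    rintro _ rfl hmem
    exact he.2 ⟨he.1, l, hl, hmem⟩
  have hpt := h.pos_le t ht
  -- Now `s` uses paths of `t`, so disjointness from the paths still kept by `t` must be checked.
  -- Equal vertices have equal positions by `inner`. As `i < p t ≤ 2`, that position is `0` or `i`;
  -- in both cases the kept path would be touched by `X`, which was excluded.
  have hdis : ∀ j ∈ J, j ≠ s → ∀ e ∈ C, ∀ e' ∈ S' j, ∀ l ≤ i, ∀ l' ≤ p j,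
      ln t e l ≠ ln j e' l' := by
    intro j hj hjs e he e' he' l hl l' hl' heq
    by_cases hjt : j = t
    · subst hjt
      have h1 := h.inner j hj e he.1 e' (hsub j hjs he') l (by omega) l' hl' heq
      subst h1
      rw [hSne j hjs] at he'
      rcases Nat.eq_zero_or_pos l with rfl | hl0
      · rw [h.zero j hj e he.1, h.zero j hj e' he'.1] at heq
        subst heq
        exact he'.2 ⟨he'.1, i, hi.le, he.2.1⟩
      · have : l = i := by omega
        subst this
        exact he'.2 ⟨he'.1, l, hl', heq ▸ he.2.1⟩
    · exact h.distinct t ht j hj (Ne.symm hjt) e he.1 e' (hsub j hjs he') l (by omega) l' hl' heq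
  refine ⟨S', U', ln', ?_⟩
  constructor
  · intro j hj
    by_cases hjs : j = s
    · subst hjs; rw [hCs]; exact hC
    · rw [hSne j hjs]; exact hθ j hj hjs
  · intro j hj
    by_cases hjs : j = s
    · subst hjs; rw [hps]; omega
    · rw [hpne j hjs]; exact h.pos_le j hj
  · intro j hj
    by_cases hjs : j = s
    · subst hjs; rw [Function.update_self]; exact hρ
    · rw [Function.update_of_ne hjs]; exact h.le_rank j hj
  · have key : ∀ j ∈ J, j ≠ s → AC G (U' s) (U' j) := by
      intro j hj hjs
      rw [hUs, hUne j hjs]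
      exact AC.union_left (h.acU s hs j hj hjs.symm) (hXU j hj hjs)
    intro a ha b hb hab
    by_cases has : a = s
    · subst has; exact key b hb hab.symm
    · by_cases hbs : b = s
      · subst hbs; exact (key a ha hab).symm
      · rw [hUne a has, hUne b hbs]
        exact h.acU a ha b hb hab
  · intro a ha b hb hab e he l hl
    by_cases has : a = s
    · subst has
      rw [hCs] at he
      rw [hps] at hl
      rw [hls, hUne b hab.symm]
      by_cases hbt : b = t
      · subst hbt; exact h.acself b hb e he.1 l (by omega)
      · exact h.acln t ht b hb (Ne.symm hbt) e he.1 l (by omega)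
    · rw [hlne a has]
      rw [hpne a has] at hl
      by_cases hbs : b = s
      · subst hbs
        rw [hUs]
        exact AC.union_right (h.acln a ha b hb hab e (hsub a has he) l hl) (hunt a has e he l hl)
      · rw [hUne b hbs]
        exact h.acln a ha b hb hab e (hsub a has he) l hl
  · intro a ha e he l hl
    by_cases has : a = s
    · subst has
      rw [hCs] at he
      rw [hps] at hl
      rw [hls, hUs]
      refine AC.union_right ?_ (ac_iff.2 ?_ : AC G X {ln t e l}).symm
      · by_cases hat : a = t
        · subst hat; exact h.acself a ha e he.1 l (by omega)
        · exact h.acln t ht a ha (Ne.symm hat) e he.1 l (by omega)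
      · rintro _ rfl
        exact he.2.2 l hl
    · rw [hlne a has, hUne a has]
      rw [hpne a has] at hl
      exact h.acself a ha e (hsub a has he) l hl
  · intro a ha e he
    by_cases has : a = s
    · subst has
      rw [hCs] at he
      rw [hls, hUs, hps, Function.update_self]
      exact hup e he
    · rw [hlne a has, hUne a has, hpne a has, Function.update_of_ne has]
      exact h.rc a ha e (hsub a has he)
  · intro a ha b hb hab e he e' he' l hl l' hl'
    by_cases has : a = s
    · subst has
      rw [hCs] at he
      rw [hps] at hl
      rw [hpne b hab.symm] at hl'
      rw [hls, hlne b hab.symm]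
      exact hdis b hb hab.symm e he e' he' l hl l' hl'
    · by_cases hbs : b = s
      · subst hbs
        rw [hCs] at he'
        rw [hps] at hl'
        rw [hpne a has] at hl
        rw [hls, hlne a has]
        exact (hdis a ha has e' he' e he l' hl' l hl).symm
      · rw [hpne a has] at hl
        rw [hpne b hbs] at hl'
        rw [hlne a has, hlne b hbs]
        exact h.distinct a ha b hb hab e (hsub a has he) e' (hsub b hbs he') l hl l' hl'
  · intro a ha e he e' he' l hl l' hl'
    by_cases has : a = s
    · subst has
      rw [hCs] at he he'
      rw [hps] at hl hl'
      rw [hls]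
      exact h.inner t ht e he.1 e' he'.1 l (by omega) l' (by omega)
    · rw [hpne a has] at hl hl'
      rw [hlne a has]
      exact h.inner a ha e (hsub a has he) e' (hsub a has he') l hl l' hl'
  · intro a ha e he
    by_cases has : a = s
    · subst has
      rw [hCs] at he
      rw [hls]; exact h.zero t ht e he.1
    · rw [hlne a has]; exact h.zero a ha e (hsub a has he)
  · intro a ha e he l hl
    by_cases has : a = s
    · subst has
      rw [hCs] at he
      rw [hps] at hl
      rw [hls]; exact h.adj t ht e he.1 l (by omega)
    · rw [hpne a has] at hl
      rw [hlne a has]; exact h.adj a ha e (hsub a has he) l hl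
  · intro a ha e he l hl
    by_cases has : a = s
    · subst has
      rw [hCs] at he
      rw [hps] at hl
      rw [hls]; exact h.lnReg t ht e he.1 l (by omega)
    · rw [hpne a has] at hl
      rw [hlne a has]; exact h.lnReg a ha e (hsub a has he) l hl
  · intro a ha
    by_cases has : a = s
    · subst has
      rw [hUs]
      refine Set.union_subset (h.UReg a ha) fun x hx => ?_
      obtain ⟨e, he, l, hl, rfl⟩ := hX x hx
      exact h.lnReg a ha e he l hl
    · rw [hUne a has]; exact h.UReg a ha

/-- The move resulting from a set `X` of path vertices of the source `s` that touches a good part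
of another object. -/
theorem Layout.hit {ε : ℝ} (hW : Wt G μ ε) (h : Layout G μ Bl m pm rm Reg θ J p r S U ln)
    (hpm : pm ≤ 2) (hrm : rm ≤ 1) {s : ι} (hs : s ∈ J) {X : Set W} {θ' : ℝ}
    (hθ' : 0 ≤ θ') {ρ : ℕ} (hρ : 1 ≤ ρ)
    (hX : ∀ x ∈ X, ∃ e ∈ S s, ∃ l ≤ p s, x = ln s e l)
    (hθ : ∀ j ∈ J, j ≠ s → θ' ≤ μ (S j \ touched G (S j) (ln j) (p j) X))
    (hC : ∃ t ∈ J, t ≠ s ∧ 3 * θ' ≤ μ (touched G (S t) (ln t) (p t) X))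
    (hblob : ∀ x ∈ X, ∃ Y ⊆ U s ∪ X, x ∈ Y ∧ Bl Y)
    (hnew : ∀ b, (∃ x ∈ X, G.Adj b x) → b ∉ X → AC G {b} (U s) → ∃ D ⊆ U s ∪ X, RC G Bl m ρ b D) :
    ∃ t ∈ J, t ≠ s ∧
      ((Good G μ Bl m pm rm Reg θ' (J.erase s) p (Function.update r t ρ) ∧
        (r t % (m + 1) < m →
          Good G μ Bl m pm rm Reg θ' (J.erase s) p (Function.update r t (r t + 1)))) ∨
      ∃ i < p t,
        Good G μ Bl m pm rm Reg θ' J (Function.update p s i) (Function.update r s ρ)) := by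
  obtain ⟨t, ht, hts, hCt⟩ := hC
  obtain ⟨i, hi, hCi⟩ := exists_firstAt hW ((h.pos_le t ht).trans hpm) hθ' hCt
  refine ⟨t, ht, hts, ?_⟩
  have hadj : ∀ e ∈ S t, ln t e i ∈ nb G X → ln t e i ∉ X ∧ ∃ x ∈ X, G.Adj (ln t e i) x := by
    intro e he hmem
    have hnot : ln t e i ∉ X := by
      intro hx
      obtain ⟨e', he', l, hl, heq⟩ := hX _ hx
      exact h.distinct t ht s hs hts e he e' he' i hi l hl heq
    refine ⟨hnot, ?_⟩
    obtain ⟨x, hx, heq | hxy⟩ := hmem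
    · exact (hnot (heq ▸ hx)).elim
    · exact ⟨x, hx, hxy.symm⟩
  have hXt : AC G (U t) X := by
    refine (ac_of_forall_singleton fun x hx => ?_ : AC G X (U t)).symm
    obtain ⟨e, he, l, hl, rfl⟩ := hX x hx
    exact h.acln s hs t ht hts.symm e he l hl
  rcases hi.lt_or_eq with hlt | rfl
  · refine Or.inr ⟨i, hlt, h.lower_move hpm hs ht (hrm.trans hρ) hlt hX hθ hCi fun e he => ?_⟩
    obtain ⟨h1, h2⟩ := hadj e he.1 he.2.1
    exact hnew _ h2 h1 (h.acln t ht s hs hts e he.1 i hi)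
  -- A touched root of `t` can be used in two ways: as the root of a caterpillar built from `s`,
  -- forgetting the one of `t`, or as the old root of `t` with a new blob containing the neighbour
  -- in `X`. The game needs both options.
  · refine Or.inl ⟨?_, fun hmod => ?_⟩
    · refine h.root_move hs ht hts (hrm.trans hρ) hX hθ hCi fun e he => ?_
      obtain ⟨h1, h2⟩ := hadj e he.1 he.2.1
      obtain ⟨D, hD, hrc⟩ := hnew _ h2 h1 (h.acln t ht s hs hts e he.1 _ le_rfl)
      exact ⟨D, hD.trans (by rw [Set.union_assoc]; exact Set.subset_union_right), hrc⟩
    · refine h.root_move hs ht hts (by omega) hX hθ hCi fun e he => ?_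
      obtain ⟨h1, x, hx, hbx⟩ := hadj e he.1 he.2.1
      obtain ⟨D, hD, hrc⟩ := h.rc t ht e he.1
      obtain ⟨Y, hY, hxY, hBY⟩ := hblob x hx
      refine ⟨D ∪ Y, ?_, hrc.blob hmod hBY ⟨x, hxY, hbx⟩ ?_ ?_⟩
      · rw [Set.union_assoc]
        exact Set.union_subset_union hD hY
      · intro hbY
        rcases hY hbY with h3 | h3
        · exact (h.acln t ht s hs hts e he.1 _ le_rfl _ rfl _ h3).1 rfl
        · exact h1 h3
      · exact (AC.union_right (h.acU t ht s hs hts) hXt).mono hD hY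

end Layout

/-! ### Target configurations and complete caterpillars. -/

/-- Vertices `q v` whose adjacencies are prescribed by `A`, and for each pair in `B` a connected
set joining the two vertices, without further adjacencies. -/
structure Conf {V : Type u} {W : Type v} (A B : V → V → Prop) (G : SimpleGraph W) (q : V → W)
    (Q : V → V → Set W) : Prop where
  inj : Function.Injective q
  adj : ∀ u w, u ≠ w → (G.Adj (q u) (q w) ↔ A u w)
  conn : ∀ u w, B u w → Conn G (Q u w)
  left : ∀ u w, B u w → ∃ x ∈ Q u w, G.Adj (q u) x
  right : ∀ u w, B u w → ∃ x ∈ Q u w, G.Adj (q w) x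
  notMem : ∀ u w, B u w → ∀ v, q v ∉ Q u w
  not_adj : ∀ u w, B u w → ∀ v, v ≠ u → v ≠ w → ∀ x ∈ Q u w, ¬ G.Adj (q v) x
  ac : ∀ u w u' w', B u w → B u' w' → (u, w) ≠ (u', w') → AC G (Q u w) (Q u' w')

/-- An induced path `q 0, …, q (N - 1)` with `m` pendant blobs at each of its vertices. -/
structure Caterpillar {W : Type v} (G : SimpleGraph W) (Bl : Set W → Prop) (m N : ℕ) (D : Set W)
    (q : ℕ → W) (X : ℕ → ℕ → Set W) : Prop where
  mem : ∀ i < N, q i ∈ D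
  blob : ∀ i < N, ∀ κ < m, Bl (X i κ)
  sub : ∀ i < N, ∀ κ < m, X i κ ⊆ D
  adj : ∀ i < N, ∀ κ < m, ∃ x ∈ X i κ, G.Adj (q i) x
  notMem : ∀ i < N, ∀ κ < m, ∀ j < N, q j ∉ X i κ
  not_adj : ∀ i < N, ∀ κ < m, ∀ j < N, j ≠ i → ∀ x ∈ X i κ, ¬ G.Adj (q j) x
  ac : ∀ i < N, ∀ κ < m, ∀ i' < N, ∀ κ' < m, (i, κ) ≠ (i', κ') → AC G (X i κ) (X i' κ')
  ne : ∀ i j, i < j → j < N → q i ≠ q j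
  path : ∀ i < N, ∀ j < N, i ≠ j → (G.Adj (q i) (q j) ↔ i + 1 = j ∨ j + 1 = i)

section Cat

variable {W : Type v} {G : SimpleGraph W} {Bl : Set W → Prop} {m : ℕ}

/-- A spine vertex is left behind only once it has all `m` blobs. With rank at least `N * (m + 1)`
there are `N` such vertices before the current root, which is dropped. -/
theorem RC.exists_caterpillar {r N : ℕ} {b : W} {D : Set W} (h : RC G Bl m r b D)
    (hr : N * (m + 1) ≤ r) : ∃ q X, Caterpillar G Bl m N D q X := by
  obtain ⟨q, X, -, h1, h2, h3, h4⟩ := h.exists_path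
  have hN : N ≤ r / (m + 1) := (Nat.le_div_iff_mul_le (Nat.succ_pos m)).2 hr
  have hlt : ∀ i < N, i < r / (m + 1) := fun i hi => hi.trans_le hN
  refine ⟨q, X, ⟨fun i hi => h1 i (hlt i hi), ?_, ?_, ?_, ?_, ?_, ?_, ?_, ?_⟩⟩
  · exact fun i hi κ hκ => (h2 i κ hκ (Or.inl (hlt i hi))).1
  · exact fun i hi κ hκ => (h2 i κ hκ (Or.inl (hlt i hi))).2.1
  · exact fun i hi κ hκ => (h2 i κ hκ (Or.inl (hlt i hi))).2.2.1
  · intro i hi κ hκ j hj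
    obtain ⟨-, -, -, h5, h6⟩ := h2 i κ hκ (Or.inl (hlt i hi))
    by_cases hij : j = i
    · subst hij; exact h5
    · exact fun hmem => (h6 j (hlt j hj).le hij _ rfl _ hmem).1 rfl
  · intro i hi κ hκ j hj hij x hx
    exact ((h2 i κ hκ (Or.inl (hlt i hi))).2.2.2.2 j (hlt j hj).le hij _ rfl x hx).2
  · exact fun i hi κ hκ i' hi' κ' hκ' =>
      h3 i κ i' κ' hκ (Or.inl (hlt i hi)) hκ' (Or.inl (hlt i' hi'))
  · exact fun i j hij hj => (h4 i j hij (hlt j hj).le).1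
  · intro i hi j hj hij
    rcases lt_or_gt_of_ne hij with h | h
    · rw [(h4 i j h (hlt j hj).le).2]; omega
    · rw [G.adj_comm, (h4 j i h (hlt i hi).le).2]; omega

end Cat

/-! ### Sets with light access, and balls. -/

/-- `X` is joined to `v` by connected subsets whose neighbourhoods have weight at most `c`. -/
def LC {W : Type v} (G : SimpleGraph W) (μ : Set W → ℝ) (c : ℝ) (v : W) (X : Set W) : Prop :=
  v ∈ X ∧ ∀ x ∈ X, ∃ π ⊆ X, Conn G π ∧ v ∈ π ∧ x ∈ π ∧ μ (nb G π) ≤ c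

/-- The vertices of `A` within distance `k` of `v` inside `A`. -/
def ball {W : Type v} (G : SimpleGraph W) (A : Set W) (v : W) : ℕ → Set W
  | 0 => {v}
  | k + 1 => nb G (ball G A v k) ∩ A

section LC

variable {W : Type v} {G : SimpleGraph W} {μ : Set W → ℝ} {ε c : ℝ} {v : W} {X : Set W}

/-- Go from `w` to `x` through the old base point `v`; this doubles the cost. -/
theorem LC.change (hW : Wt G μ ε) (h : LC G μ c v X) {w : W} (hw : w ∈ X) :
    LC G μ (2 * c) w X := by
  refine ⟨hw, fun x hx => ?_⟩
  obtain ⟨π, hπ, h1, h2, h3, h4⟩ := h.2 x hx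
  obtain ⟨π', hπ', h1', h2', h3', h4'⟩ := h.2 w hw
  refine ⟨π ∪ π', Set.union_subset hπ hπ', h1.union h1' ⟨v, h2, subset_nb h2'⟩, Or.inr h3',
    Or.inl h3, ?_⟩
  rw [nb_union]
  have := hW.union_le (nb G π) (nb G π')
  linarith

theorem lc_ball (hW : Wt G μ ε) {A : Set W} (hv : v ∈ A) (k : ℕ) :
    LC G μ ((k + 1) * ε) v (ball G A v k) ∧ ball G A v k ⊆ A := by
  induction k with
  | zero =>
    refine ⟨⟨rfl, ?_⟩, by simpa [ball] using hv⟩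
    rintro x rfl
    exact ⟨{x}, subset_rfl, conn_singleton x, rfl, rfl, by simpa using hW.nb_le x⟩
  | succ k ih =>
    obtain ⟨⟨h1, h2⟩, h3⟩ := ih
    have hsub : ball G A v k ⊆ ball G A v (k + 1) := fun x hx => ⟨subset_nb hx, h3 hx⟩
    refine ⟨⟨hsub h1, ?_⟩, Set.inter_subset_right⟩
    rintro x ⟨⟨y, hy, hxy⟩, hxA⟩
    obtain ⟨π, hπ, hc, hvπ, hyπ, hμ⟩ := h2 y hy
    refine ⟨π ∪ {x}, Set.union_subset (hπ.trans hsub) ?_, hc.union (conn_singleton x)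
      ⟨y, hyπ, mem_nb_singleton_comm.1 (mem_nb_singleton.2 hxy)⟩, Or.inl hvπ, Or.inr rfl, ?_⟩
    · rintro _ rfl
      exact ⟨⟨y, hy, hxy⟩, hxA⟩
    · rw [nb_union]
      have h4 := hW.union_le (nb G π) (nb G {x})
      have h5 := hW.nb_le x
      push_cast
      linarith

/-- The set is rebuilt from the base point by adding one access set at a time. Each addition
enlarges the neighbourhood by weight at most `c` and keeps the light access, so the growth can be
stopped just after some `E j` is seen to the amount `η`. -/
theorem LC.exists_trim [Finite W] (hW : Wt G μ ε) (h : LC G μ c v X) (hc : ε ≤ c) {ι : Type*}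
    (E : ι → Set W) (J : Set ι) {η : ℝ} (hη : ε < η) (h1 : ∃ j ∈ J, η ≤ μ (nb G X ∩ E j)) :
    ∃ Y ⊆ X, LC G μ c v Y ∧ (∃ j ∈ J, η ≤ μ (nb G Y ∩ E j)) ∧
      ∀ j ∈ J, μ (nb G Y ∩ E j) ≤ η + c := by
  obtain ⟨Y, hY, -, hYX, h2, h3⟩ := PureInduced.exists_trim (LC G μ c v)
    (fun j Y => μ (nb G Y ∩ E j)) J (X₀ := {v}) (X₁ := X) (η := η) (c := c)
    ⟨rfl, by
      rintro x rfl
      exact ⟨{x}, subset_rfl, conn_singleton x, rfl, rfl, (hW.nb_le x).trans hc⟩⟩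
    (by simpa using h.1)
    (fun j _ => ((hW.mono Set.inter_subset_left).trans (hW.nb_le v)).trans_lt hη) h1 (by
      intro Z hZ _ hZX hne
      obtain ⟨x, hxX, hxZ⟩ := Set.exists_of_ssubset (hZX.ssubset_of_ne hne)
      obtain ⟨π, hπ, hcn, hvπ, hxπ, hμ⟩ := h.2 x hxX
      refine ⟨Z ∪ π, ⟨Or.inl hZ.1, ?_⟩, Set.subset_union_left,
        fun e => hxZ (e ▸ Or.inr hxπ), Set.union_subset hZX hπ, fun j _ => ?_⟩
      · rintro y (hy | hy)
        · obtain ⟨π', hπ', h'⟩ := hZ.2 y hy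
          exact ⟨π', hπ'.trans Set.subset_union_left, h'⟩
        · exact ⟨π, Set.subset_union_right, hcn, hvπ, hy, hμ⟩
      · rw [nb_union, Set.union_inter_distrib_right]
        have h4 := hW.union_le (nb G Z ∩ E j) (nb G π ∩ E j)
        have h5 := hW.mono (X := nb G π ∩ E j) (Y := nb G π) Set.inter_subset_left
        linarith)
  exact ⟨Y, hYX, hY, h2, h3⟩

end LC

/-! ### The game when heavy sets contain heavy balls. -/

section LocallyDense

variable {W : Type v} {G : SimpleGraph W} {μ : Set W → ℝ} {ε : ℝ}

/-- The blobs in the case that heavy sets contain heavy balls. -/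
def DenseBlob (G : SimpleGraph W) (μ : Set W → ℝ) (ε δ : ℝ) (X : Set W) : Prop :=
  ∃ v, LC G μ (6 * ε) v X ∧ δ ≤ μ (nb G X)

/-- Here paths have length zero, so candidates are the roots themselves. A heavy ball in `S s` sees
all but `ε` of every other object; trimmed, it sees a quarter of one of them and little more than a
quarter of the rest. The trimmed set is a blob, since `θ / 4` exceeds `δ`. -/
theorem dense_hit [Finite W] {ι : Type*} [DecidableEq ι] (hW : Wt G μ ε) {δ θ : ℝ}
    (hball : ∀ A, δ ≤ μ A → ∃ v ∈ A, ε ≤ μ (ball G A v 5)) (hδ : δ ≤ θ / 12) (hε : 24 * ε ≤ θ)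
    {m : ℕ} {J : Finset ι} {p r : ι → ℕ} {S U : ι → Set W} {ln : ι → W → ℕ → W}
    (h : Layout G μ (DenseBlob G μ ε δ) m 0 0 Set.univ θ J p r S U ln) {s : ι} (hs : s ∈ J)
    (hother : ∃ t ∈ J, t ≠ s) {ρ : ℕ} (hρ : 1 ≤ ρ)
    (hnew : ∀ X ⊆ S s, DenseBlob G μ ε δ X → ∀ b, (∃ x ∈ X, G.Adj b x) → b ∉ X → AC G {b} (U s) →
      ∃ D ⊆ U s ∪ X, RC G (DenseBlob G μ ε δ) m ρ b D) :
    ∃ t ∈ J, t ≠ s ∧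
      Good G μ (DenseBlob G μ ε δ) m 0 0 Set.univ (θ / 12) (J.erase s) p (Function.update r t ρ) ∧
      (r t % (m + 1) < m → Good G μ (DenseBlob G μ ε δ) m 0 0 Set.univ (θ / 12) (J.erase s) p
        (Function.update r t (r t + 1))) := by
  have hpos := hW.pos
  have hp : ∀ j ∈ J, p j = 0 := fun j hj => Nat.le_zero.1 (h.pos_le j hj)
  have htouch : ∀ j ∈ J, ∀ X, touched G (S j) (ln j) (p j) X = nb G X ∩ S j := by
    intro j hj X
    ext e
    rw [hp j hj]
    constructor
    · rintro ⟨he, l, hl, hmem⟩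
      obtain rfl : l = 0 := Nat.le_zero.1 hl
      rw [h.zero j hj e he] at hmem
      exact ⟨hmem, he⟩
    · rintro ⟨hmem, he⟩
      exact ⟨he, 0, le_rfl, by rwa [h.zero j hj e he]⟩
  obtain ⟨v, hv, hvb⟩ := hball (S s) (by have := h.heavy s hs; linarith)
  obtain ⟨hlc, hsub⟩ := lc_ball hW hv 5
  -- Radius five gives access cost `6 * ε`, the constant in `DenseBlob`.
  norm_num at hlc
  obtain ⟨X, hXs, hX, ⟨t, ⟨ht, hts⟩, htX⟩, hXj⟩ := hlc.exists_trim hW (by linarith) S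
    {j | j ∈ J ∧ j ≠ s} (η := θ / 4) (by linarith) (by
      obtain ⟨t, ht, hts⟩ := hother
      refine ⟨t, ⟨ht, hts⟩, ?_⟩
      have h1 := hW.compl_nb_lt hvb
      have h2 := hW.sub_le_diff (S t) (nb G (ball G (S s) v 5))ᶜ
      have h3 := h.heavy t ht
      rw [Set.sdiff_compl, Set.inter_comm] at h2
      linarith)
  have hXS : X ⊆ S s := hXs.trans hsub
  have hblob : DenseBlob G μ ε δ X := by
    refine ⟨v, hX, ?_⟩
    have := hW.mono (X := nb G X ∩ S t) (Y := nb G X) Set.inter_subset_left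
    linarith
  obtain ⟨t, ht, hts, h' | ⟨i, hi, -⟩⟩ := h.hit hW (by norm_num) (by norm_num) hs (X := X)
    (θ' := θ / 12) (by linarith) hρ
    (fun x hx => ⟨x, hXS hx, 0, Nat.zero_le _, (h.zero s hs x (hXS hx)).symm⟩)
    (by
      intro j hj hjs
      rw [htouch j hj]
      have h1 := hXj j ⟨hj, hjs⟩
      have h2 := hW.sub_le_diff (S j) (nb G X ∩ S j)
      have h3 := h.heavy j hj
      linarith)
    ⟨t, ht, hts, by rw [htouch t ht]; linarith⟩
    (fun x hx => ⟨X, Set.subset_union_right, hx, hblob⟩)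
    (hnew X hXS hblob)
  · exact ⟨t, ht, hts, h'⟩
  · rw [hp t ht] at hi; omega

theorem dense_game [Finite W] {ι : Type*} [DecidableEq ι] (hW : Wt G μ ε) {θ : ℝ} {m F : ℕ}
    (hm : 0 < m) (hε : 24 * ε ≤ θ / 12 ^ F)
    (hball : ∀ A, θ / 12 ^ F ≤ μ A → ∃ v ∈ A, ε ≤ μ (ball G A v 5)) :
    Game m F fun n (J : Finset ι) p r =>
      Good G μ (DenseBlob G μ ε (θ / 12 ^ F)) m 0 0 Set.univ (θ / 12 ^ n) J p r := by
  have hpos := hW.pos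
  have hθ : 0 < θ := by
    by_contra hcon
    have : θ / 12 ^ F ≤ 0 := div_nonpos_of_nonpos_of_nonneg (not_lt.1 hcon) (by positivity)
    linarith
  have hle : ∀ n < F, θ / 12 ^ F ≤ θ / 12 ^ n / 12 := by
    intro n hn
    rw [div_div, ← pow_succ]
    exact div_le_div_of_nonneg_left hθ.le (by positivity)
      (pow_le_pow_right₀ (by norm_num) hn)
  have hdiv : ∀ n, θ / 12 ^ (n + 1) = θ / 12 ^ n / 12 := fun n => by rw [pow_succ, div_div]
  have hε' : ∀ n < F, 24 * ε ≤ θ / 12 ^ n := by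
    intro n hn
    have := hle n hn
    have : 0 < θ / 12 ^ n := by positivity
    linarith
  refine ⟨fun h J' hJ' => h.mono hJ', ?_, ?_⟩
  · rintro n J p r hn ⟨S, U, ln, h⟩ s hs hother
    obtain ⟨t, ht, hts, h1, h2⟩ := dense_hit hW hball (hle n hn) (hε' n hn) h hs hother (ρ := 1)
      le_rfl (by
        intro X _ hX b hb hbX _
        exact ⟨∅ ∪ X, by simp, (RC.base b).blob (by simpa using hm) hX hb hbX ac_empty_left⟩)
    refine ⟨t, ht, hts, Or.inl fun hmod => ?_⟩
    simp only [hdiv]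
    exact h2 hmod
  · rintro n J p r hn ⟨S, U, ln, h⟩ s hs hother hmod
    obtain ⟨t, ht, hts, h1, h2⟩ := dense_hit hW hball (hle n hn) (hε' n hn) h hs hother
      (ρ := r s + 1) (by omega) (by
        rintro X hXS - b ⟨x, hx, hbx⟩ hbX hbU
        obtain ⟨D, hD, hrc⟩ := h.rc s hs x (hXS hx)
        rw [Nat.le_zero.1 (h.pos_le s hs), h.zero s hs x (hXS hx)] at hrc
        exact ⟨insert x D, Set.insert_subset (Or.inr hx) (hD.trans Set.subset_union_left),
          hrc.spine hmod hbx (hbU.mono subset_rfl hD)⟩)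
    refine Or.inl ⟨t, ht, hts, ?_⟩
    simp only [hdiv]
    exact ⟨h1, h2⟩

end LocallyDense

/-! ### Greedy joining of sets with large neighbourhoods. -/

section Link

variable {W : Type v} {G : SimpleGraph W} {μ : Set W → ℝ} {ε c : ℝ}

/-- Given pairs of pairwise anticomplete sets with large neighbourhoods, the two members of each
pair can be joined by connected sets that are pairwise anticomplete. -/
theorem exists_links [Finite W] {κ : Type*} [DecidableEq κ] (hW : Wt G μ ε) (hc : ε ≤ c) {M : ℕ}
    (hM : 0 < M) (𝓔 : Finset κ) :
    𝓔.card ≤ M → ∀ (X : κ → Bool → Set W) (ℓ : κ → Bool → W) (E : κ → Bool → Set W) (F : Set W)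
      (θ : ℝ),
      (∀ e ∈ 𝓔, ∀ b, LC G μ c (ℓ e b) (X e b)) →
      (∀ e ∈ 𝓔, ∀ b, ∀ e' ∈ 𝓔, ∀ b', (e, b) ≠ (e', b') → AC G (X e b) (X e' b')) →
      (∀ e ∈ 𝓔, ∀ b, E e b ⊆ nb G (X e b) ∩ F) → (∀ e ∈ 𝓔, ∀ b, θ ≤ μ (E e b)) →
      64 * M * c * (16 * M) ^ 𝓔.card ≤ θ →
      ∃ Q : κ → Set W, (∀ e ∈ 𝓔, Conn G (Q e) ∧ (∀ b, ℓ e b ∈ Q e) ∧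
          Q e ⊆ F ∪ X e false ∪ X e true) ∧
        ∀ e ∈ 𝓔, ∀ e' ∈ 𝓔, e ≠ e' → AC G (Q e) (Q e') := by
  have hpos := hW.pos
  have hM1 : (1 : ℝ) ≤ M := by exact_mod_cast hM
  induction 𝓔 using Finset.induction_on with
  | empty => intro _ X ℓ E F θ _ _ _ _ _; exact ⟨fun _ => ∅, by simp, by simp⟩
  | insert e₀ 𝓔 he₀ ih =>
    intro hcard X ℓ E F θ hX hXX hE hEθ hθ
    rw [Finset.card_insert_of_notMem he₀] at hcard hθ
    -- At most `2 * M` trimmed sets each see at most `η + c ≤ 2 * η` of a given `E e₀ b`, hence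
    -- together at most half of it. The next stage runs with `η / 2 = θ / (16 * M)`, whence the
    -- power in the hypothesis.
    set η := θ / (8 * M) with hη
    have hθη : θ = 8 * M * η := by rw [hη]; field_simp
    have hpow : (1 : ℝ) ≤ (16 * M) ^ 𝓔.card := one_le_pow₀ (by linarith)
    have hpow' : 64 * M * c * (16 * M) ^ 𝓔.card ≤ η / 2 := by
      rw [pow_succ] at hθ
      have h1 : 64 * M * c * (16 * M) ^ 𝓔.card * (16 * M) ≤ η / 2 * (16 * M) := by
        rw [hθη] at hθ; linarith
      exact le_of_mul_le_mul_right h1 (by linarith)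
    have hcη : 64 * c ≤ η / 2 := by
      refine le_trans ?_ hpow'
      have : 64 * c * 1 ≤ 64 * c * (M * (16 * M) ^ 𝓔.card) := by
        apply mul_le_mul_of_nonneg_left _ (by linarith)
        nlinarith
      linarith
    have hmem : ∀ e ∈ 𝓔, e ∈ insert e₀ 𝓔 := fun e he => Finset.mem_insert_of_mem he
    have hmem₀ : e₀ ∈ insert e₀ 𝓔 := Finset.mem_insert_self _ _
    -- Before the pair `e₀` is joined, all other sets are shrunk so that none sees much of any `E`.
    -- Each still sees weight `η` of some `E d`, possibly belonging to another pair; this is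
    -- harmless, since later only membership in `F` matters.
    have hYex : ∀ e b, ∃ (Y : Set W) (d : κ × Bool), e ∈ 𝓔 → Y ⊆ X e b ∧ LC G μ c (ℓ e b) Y ∧
        (d.1 ∈ insert e₀ 𝓔 ∧ η ≤ μ (nb G Y ∩ E d.1 d.2)) ∧
          ∀ e' ∈ insert e₀ 𝓔, ∀ b', μ (nb G Y ∩ E e' b') ≤ η + c := by
      intro e b
      by_cases he : e ∈ 𝓔
      · obtain ⟨Y, h1, h2, ⟨d, h3, h4⟩, h5⟩ := (hX e (hmem e he) b).exists_trim hW hc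
          (fun d : κ × Bool => E d.1 d.2) {d | d.1 ∈ insert e₀ 𝓔} (η := η) (by linarith)
          ⟨(e, b), hmem e he, by
            have h1 : nb G (X e b) ∩ E e b = E e b :=
              Set.inter_eq_right.2 fun x hx => (hE e (hmem e he) b hx).1
            simp only [h1]
            refine le_trans ?_ (hEθ e (hmem e he) b)
            rw [hθη]; nlinarith⟩
        exact ⟨Y, d, fun _ => ⟨h1, h2, ⟨h3, h4⟩, fun e' he' b' => h5 (e', b') he'⟩⟩
      · exact ⟨∅, (e, b), fun h => (he h).elim⟩
    choose Y d hY using hYex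
    -- the vertices of the new connection
    set Z : Set W := ⋃ i ∈ 𝓔 ×ˢ (Finset.univ : Finset Bool), nb G (Y i.1 i.2) with hZ
    have hbig : ∀ b, ε ≤ μ (E e₀ b \ Z) := by
      intro b
      have h1 := hW.biUnion_le (𝓔 ×ˢ (Finset.univ : Finset Bool))
        (fun i => nb G (Y i.1 i.2) ∩ E e₀ b) (η + c) (by
          intro i hi
          exact (hY i.1 i.2 (Finset.mem_product.1 hi).1).2.2.2 e₀ hmem₀ b)
      have h2 : (((𝓔 ×ˢ (Finset.univ : Finset Bool)).card : ℕ) : ℝ) ≤ 2 * M := by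
        rw [Finset.card_product, Finset.card_univ, Fintype.card_bool]
        have : 𝓔.card * 2 ≤ 2 * M := by omega
        exact_mod_cast this
      have h3 := hW.sub_le_diff (E e₀ b)
        (⋃ i ∈ 𝓔 ×ˢ (Finset.univ : Finset Bool), nb G (Y i.1 i.2) ∩ E e₀ b)
      have h4 : E e₀ b \ (⋃ i ∈ 𝓔 ×ˢ (Finset.univ : Finset Bool), nb G (Y i.1 i.2) ∩ E e₀ b) ⊆
          E e₀ b \ Z := by
        rintro x ⟨hx, hx'⟩
        refine ⟨hx, fun hxZ => hx' ?_⟩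
        simp only [hZ, Set.mem_iUnion] at hxZ ⊢
        obtain ⟨i, hi, hxi⟩ := hxZ
        exact ⟨i, hi, hxi, hx⟩
      have h5 := hW.mono h4
      have h6 := hEθ e₀ hmem₀ b
      have h7 : ((𝓔 ×ˢ (Finset.univ : Finset Bool)).card : ℝ) * (η + c) ≤ 2 * M * (2 * η) := by
        apply mul_le_mul h2 (by linarith) (by linarith) (by linarith)
      have h8 : η ≤ M * η := by nlinarith
      linarith
    -- The two unseen parts are heavy, so they contain equal or adjacent vertices; adding light
    -- access sets on both sides gives a connection whose neighbourhood has weight at most `4 * c`.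
    obtain ⟨y₁, hy₁, y₀, hy₀, hyy⟩ := hW.exists_inter_nb (hbig false) (hbig true)
    have hyE : ∀ b, ∀ y ∈ E e₀ b, ∃ π ⊆ X e₀ b, Conn G (π ∪ {y}) ∧ ℓ e₀ b ∈ π ∧
        μ (nb G π) ≤ c := by
      intro b y hy
      obtain ⟨x, hx, hxy⟩ := (hE e₀ hmem₀ b hy).1
      obtain ⟨π, h1, h2, h3, h4, h5⟩ := (hX e₀ hmem₀ b).2 x hx
      exact ⟨π, h1, h2.union (conn_singleton y)
        ⟨x, h4, mem_nb_singleton_comm.1 (mem_nb_singleton.2 hxy)⟩, h3, h5⟩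
    obtain ⟨π₀, hπ₀, hc₀, hl₀, hμ₀⟩ := hyE false y₀ hy₀.1
    obtain ⟨π₁, hπ₁, hc₁, hl₁, hμ₁⟩ := hyE true y₁ hy₁.1
    set Q₀ : Set W := (π₀ ∪ {y₀}) ∪ (π₁ ∪ {y₁}) with hQ₀
    have hQc : Conn G Q₀ := by
      refine hc₀.union hc₁ ⟨y₀, Or.inr rfl, nb_mono Set.subset_union_right ?_⟩
      rcases hyy with rfl | h
      · exact subset_nb rfl
      · exact mem_nb_singleton.2 (Or.inr h.symm)
    have hQμ : μ (nb G Q₀) ≤ 4 * c := by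
      rw [hQ₀, nb_union, nb_union, nb_union]
      have h1 := hW.union_le (nb G π₀ ∪ nb G {y₀}) (nb G π₁ ∪ nb G {y₁})
      have h2 := hW.union_le (nb G π₀) (nb G {y₀})
      have h3 := hW.union_le (nb G π₁) (nb G {y₁})
      have h4 := hW.nb_le y₀
      have h5 := hW.nb_le y₁
      linarith
    have hQF : Q₀ ⊆ F ∪ X e₀ false ∪ X e₀ true := by
      rintro x ((hx | rfl) | (hx | rfl))
      · exact Or.inl (Or.inr (hπ₀ hx))
      · exact Or.inl (Or.inl (hE e₀ hmem₀ _ hy₀.1).2)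
      · exact Or.inr (hπ₁ hx)
      · exact Or.inl (Or.inl (hE e₀ hmem₀ _ hy₁.1).2)
    have hyY : ∀ b, ∀ y ∈ E e₀ b \ Z, ∀ e ∈ 𝓔, ∀ b', AC G {y} (Y e b') := by
      intro b y hy e he b'
      refine (ac_iff.2 ?_ : AC G (Y e b') {y}).symm
      rintro _ rfl hmem
      refine hy.2 ?_
      simp only [hZ, Set.mem_iUnion]
      exact ⟨(e, b'), Finset.mem_product.2 ⟨he, Finset.mem_univ _⟩, hmem⟩
    have hQY : ∀ e ∈ 𝓔, ∀ b, AC G Q₀ (Y e b) := by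
      intro e he b
      have hne : ∀ b', (e₀, b') ≠ (e, b) := by
        rintro b' h
        rw [Prod.mk.injEq] at h
        exact he₀ (h.1 ▸ he)
      refine AC.union_left (AC.union_left ?_ (hyY _ _ hy₀ e he b))
        (AC.union_left ?_ (hyY _ _ hy₁ e he b))
      · exact (hXX e₀ hmem₀ false e (hmem e he) b (hne _)).mono hπ₀ (hY e b he).1
      · exact (hXX e₀ hmem₀ true e (hmem e he) b (hne _)).mono hπ₁ (hY e b he).1
    -- The other connections must use vertices outside the closed neighbourhood of `Q₀`; this costs
    -- at most `4 * c ≤ η / 2`.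
    obtain ⟨Q, hQ1, hQ2⟩ := ih (by omega) Y ℓ
      (fun e b => (nb G (Y e b) ∩ E (d e b).1 (d e b).2) \ nb G Q₀) (F \ nb G Q₀) (η / 2)
      (fun e he b => (hY e b he).2.1)
      (fun e he b e' he' b' hne => (hXX e (hmem e he) b e' (hmem e' he') b' hne).mono
        (hY e b he).1 (hY e' b' he').1)
      (fun e he b x hx => ⟨hx.1.1, (hE _ (hY e b he).2.2.1.1 _ hx.1.2).2, hx.2⟩)
      (fun e he b => by
        have h1 := (hY e b he).2.2.1.2
        have h2 := hW.sub_le_diff (nb G (Y e b) ∩ E (d e b).1 (d e b).2) (nb G Q₀)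
        linarith)
      hpow'
    have hac : ∀ e ∈ 𝓔, AC G Q₀ (Q e) := by
      intro e he
      refine AC.mono (B := (F \ nb G Q₀) ∪ Y e false ∪ Y e true) ?_ subset_rfl (hQ1 e he).2.2
      exact AC.union_right (AC.union_right (ac_iff.2 fun x hx => hx.2) (hQY e he _)) (hQY e he _)
    refine ⟨fun e => if e = e₀ then Q₀ else Q e, ?_, ?_⟩
    · intro e he
      by_cases h : e = e₀
      · subst h
        simp only [if_true]
        refine ⟨hQc, fun b => ?_, hQF⟩
        cases b
        · exact Or.inl (Or.inl hl₀)
        · exact Or.inr (Or.inl hl₁)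
      · simp only [h, if_false]
        have he' := Finset.mem_of_mem_insert_of_ne he h
        obtain ⟨h1, h2, h3⟩ := hQ1 e he'
        refine ⟨h1, h2, h3.trans ?_⟩
        exact Set.union_subset_union (Set.union_subset_union Set.sdiff_subset (hY e _ he').1)
          (hY e _ he').1
    · intro e he e' he' hne
      by_cases h : e = e₀
      · subst h
        simp only [if_true, hne.symm, if_false]
        exact hac e' (Finset.mem_of_mem_insert_of_ne he' hne.symm)
      · have he1 := Finset.mem_of_mem_insert_of_ne he h
        by_cases h' : e' = e₀
        · subst h'
          simp only [if_true, h, if_false]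
          exact (hac e he1).symm
        · simp only [h, h', if_false]
          exact hQ2 e he1 e' (Finset.mem_of_mem_insert_of_ne he' h') hne

end Link

/-- If every heavy set contains a heavy ball, then the required configuration exists. -/
theorem exists_conf_of_dense {V : Type u} [Finite V] (f κ : V → ℕ) (hf : Function.Injective f)
    (hκ : Function.Injective κ) (B : V → V → Prop) (hB : ∀ u w, B u w → f u < f w) :
    ∃ δ c : ℝ, 0 < δ ∧ 0 < c ∧ ∀ (W : Type v) [Finite W] (G : SimpleGraph W) (μ : Set W → ℝ)
      (ε : ℝ), Wt G μ ε → 1 ≤ μ Set.univ → ε ≤ c →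
      (∀ A, δ ≤ μ A → ∃ v ∈ A, ε ≤ μ (ball G A v 5)) →
      ∃ q Q, Conf (fun u w => f u + 1 = f w ∨ f w + 1 = f u) B G q Q := by
  classical
  obtain ⟨_⟩ := nonempty_fintype V
  set N := Finset.univ.sup f + 1 with hN
  set m := Finset.univ.sup κ + 1 with hm
  have hfN : ∀ u, f u < N := fun u => Nat.lt_succ_of_le (Finset.le_sup (f := f) (Finset.mem_univ u))
  have hκm : ∀ u, κ u < m := fun u => Nat.lt_succ_of_le (Finset.le_sup (f := κ) (Finset.mem_univ u))
  obtain ⟨n₀, F, hgame⟩ := Game.exists_rank ℕ m (N * (m + 1)) 0 0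
  set θ : ℝ := 1 / (4 * 2 ^ n₀) with hθ
  have hθpos : 0 < θ := by positivity
  set δ : ℝ := θ / 12 ^ F with hδ
  have hδpos : 0 < δ := by positivity
  have hδθ : δ ≤ θ := div_le_self hθpos.le (one_le_pow₀ (by norm_num))
  set M := (Finset.univ : Finset (V × V)).card + 1 with hM
  have hM1 : (1 : ℝ) ≤ M := by exact_mod_cast Nat.succ_pos _
  -- The summands serve, in order, the joining of blobs with access cost `12 * ε`, the removal of
  -- the neighbourhoods of the chosen spine vertices, and the condition `24 * ε ≤ δ` of the game.
  set K : ℝ := 2 * (64 * M * 12 * (16 * M) ^ M) + 2 * (Fintype.card V : ℝ) + 24 with hK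
  have hKpos : 0 < K := by positivity
  refine ⟨δ, δ / K, hδpos, div_pos hδpos hKpos, fun W _ G μ ε hW hμ hεc hball => ?_⟩
  have hpos := hW.pos
  have hεK : ε * K ≤ δ := by rwa [le_div_iff₀ hKpos] at hεc
  have hpowM : (0 : ℝ) ≤ 64 * M * 12 * (16 * M) ^ M := by positivity
  have hε24 : 24 * ε ≤ δ := by
    have : 24 ≤ K := by rw [hK]; linarith [Nat.cast_nonneg (α := ℝ) (Fintype.card V)]
    nlinarith
  obtain ⟨S, -, hSμ, hSd⟩ := hW.exists_separate (Finset.range n₀) (fun _ => Set.univ)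
    (fun _ e => e) 1 (fun _ _ => hμ)
    (fun a _ y => (hW.mono (by rintro e ⟨-, rfl⟩; exact subset_nb rfl)).trans (hW.nb_le y)) (by
      rw [Finset.card_range]
      have : ε ≤ θ := by linarith
      rwa [hθ, le_div_iff₀ (by positivity)] at this)
  rw [Finset.card_range] at hSμ
  have hgood : Good G μ (DenseBlob G μ ε δ) m 0 0 Set.univ (θ / 12 ^ 0) (Finset.range n₀)
      (fun _ => 0) (fun _ => 0) := by
    refine ⟨S, fun _ => ∅, fun _ e _ => e, ?_⟩
    constructor
    · intro j hj
      rw [pow_zero, div_one]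
      exact hSμ j hj
    · simp
    · simp
    · exact fun _ _ _ _ _ => ac_empty_left
    · exact fun _ _ _ _ _ _ _ _ _ => ac_empty_left.symm
    · exact fun _ _ _ _ _ _ => ac_empty_left.symm
    · exact fun _ _ e _ => ⟨∅, subset_rfl, RC.base e⟩
    · exact fun i hi j hj hij e he e' he' _ _ _ _ => hSd i hi j hj hij e he e' he'
    · intro _ _ _ _ _ _ l hl l' hl' _; simp at hl hl'; omega
    · simp
    · intro _ _ _ _ l hl; simp at hl
    · simp
    · simp
  obtain ⟨n, J, p, r, hn, ⟨S, U, ln, hlay⟩, j, hj, hR⟩ := hgame F _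
    (dense_game hW (ι := ℕ) (θ := θ) (m := m) (F := F) (Nat.succ_pos _) hε24 hball) 0 _ _ _ hgood
    (by simp) (by simp) (by omega)
  obtain ⟨e, he⟩ := hW.nonempty_of_pos (X := S j) (lt_of_lt_of_le (by positivity) (hlay.heavy j hj))
  obtain ⟨D, -, hrc⟩ := hlay.rc j hj e he
  obtain ⟨q, X, hcat⟩ := hrc.exists_caterpillar hR
  -- the two blobs to be joined for a pair
  set Xp : V × V → Bool → Set W := fun i b =>
    if b then X (f i.2) (κ i.1) else X (f i.1) (κ i.2) with hXp
  set qp : V × V → Bool → W := fun i b => if b then q (f i.2) else q (f i.1) with hqp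
  have hXpq : ∀ i b, ∃ x ∈ Xp i b, G.Adj (qp i b) x := by
    rintro i (_ | _)
    · exact hcat.adj _ (hfN _) _ (hκm _)
    · exact hcat.adj _ (hfN _) _ (hκm _)
  choose ℓ hℓ hℓadj using hXpq
  have hblob : ∀ i b, DenseBlob G μ ε δ (Xp i b) := by
    rintro i (_ | _)
    · exact hcat.blob _ (hfN _) _ (hκm _)
    · exact hcat.blob _ (hfN _) _ (hκm _)
  set 𝓔 : Finset (V × V) := Finset.univ.filter fun i => B i.1 i.2 with h𝓔
  have h𝓔card : 𝓔.card ≤ M := (Finset.card_le_card (Finset.filter_subset _ _)).trans (Nat.le_succ _)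
  -- The connections avoid `T`, so apart from the blobs themselves they neither contain nor touch a
  -- chosen spine vertex.
  set T : Set W := ⋃ v ∈ (Finset.univ : Finset V), nb G {q (f v)} with hT
  have hTμ : μ T ≤ (Fintype.card V : ℝ) * ε := by
    have := hW.biUnion_le (Finset.univ : Finset V) (fun v => nb G {q (f v)}) ε
      (fun v _ => hW.nb_le _)
    rwa [Finset.card_univ] at this
  -- The base point of each blob is moved to a neighbour of its spine vertex, so that the connection
  -- starts there; hence the factor two.
  obtain ⟨Q, hQ1, hQ2⟩ := exists_links hW (c := 2 * (6 * ε)) (by linarith) (M := M)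
    (Nat.succ_pos _) 𝓔 h𝓔card Xp ℓ (fun i b => nb G (Xp i b) ∩ Tᶜ) Tᶜ (δ / 2)
    (fun i _ b => by
      obtain ⟨v, hv, -⟩ := hblob i b
      exact hv.change hW (hℓ i b))
    (by
      intro i hi b i' hi' b' hne
      have h1 := hB _ _ (Finset.mem_filter.1 hi).2
      have h2 := hB _ _ (Finset.mem_filter.1 hi').2
      cases b <;> cases b'
      · refine hcat.ac _ (hfN _) _ (hκm _) _ (hfN _) _ (hκm _) fun h => hne ?_
        rw [Prod.mk.injEq] at h
        rw [Prod.ext (hf h.1) (hκ h.2)]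
      · refine hcat.ac _ (hfN _) _ (hκm _) _ (hfN _) _ (hκm _) fun h => ?_
        rw [Prod.mk.injEq] at h
        have h3 := hκ h.2
        rw [h3] at h1
        omega
      · refine hcat.ac _ (hfN _) _ (hκm _) _ (hfN _) _ (hκm _) fun h => ?_
        rw [Prod.mk.injEq] at h
        have h3 := hκ h.2
        rw [h3] at h1
        omega
      · refine hcat.ac _ (hfN _) _ (hκm _) _ (hfN _) _ (hκm _) fun h => hne ?_
        rw [Prod.mk.injEq] at h
        rw [Prod.ext (hκ h.2) (hf h.1)])
    (fun _ _ _ => subset_rfl)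
    (by
      intro i _ b
      obtain ⟨v, -, hv⟩ := hblob i b
      have h1 := hW.sub_le_diff (nb G (Xp i b)) T
      rw [Set.sdiff_eq] at h1
      have h2 : 2 * ((Fintype.card V : ℝ) * ε) ≤ δ := by
        have : 2 * (Fintype.card V : ℝ) ≤ K := by rw [hK]; linarith
        nlinarith
      linarith)
    (by
      have h1 : (16 * (M : ℝ)) ^ 𝓔.card ≤ (16 * M) ^ M :=
        pow_le_pow_right₀ (by linarith) h𝓔card
      have h2 : 2 * (64 * M * 12 * (16 * M) ^ M) * ε ≤ δ := by
        have : 2 * (64 * M * 12 * (16 * M) ^ M) ≤ K := by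
          rw [hK]; linarith [Nat.cast_nonneg (α := ℝ) (Fintype.card V)]
        nlinarith
      have h3 : 64 * M * (2 * (6 * ε)) * (16 * (M : ℝ)) ^ 𝓔.card ≤
          64 * M * (2 * (6 * ε)) * (16 * M) ^ M :=
        mul_le_mul_of_nonneg_left h1 (by positivity)
      linarith)
  have hmem : ∀ u w, B u w → (u, w) ∈ 𝓔 := fun u w h => by simp [h𝓔, h]
  have hTq : ∀ v, ∀ x ∈ Tᶜ, x ≠ q (f v) ∧ ¬ G.Adj (q (f v)) x := by
    intro v x hx
    have h1 : x ∉ nb G {q (f v)} := fun h => hx (by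
      simp only [hT, Set.mem_iUnion]; exact ⟨v, Finset.mem_univ _, h⟩)
    rw [mem_nb_singleton, not_or] at h1
    exact h1
  refine ⟨fun v => q (f v), fun u w => Q (u, w), ⟨?_, ?_, ?_, ?_, ?_, ?_, ?_, ?_⟩⟩
  · intro u w huw
    by_contra hne
    rcases lt_or_gt_of_ne (hf.ne hne) with h | h
    · exact hcat.ne _ _ h (hfN _) huw
    · exact hcat.ne _ _ h (hfN _) huw.symm
  · exact fun u w huw => hcat.path _ (hfN _) _ (hfN _) (hf.ne huw)
  · exact fun u w h => (hQ1 _ (hmem u w h)).1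
  · exact fun u w h => ⟨_, (hQ1 _ (hmem u w h)).2.1 false, hℓadj (u, w) false⟩
  · exact fun u w h => ⟨_, (hQ1 _ (hmem u w h)).2.1 true, hℓadj (u, w) true⟩
  · intro u w h v hv
    rcases (hQ1 _ (hmem u w h)).2.2 hv with (h1 | h1) | h1
    · exact (hTq v _ h1).1 rfl
    · exact hcat.notMem _ (hfN _) _ (hκm _) _ (hfN _) h1
    · exact hcat.notMem _ (hfN _) _ (hκm _) _ (hfN _) h1
  · intro u w h v hvu hvw x hx
    rcases (hQ1 _ (hmem u w h)).2.2 hx with (h1 | h1) | h1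
    · exact (hTq v _ h1).2
    · exact hcat.not_adj _ (hfN _) _ (hκm _) _ (hfN _) (hf.ne hvu) x h1
    · exact hcat.not_adj _ (hfN _) _ (hκm _) _ (hfN _) (hf.ne hvw) x h1
  · exact fun u w u' w' h h' hne => hQ2 _ (hmem u w h) _ (hmem u' w' h') hne

/-! ### Distances and segments of paths. -/

/-- The vertices `x` and `y` are at distance at most `k`. -/
def Near {W : Type v} (G : SimpleGraph W) (k : ℕ) (x y : W) : Prop := y ∈ (nb G)^[k] {x}

/-- The vertices `f 0, …, f k`. -/
def seg {W : Type v} (f : ℕ → W) (k : ℕ) : Set W := {x | ∃ l ≤ k, x = f l}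

section Near

variable {W : Type v} {G : SimpleGraph W} {x y z : W} {k l : ℕ}

theorem mem_iterate_nb {X : Set W} : y ∈ (nb G)^[k] X ↔ ∃ x ∈ X, Near G k x y := by
  induction k generalizing y with
  | zero => simp [Near]
  | succ k ih =>
    simp only [Near, Function.iterate_succ_apply'] at ih ⊢
    constructor
    · rintro ⟨z, hz, h⟩
      obtain ⟨x, hx, hxz⟩ := ih.1 hz
      exact ⟨x, hx, z, hxz, h⟩
    · rintro ⟨x, hx, z, hz, h⟩
      exact ⟨z, ih.2 ⟨x, hx, hz⟩, h⟩

theorem Near.trans (h : Near G k x y) (h' : Near G l y z) : Near G (l + k) x z := by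
  rw [Near, Function.iterate_add_apply]
  exact mem_iterate_nb.2 ⟨y, h, h'⟩

theorem near_one : Near G 1 x y ↔ y ∈ nb G {x} := by simp [Near]

theorem near_one_of_adj (h : G.Adj x y) : Near G 1 x y :=
  near_one.2 (mem_nb_singleton.2 (Or.inr h))

theorem near_refl : Near G k x x := by
  induction k with
  | zero => simp [Near]
  | succ k ih =>
    rw [Near, Function.iterate_succ_apply']
    exact subset_nb ih

theorem Near.mono (h : Near G k x y) (hkl : k ≤ l) : Near G l x y := by
  obtain ⟨d, rfl⟩ := Nat.exists_eq_add_of_le hkl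
  rw [Nat.add_comm]
  exact h.trans near_refl

theorem Near.symm (h : Near G k x y) : Near G k y x := by
  induction k generalizing y with
  | zero =>
    have h' : y = x := by simpa [Near] using h
    subst h'; exact near_refl
  | succ k ih =>
    rw [Near, Function.iterate_succ_apply'] at h
    obtain ⟨z, hz, h⟩ := mem_nb_iff.1 h
    exact (near_one.2 (mem_nb_singleton_comm.1 h)).trans (ih hz)

theorem conn_seg {f : ℕ → W} (h : ∀ l < k, G.Adj (f l) (f (l + 1))) : Conn G (seg f k) := by
  induction k with
  | zero =>
    have : seg f 0 = {f 0} := by ext x; simp [seg]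
    rw [this]; exact conn_singleton _
  | succ k ih =>
    have h1 : seg f (k + 1) = insert (f (k + 1)) (seg f k) := by
      ext x
      simp only [seg, Set.mem_ofPred_eq, Set.mem_insert_iff]
      constructor
      · rintro ⟨l, hl, rfl⟩
        rcases hl.lt_or_eq with h | rfl
        · exact Or.inr ⟨l, by omega, rfl⟩
        · exact Or.inl rfl
      · rintro (rfl | ⟨l, hl, rfl⟩)
        · exact ⟨k + 1, le_rfl, rfl⟩
        · exact ⟨l, by omega, rfl⟩
    rw [h1]
    exact (ih fun l hl => h l (by omega)).insert ⟨f k, ⟨k, le_rfl, rfl⟩, h k (by omega)⟩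

theorem near_of_path {f : ℕ → W} (h : ∀ l < k, G.Adj (f l) (f (l + 1))) (hl : l ≤ k) :
    Near G l (f 0) (f l) := by
  induction l with
  | zero => exact near_refl
  | succ l ih =>
    rw [Nat.add_comm l 1]
    exact (ih (by omega)).trans (near_one_of_adj (Nat.add_comm l 1 ▸ h l (by omega)))

end Near

/-! ### The game when balls are light. -/

section LocallySparse

variable {W : Type v} {G : SimpleGraph W} {μ : Set W → ℝ} {ε : ℝ}

/-- The blobs in the case that balls are light: connected sets that contain one of the cores. -/
def SparseBlob (G : SimpleGraph W) (Core : Set W → Prop) (Reg X : Set W) : Prop :=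
  Conn G X ∧ (∃ K ⊆ X, Core K) ∧ X ⊆ Reg

variable {ι : Type*} {Core : Set W → Prop} {Reg : Set W} {m : ℕ} {θ : ℝ} {J : Finset ι}
  {p r : ι → ℕ} {S U : ι → Set W} {ln : ι → W → ℕ → W}

theorem Layout.near (h : Layout G μ (SparseBlob G Core Reg) m 2 1 Reg θ J p r S U ln) {j : ι}
    (hj : j ∈ J) {e : W} (he : e ∈ S j) {l : ℕ} (hl : l ≤ p j) : Near G 2 e (ln j e l) := by
  have h1 := near_of_path (h.adj j hj e he) hl
  rw [h.zero j hj e he] at h1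
  exact h1.mono (hl.trans (h.pos_le j hj))

/-- A path newly touched through the path of `e` starts within distance `2 + 1 + 2 = 5` of `e`. As
balls of radius five are light, adding one path at a time makes the touched weight grow slowly. -/
theorem Layout.touched_subset (h : Layout G μ (SparseBlob G Core Reg) m 2 1 Reg θ J p r S U ln)
    {s j : ι} (hs : s ∈ J) (hj : j ∈ J) {e : W} (he : e ∈ S s) {X X' : Set W}
    (hX : X' ⊆ X ∪ seg (ln s e) (p s)) {k : ℕ} (hk : k ≤ p j) :
    touched G (S j) (ln j) k X' ⊆ touched G (S j) (ln j) k X ∪ (nb G)^[5] {e} := by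
  rintro e' ⟨he', l, hl, hmem⟩
  have hmem' := nb_mono hX hmem
  rw [nb_union] at hmem'
  rcases hmem' with h1 | h1
  · exact Or.inl ⟨he', l, hl, h1⟩
  · right
    obtain ⟨_, ⟨l', hl', rfl⟩, h2⟩ := mem_nb_iff.1 h1
    exact ((h.near hs he hl').trans (near_one.2 h2)).trans (h.near hj he' (hl.trans hk)).symm

/-- A piece of the path ending at the root, together with the caterpillar there, is connected and
contains a core because the rank is positive. An object can thus be sacrificed whole as a blob. -/
theorem Layout.blob_of_rc (h : Layout G μ (SparseBlob G Core Reg) m 2 1 Reg θ J p r S U ln)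
    (hm : 0 < m) {s : ι} (hs : s ∈ J) {e : W} (he : e ∈ S s) {D : Set W}
    (hD : D ⊆ U s) (hrc : RC G (SparseBlob G Core Reg) m (r s) (ln s e (p s)) D) {Z : Set W}
    (hZ : Conn G Z) (hpZ : ln s e (p s) ∈ Z) (hZs : Z ⊆ seg (ln s e) (p s)) :
    SparseBlob G Core Reg (Z ∪ insert (ln s e (p s)) D) := by
  refine ⟨hZ.union (hrc.conn fun X hX => hX.1) ⟨_, hpZ, subset_nb (Set.mem_insert _ _)⟩, ?_, ?_⟩
  · obtain ⟨X, hX, -, ⟨K, hK, hKc⟩, -⟩ := hrc.exists_blob hm (h.le_rank s hs)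
    exact ⟨K, (hK.trans hX).trans ((Set.subset_insert _ _).trans Set.subset_union_right), hKc⟩
  · refine Set.union_subset ?_ (Set.insert_subset (h.lnReg s hs e he _ le_rfl)
      (hD.trans (h.UReg s hs)))
    intro x hx
    obtain ⟨l, hl, rfl⟩ := hZs hx
    exact h.lnReg s hs e he l hl

variable [DecidableEq ι]

/-- Whole paths of `s` are added until some other object is sufficiently touched. This must happen,
since the paths contain the heavy set `S s`, which sees almost everything. Any vertex met lies in a
blob made of its path and the caterpillar at its end. -/
theorem sparse_feed [Finite W] (hW : Wt G μ ε) (hball : ∀ v, μ ((nb G)^[5] {v}) ≤ ε) (hm : 0 < m)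
    (hε : 8 * ε ≤ θ) (h : Layout G μ (SparseBlob G Core Reg) m 2 1 Reg θ J p r S U ln) {s : ι}
    (hs : s ∈ J) (hother : ∃ t ∈ J, t ≠ s) :
    ∃ t ∈ J, t ≠ s ∧
      ((r t % (m + 1) < m → Good G μ (SparseBlob G Core Reg) m 2 1 Reg (θ / 12) (J.erase s) p
          (Function.update r t (r t + 1))) ∨
        ∃ i < p t, Good G μ (SparseBlob G Core Reg) m 2 1 Reg (θ / 12) J (Function.update p s i)
          (Function.update r s 1)) := by
  have hpos := hW.pos
  set L : Set W → Set W := fun Y => ⋃ e ∈ Y, seg (ln s e) (p s) with hL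
  obtain ⟨Y, -, -, hYS, ⟨t, ⟨ht, hts⟩, htY⟩, hY⟩ := exists_trim (α := W) (fun _ => True)
    (fun j Y => μ (touched G (S j) (ln j) (p j) (L Y))) {j | j ∈ J ∧ j ≠ s} (X₀ := ∅) (X₁ := S s)
    (η := θ / 4) (c := ε) trivial (Set.empty_subset _)
    (by
      intro j _
      have h1 : touched G (S j) (ln j) (p j) (L ∅) = ∅ := by
        ext e; simp [touched, hL, nb]
      simp only [h1, hW.empty]
      linarith)
    (by
      obtain ⟨t, ht, hts⟩ := hother
      refine ⟨t, ⟨ht, hts⟩, ?_⟩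
      have h1 := hW.compl_nb_lt (X := S s) (by have := h.heavy s hs; linarith)
      have h2 := hW.sub_le_diff (S t) (nb G (S s))ᶜ
      have h3 := h.heavy t ht
      have h4 : S t \ (nb G (S s))ᶜ ⊆ touched G (S t) (ln t) (p t) (L (S s)) := by
        rintro e ⟨he, hmem⟩
        refine ⟨he, 0, Nat.zero_le _, ?_⟩
        rw [h.zero t ht e he]
        refine nb_mono ?_ (not_not.1 hmem)
        intro x hx
        simp only [hL, Set.mem_iUnion]
        exact ⟨x, hx, 0, Nat.zero_le _, (h.zero s hs x hx).symm⟩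
      have h5 := hW.mono h4
      linarith)
    (by
      intro Y _ _ hYS hne
      obtain ⟨e, heS, heY⟩ := Set.exists_of_ssubset (hYS.ssubset_of_ne hne)
      refine ⟨insert e Y, trivial, Set.subset_insert _ _, fun h' => heY (h' ▸ Set.mem_insert _ _),
        Set.insert_subset heS hYS, fun j hj => ?_⟩
      have h1 := hW.mono (h.touched_subset hs hj.1 heS (X := L Y) (X' := L (insert e Y)) (by
        simp only [hL, Set.biUnion_insert]
        rw [Set.union_comm]) le_rfl)
      have h2 := hW.union_le (touched G (S j) (ln j) (p j) (L Y)) ((nb G)^[5] {e})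
      have h3 := hball e
      linarith)
  have hblob : ∀ x ∈ L Y, ∃ Z ⊆ U s ∪ L Y, x ∈ Z ∧ SparseBlob G Core Reg Z := by
    intro x hx
    simp only [hL, Set.mem_iUnion] at hx
    obtain ⟨e, heY, hxe⟩ := hx
    have he := hYS heY
    obtain ⟨D, hD, hrc⟩ := h.rc s hs e he
    have hsub : seg (ln s e) (p s) ⊆ L Y := by
      intro z hz
      simp only [hL, Set.mem_iUnion]
      exact ⟨e, heY, hz⟩
    refine ⟨seg (ln s e) (p s) ∪ insert (ln s e (p s)) D, ?_, Or.inl hxe,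
      h.blob_of_rc hm hs he hD hrc (conn_seg (h.adj s hs e he)) ⟨_, le_rfl, rfl⟩ subset_rfl⟩
    refine Set.union_subset (hsub.trans Set.subset_union_right) (Set.insert_subset ?_ ?_)
    · exact Or.inr (hsub ⟨_, le_rfl, rfl⟩)
    · exact hD.trans Set.subset_union_left
  obtain ⟨t, ht, hts, h' | h'⟩ := h.hit hW le_rfl le_rfl hs (X := L Y)
    (θ' := θ / 12) (by linarith) (ρ := 1) le_rfl
    (by
      intro x hx
      simp only [hL, Set.mem_iUnion] at hx
      obtain ⟨e, heY, l, hl, rfl⟩ := hx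
      exact ⟨e, hYS heY, l, hl, rfl⟩)
    (by
      intro j hj hjs
      have h1 := hY j ⟨hj, hjs⟩
      have h2 := hW.sub_le_diff (S j) (touched G (S j) (ln j) (p j) (L Y))
      have h3 := h.heavy j hj
      linarith)
    ⟨t, ht, hts, by linarith⟩ hblob
    (by
      rintro b ⟨x, hx, hbx⟩ hbX hbU
      obtain ⟨Z, hZ, hxZ, hB⟩ := hblob x hx
      refine ⟨∅ ∪ Z, by simpa using hZ, (RC.base b).blob (by simpa using hm) hB ⟨x, hxZ, hbx⟩
        ?_ ac_empty_left⟩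
      intro hbZ
      rcases hZ hbZ with h1 | h1
      · exact (hbU _ rfl _ h1).1 rfl
      · exact hbX h1)
  · exact ⟨t, ht, hts, Or.inl h'.2⟩
  · exact ⟨t, ht, hts, Or.inr h'⟩

/-- Only roots of `s` are added this time, so that a vertex touching them can become the next spine
vertex. The roots may be few and see little of other objects, but every path of `s` has a vertex
just before its root; hence contacts with `s` itself at earlier positions are counted too, and lead
to a lower position. -/
theorem sparse_push [Finite W] (hW : Wt G μ ε) (hball : ∀ v, μ ((nb G)^[5] {v}) ≤ ε) (hm : 0 < m)
    (hε : 8 * ε ≤ θ) (h : Layout G μ (SparseBlob G Core Reg) m 2 1 Reg θ J p r S U ln) {s : ι}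
    (hs : s ∈ J) (hother : ∃ t ∈ J, t ≠ s) (hmod : r s % (m + 1) = m) :
    (∃ t ∈ J, t ≠ s ∧
      Good G μ (SparseBlob G Core Reg) m 2 1 Reg (θ / 12) (J.erase s) p
        (Function.update r t (r s + 1)) ∧
      (r t % (m + 1) < m → Good G μ (SparseBlob G Core Reg) m 2 1 Reg (θ / 12) (J.erase s) p
        (Function.update r t (r t + 1)))) ∨
    ∃ i, (∃ t ∈ J, i < p t) ∧ Good G μ (SparseBlob G Core Reg) m 2 1 Reg (θ / 12) J
      (Function.update p s i) (Function.update r s (r s + 1)) := by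
  have hpos := hW.pos
  set L : Set W → Set W := fun Y => (fun e => ln s e (p s)) '' Y with hL
  -- For `j = s` only positions strictly before the root count. If `p s = 0` there are none, but
  -- then the roots form the heavy set `S s` and must touch another object.
  obtain ⟨Y, -, -, hYS, ⟨t, ht, htY⟩, hY⟩ := exists_trim (α := W) (fun _ => True)
    (fun j Y => if j = s then (if p s = 0 then 0 else μ (touched G (S s) (ln s) (p s - 1) (L Y)))
      else μ (touched G (S j) (ln j) (p j) (L Y))) {j | j ∈ J} (X₀ := ∅) (X₁ := S s)
    (η := θ / 4) (c := ε) trivial (Set.empty_subset _)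
    (by
      intro j _
      have h1 : ∀ j k, touched G (S j) (ln j) k (L ∅) = ∅ := by
        intro j k
        ext e; simp [touched, hL, nb]
      simp only [h1, hW.empty, ite_self]
      linarith)
    (by
      by_cases hp : p s = 0
      · obtain ⟨t, ht, hts⟩ := hother
        refine ⟨t, ht, ?_⟩
        simp only [hts, if_false]
        have h1 := hW.compl_nb_lt (X := S s) (by have := h.heavy s hs; linarith)
        have h2 := hW.sub_le_diff (S t) (nb G (S s))ᶜ
        have h3 := h.heavy t ht
        have h4 : S t \ (nb G (S s))ᶜ ⊆ touched G (S t) (ln t) (p t) (L (S s)) := by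
          rintro e ⟨he, hmem⟩
          refine ⟨he, 0, Nat.zero_le _, ?_⟩
          rw [h.zero t ht e he]
          refine nb_mono ?_ (not_not.1 hmem)
          intro x hx
          exact ⟨x, hx, by simp only [hp]; exact h.zero s hs x hx⟩
        have h5 := hW.mono h4
        linarith
      · refine ⟨s, hs, ?_⟩
        simp only [if_true, hp, if_false]
        have h3 := h.heavy s hs
        have h4 : S s ⊆ touched G (S s) (ln s) (p s - 1) (L (S s)) := by
          intro e he
          refine ⟨he, p s - 1, le_rfl, mem_nb_of_adj ⟨e, he, rfl⟩ ?_⟩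
          have h5 := h.adj s hs e he (p s - 1) (by omega)
          rw [Nat.sub_add_cancel (by omega)] at h5
          exact h5.symm
        have h5 := hW.mono h4
        linarith)
    (by
      intro Y _ _ hYS hne
      obtain ⟨e, heS, heY⟩ := Set.exists_of_ssubset (hYS.ssubset_of_ne hne)
      refine ⟨insert e Y, trivial, Set.subset_insert _ _, fun h' => heY (h' ▸ Set.mem_insert _ _),
        Set.insert_subset heS hYS, fun j hj => ?_⟩
      have hsub : L (insert e Y) ⊆ L Y ∪ seg (ln s e) (p s) := by
        simp only [hL, Set.image_insert_eq]
        rintro x (rfl | hx)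
        · exact Or.inr ⟨_, le_rfl, rfl⟩
        · exact Or.inl hx
      have key : ∀ j ∈ J, ∀ k ≤ p j, μ (touched G (S j) (ln j) k (L (insert e Y))) ≤
          μ (touched G (S j) (ln j) k (L Y)) + ε := by
        intro j hj k hk
        have h1 := hW.mono (h.touched_subset hs hj heS hsub hk)
        have h2 := hW.union_le (touched G (S j) (ln j) k (L Y)) ((nb G)^[5] {e})
        have h3 := hball e
        linarith
      by_cases hjs : j = s
      · subst hjs
        by_cases hp : p j = 0
        · simp only [hp, if_true]; linarith
        · simp only [hp, if_true, if_false]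
          exact key j hj _ (Nat.sub_le _ _)
      · simp only [hjs, if_false]
        exact key j hj _ le_rfl)
  have hXe : ∀ x ∈ L Y, ∃ e ∈ S s, x = ln s e (p s) := by
    rintro x ⟨e, he, rfl⟩
    exact ⟨e, hYS he, rfl⟩
  have hX : ∀ x ∈ L Y, ∃ e ∈ S s, ∃ l ≤ p s, x = ln s e l := by
    intro x hx
    obtain ⟨e, he, rfl⟩ := hXe x hx
    exact ⟨e, he, _, le_rfl, rfl⟩
  have hθ : ∀ j ∈ J, j ≠ s → θ / 12 ≤ μ (S j \ touched G (S j) (ln j) (p j) (L Y)) := by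
    intro j hj hjs
    have h1 := hY j hj
    simp only [hjs, if_false] at h1
    have h2 := hW.sub_le_diff (S j) (touched G (S j) (ln j) (p j) (L Y))
    have h3 := h.heavy j hj
    linarith
  have hnew : ∀ b, (∃ x ∈ L Y, G.Adj b x) → b ∉ L Y → AC G {b} (U s) →
      ∃ D ⊆ U s ∪ L Y, RC G (SparseBlob G Core Reg) m (r s + 1) b D := by
    rintro b ⟨x, hx, hbx⟩ - hbU
    obtain ⟨e, he, rfl⟩ := hXe x hx
    obtain ⟨D, hD, hrc⟩ := h.rc s hs e he
    exact ⟨_, Set.insert_subset (Or.inr hx) (hD.trans Set.subset_union_left),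
      hrc.spine hmod hbx (hbU.mono subset_rfl hD)⟩
  by_cases hts : t = s
  · subst hts
    by_cases hp : p t = 0
    · simp only [hp, if_true] at htY; linarith
    simp only [if_true, hp, if_false] at htY
    obtain ⟨i, hi, hCi⟩ := exists_firstAt hW (T := S t) (l := ln t) (X := L Y)
      (k := p t - 1)
      (by have := h.pos_le t ht; omega) (η := θ / 12) (by linarith) (by linarith)
    have hip : i < p t := by omega
    refine Or.inr ⟨i, ⟨t, ht, hip⟩, h.lower_move le_rfl ht ht (by omega) hip hX hθ hCi ?_⟩
    rintro e ⟨he, hmem, -⟩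
    have hnot : ln t e i ∉ L Y := by
      intro hx
      obtain ⟨e', he', heq⟩ := hXe _ hx
      have := h.inner t ht e he e' he' i hip.le _ le_rfl heq
      omega
    refine hnew _ ?_ hnot (h.acself t ht e he i hip)
    obtain ⟨x, hx, heq | hxy⟩ := hmem
    · exact (hnot (heq ▸ hx)).elim
    · exact ⟨x, hx, hxy.symm⟩
  · simp only [hts, if_false] at htY
    obtain ⟨t, ht, hts, h' | ⟨i, hi, h'⟩⟩ := h.hit hW le_rfl le_rfl hs (X := L Y)
      (θ' := θ / 12) (by linarith) (ρ := r s + 1) (by omega) hX hθ ⟨t, ht, hts, by linarith⟩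
      (by
        intro x hx
        obtain ⟨e, he, rfl⟩ := hXe x hx
        obtain ⟨D, hD, hrc⟩ := h.rc s hs e he
        refine ⟨{ln s e (p s)} ∪ insert (ln s e (p s)) D, ?_, Or.inl rfl,
          h.blob_of_rc hm hs he hD hrc (conn_singleton _) rfl ?_⟩
        · refine Set.union_subset ?_ (Set.insert_subset (Or.inr hx)
            (hD.trans Set.subset_union_left))
          rintro _ rfl
          exact Or.inr hx
        · rintro _ rfl
          exact ⟨_, le_rfl, rfl⟩)
      hnew
    · exact Or.inl ⟨t, ht, hts, h'⟩
    · exact Or.inr ⟨i, ⟨t, ht, hi⟩, h'⟩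

theorem sparse_game [Finite W] (hW : Wt G μ ε) (hball : ∀ v, μ ((nb G)^[5] {v}) ≤ ε) {F : ℕ}
    (hm : 0 < m) (hε : 8 * ε ≤ θ / 12 ^ F) :
    Game m F fun n (J : Finset ι) p r =>
      Good G μ (SparseBlob G Core Reg) m 2 1 Reg (θ / 12 ^ n) J p r := by
  have hpos := hW.pos
  have hθ : 0 < θ := by
    by_contra hcon
    have : θ / 12 ^ F ≤ 0 := div_nonpos_of_nonpos_of_nonneg (not_lt.1 hcon) (by positivity)
    linarith
  have hε' : ∀ n < F, 8 * ε ≤ θ / 12 ^ n := fun n hn =>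
    hε.trans (div_le_div_of_nonneg_left hθ.le (by positivity)
      (pow_le_pow_right₀ (by norm_num) hn.le))
  have hdiv : ∀ n, θ / 12 ^ (n + 1) = θ / 12 ^ n / 12 := fun n => by rw [pow_succ, div_div]
  refine ⟨fun h J' hJ' => h.mono hJ', ?_, ?_⟩
  · rintro n J p r hn ⟨S, U, ln, h⟩ s hs hother
    simp only [hdiv]
    exact sparse_feed hW hball hm (hε' n hn) h hs hother
  · rintro n J p r hn ⟨S, U, ln, h⟩ s hs hother hmod
    simp only [hdiv]
    exact sparse_push hW hball hm (hε' n hn) h hs hother hmod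

end LocallySparse

/-! ### Cores, the connections between them and the starting position. -/

/-- A path `f 0 = e, f 1, f 2` from a vertex `e` at distance three from `K` to a neighbour
of `K`. -/
structure IsLine {W : Type v} (G : SimpleGraph W) (K : Set W) (e : W) (f : ℕ → W) : Prop where
  zero : f 0 = e
  adj₀ : G.Adj (f 0) (f 1)
  adj₁ : G.Adj (f 1) (f 2)
  adj₂ : ∃ k ∈ K, G.Adj (f 2) k
  notMem₀ : f 0 ∉ nb G (nb G K)
  mem₁ : f 1 ∈ nb G (nb G K)
  notMem₁ : f 1 ∉ nb G K
  mem₂ : f 2 ∈ nb G K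
  notMem₂ : f 2 ∉ K

/-- Cores `K a` for `a < n` and a connection `PP a b` for every two of them. -/
structure Fabric {W : Type v} (G : SimpleGraph W) (n : ℕ) (K : ℕ → Set W) (PP : ℕ → ℕ → Set W) :
    Prop where
  nonempty : ∀ a < n, (K a).Nonempty
  conn : ∀ a < n, ∀ b < n, Conn G (PP a b)
  left : ∀ a < n, ∀ b < n, ∃ x ∈ PP a b, x ∈ nb G (K a)
  right : ∀ a < n, ∀ b < n, ∃ x ∈ PP a b, x ∈ nb G (K b)
  acK : ∀ a < n, ∀ b < n, ∀ c < n, c ≠ a → c ≠ b → AC G (PP a b) (K c)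
  ac : ∀ a < n, ∀ b < n, ∀ a' < n, ∀ b' < n, (a, b) ≠ (a', b') → AC G (PP a b) (PP a' b')

/-- The region in which the game is played: the cores, and the vertices away from the
connections. -/
def Region {W : Type v} (G : SimpleGraph W) (n : ℕ) (K : ℕ → Set W) (PP : ℕ → ℕ → Set W) : Set W :=
  {x | ∀ a < n, ∀ b < n, AC G {x} (PP a b)} ∪ {x | ∃ a < n, x ∈ K a}

section Channels

variable {W : Type v} {G : SimpleGraph W} {μ : Set W → ℝ} {ε : ℝ}

theorem exists_isLine {K : Set W} {e : W} (h : e ∈ nb G (nb G (nb G K))) (h' : e ∉ nb G (nb G K)) :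
    ∃ f, IsLine G K e f := by
  obtain ⟨g1, hg1, rfl | h1⟩ := h
  · exact (h' hg1).elim
  have hn1 : g1 ∉ nb G K := fun hmem => h' (mem_nb_of_adj hmem h1)
  obtain ⟨g2, hg2, rfl | h2⟩ := id hg1
  · exact (hn1 hg2).elim
  have hn2 : g2 ∉ K := fun hmem => hn1 (mem_nb_of_adj hmem h2)
  obtain ⟨k, hk, rfl | h3⟩ := id hg2
  · exact (hn2 hk).elim
  exact ⟨fun l => if l = 0 then e else if l = 1 then g1 else g2,
    ⟨rfl, h1.symm, h2.symm, ⟨k, hk, h3.symm⟩, h', hg1, hn1, hg2, hn2⟩⟩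

theorem IsLine.adj {K : Set W} {e : W} {f : ℕ → W} (h : IsLine G K e f) :
    ∀ l < 2, G.Adj (f l) (f (l + 1)) := by
  intro l hl
  interval_cases l
  · exact h.adj₀
  · exact h.adj₁

theorem IsLine.near {K : Set W} {e : W} {f : ℕ → W} (h : IsLine G K e f) {l : ℕ} (hl : l ≤ 2) :
    Near G 2 e (f l) := by
  have h1 := near_of_path h.adj hl
  rw [h.zero] at h1
  exact h1.mono hl

/-- The position on a line is determined by the distance of the vertex from `K`, which is three, two
and one. -/
theorem IsLine.inner {K : Set W} {e e' : W} {f f' : ℕ → W} (h : IsLine G K e f)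
    (h' : IsLine G K e' f') {l l' : ℕ} (hl : l ≤ 2) (hl' : l' ≤ 2) (heq : f l = f' l') :
    l = l' := by
  have key : ∀ {e : W} {f : ℕ → W}, IsLine G K e f → ∀ i ≤ 2,
      (f i ∈ nb G (nb G K) ↔ 1 ≤ i) ∧ (f i ∈ nb G K ↔ 2 ≤ i) := by
    intro e f h i hi
    interval_cases i
    · exact ⟨⟨fun h1 => (h.notMem₀ h1).elim, by omega⟩,
        ⟨fun h1 => (h.notMem₀ (subset_nb h1)).elim, by omega⟩⟩
    · exact ⟨⟨fun _ => le_rfl, fun _ => h.mem₁⟩, ⟨fun h1 => (h.notMem₁ h1).elim, by omega⟩⟩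
    · exact ⟨⟨fun _ => by omega, fun _ => subset_nb h.mem₂⟩, ⟨fun _ => le_rfl, fun _ => h.mem₂⟩⟩
  have h1 := key h l hl
  have h2 := key h' l' hl'
  rw [heq] at h1
  have h3 := h1.1.symm.trans h2.1
  have h4 := h1.2.symm.trans h2.2
  omega

/-- Contact with `K'` at position `0` or `1` would bring `e` within distance two of `K'`; at
position `2` it would bring `K` and `K'` within distance two. -/
theorem IsLine.notMem_other {K K' : Set W} {e : W} {f : ℕ → W} (h : IsLine G K e f)
    (he : e ∉ nb G (nb G K')) (hK : ∀ x ∈ K', x ∉ nb G (nb G K)) {l : ℕ} (hl : l ≤ 2) :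
    f l ∉ nb G K' := by
  interval_cases l
  · rw [h.zero]; exact fun hmem => he (subset_nb hmem)
  · intro hmem
    rw [← h.zero] at he
    exact he (mem_nb_of_adj hmem h.adj₀.symm)
  · rintro ⟨k, hk, heq | hadj⟩
    · exact hK k hk (subset_nb (heq ▸ h.mem₂))
    · exact hK k hk (mem_nb_of_adj h.mem₂ hadj.symm)

theorem IsLine.ac_self {K : Set W} {e : W} {f : ℕ → W} (h : IsLine G K e f) {l : ℕ} (hl : l < 2) :
    AC G {f l} K := by
  refine (ac_iff.2 ?_ : AC G K {f l}).symm
  rintro _ rfl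
  interval_cases l
  · exact fun h1 => h.notMem₀ (subset_nb h1)
  · exact h.notMem₁

theorem nb_nb_union {X Y : Set W} : nb G (nb G (X ∪ Y)) = nb G (nb G X) ∪ nb G (nb G Y) := by
  rw [nb_union, nb_union]

/-- Outside the second neighbourhoods of earlier cores a heavy connected set remains. In it a
connected set is grown vertex by vertex until its second neighbourhood has weight at least `2 * ε`;
since balls are light, it stays below `3 * ε`. So the third neighbourhood of a core omits less than
`ε`, and most vertices are at distance exactly three from all cores. -/
theorem exists_cores [Finite W] (hW : Wt G μ ε) (hball : ∀ v, μ ((nb G)^[5] {v}) ≤ ε) (n : ℕ)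
    (hn : (3 * n + 6) * ε ≤ μ Set.univ) :
    ∃ K : ℕ → Set W, ∀ a < n, Conn G (K a) ∧ 2 * ε ≤ μ (nb G (nb G (K a))) ∧
      μ (nb G (nb G (K a))) ≤ 3 * ε ∧ ∀ b < n, b ≠ a → ∀ x ∈ K b, x ∉ nb G (nb G (K a)) := by
  have hpos := hW.pos
  have hball2 : ∀ v, μ (nb G (nb G {v})) ≤ ε := fun v =>
    (hW.mono fun x hx => (show Near G 2 v x from hx).mono (by norm_num)).trans (hball v)
  induction n with
  | zero => exact ⟨fun _ => ∅, by simp⟩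
  | succ n ih =>
    push_cast at hn
    obtain ⟨K, hK⟩ := ih (by nlinarith)
    set T : Set W := ⋃ a ∈ Finset.range n, nb G (nb G (K a)) with hT
    have hTμ : μ T ≤ n * (3 * ε) := by
      have := hW.biUnion_le (Finset.range n) (fun a => nb G (nb G (K a))) (3 * ε)
        fun a ha => (hK a (Finset.mem_range.1 ha)).2.2.1
      rwa [Finset.card_range] at this
    have h1 := hW.sub_le_diff Set.univ T
    obtain ⟨Z, hZT, hZ, hZμ⟩ := hW.exists_conn (B := Set.univ \ T) (κ := 2 * ε) (by linarith)
      (by linarith)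
    obtain ⟨v, hv⟩ := hZ.nonempty
    obtain ⟨X, hX, -, hXZ, ⟨-, -, hX1⟩, hX2⟩ := exists_trim (Conn G)
      (fun (_ : Unit) X => μ (nb G (nb G X))) Set.univ (X₀ := {v}) (X₁ := Z) (η := 2 * ε) (c := ε)
      (conn_singleton v) (by simpa using hv) (fun _ _ => (hball2 v).trans_lt (by linarith))
      ⟨(), trivial, hZμ.trans (hW.mono (subset_nb.trans subset_nb))⟩ (by
        intro X hX hvX hXZ hne
        obtain ⟨x, hx, y, hy, hyx⟩ := hZ.exists_adj_diff hX.nonempty hXZ hne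
        refine ⟨X ∪ {x}, ?_, Set.subset_union_left, fun h => hx.2 (h ▸ Or.inr rfl),
          Set.union_subset hXZ (by simpa using hx.1), fun _ _ => ?_⟩
        · exact hX.union (conn_singleton x)
            ⟨y, hy, mem_nb_singleton.2 (Or.inr hyx.symm)⟩
        · rw [nb_nb_union]
          exact (hW.union_le _ _).trans (by linarith [hball2 x]))
    have hsymm : ∀ {A B : Set W}, (∀ x ∈ A, x ∉ nb G (nb G B)) → ∀ x ∈ B, x ∉ nb G (nb G A) := by
      intro A B h x hx hmem
      obtain ⟨a, ha, hax⟩ := (mem_iterate_nb (k := 2)).1 hmem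
      exact h a ha ((mem_iterate_nb (k := 2)).2 ⟨x, hx, hax.symm⟩)
    have hXK : ∀ a < n, ∀ x ∈ X, x ∉ nb G (nb G (K a)) := by
      intro a ha x hx hmem
      refine (hZT (hXZ hx)).2 ?_
      simp only [hT, Set.mem_iUnion]
      exact ⟨a, Finset.mem_range.2 ha, hmem⟩
    refine ⟨fun a => if a = n then X else K a, fun a ha => ?_⟩
    by_cases han : a = n
    · subst han
      simp only [if_true]
      refine ⟨hX, hX1, by linarith [hX2 () trivial], fun b hb hba => ?_⟩
      simp only [hba, if_false]
      exact hsymm (hXK b (by omega))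
    · simp only [han, if_false]
      obtain ⟨k1, k2, k3, k4⟩ := hK a (by omega)
      refine ⟨k1, k2, k3, fun b hb hba => ?_⟩
      by_cases hbn : b = n
      · subst hbn
        simp only [if_true]
        exact hXK a (by omega)
      · simp only [hbn, if_false]
        exact k4 b (by omega) hba

theorem exists_far (hW : Wt G μ ε) (hball : ∀ v, μ ((nb G)^[5] {v}) ≤ ε) {κ : Type*} (A : Set W)
    (I : Finset κ) (hA : I.card * ε < μ A) (hne : A.Nonempty) :
    ∃ e : κ → W, (∀ i ∈ I, e i ∈ A) ∧ ∀ i ∈ I, ∀ j ∈ I, i ≠ j → ¬ Near G 5 (e i) (e j) := by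
  classical
  have hpos := hW.pos
  induction I using Finset.induction_on with
  | empty => exact ⟨fun _ => hne.some, by simp, by simp⟩
  | insert a I ha ih =>
    rw [Finset.card_insert_of_notMem ha] at hA
    push_cast at hA
    obtain ⟨e, he, hee⟩ := ih (by linarith)
    have h1 := hW.biUnion_le I (fun i => (nb G)^[5] {e i}) ε fun i _ => hball (e i)
    have h2 := hW.sub_le_diff A (⋃ i ∈ I, (nb G)^[5] {e i})
    obtain ⟨x, hxA, hx⟩ := hW.nonempty_of_pos (X := A \ ⋃ i ∈ I, (nb G)^[5] {e i}) (by linarith)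
    have hx' : ∀ i ∈ I, ¬ Near G 5 (e i) x := by
      intro i hi h
      refine hx ?_
      simp only [Set.mem_iUnion]
      exact ⟨i, hi, h⟩
    have hne' : ∀ i ∈ I, i ≠ a := fun i hi h => ha (h ▸ hi)
    refine ⟨Function.update e a x, ?_, ?_⟩
    · intro i hi
      rcases Finset.mem_insert.1 hi with rfl | hi
      · rwa [Function.update_self]
      · rw [Function.update_of_ne (hne' i hi)]; exact he i hi
    · intro i hi j hj hij
      rcases Finset.mem_insert.1 hi with rfl | hi' <;> rcases Finset.mem_insert.1 hj with rfl | hj'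
      · exact (hij rfl).elim
      · rw [Function.update_self, Function.update_of_ne (hne' j hj')]
        exact fun h => hx' j hj' h.symm
      · rw [Function.update_self, Function.update_of_ne (hne' i hi')]
        exact hx' i hi'
      · rw [Function.update_of_ne (hne' i hi'), Function.update_of_ne (hne' j hj')]
        exact hee i hi' j hj' hij

theorem ac_of_not_near {x y a b : W} (ha : Near G 2 x a) (hb : Near G 2 y b)
    (h : ¬ Near G 5 x y) : a ≠ b ∧ ¬ G.Adj a b := by
  refine ⟨?_, fun hab => h ?_⟩
  · rintro rfl
    exact h ((ha.trans hb.symm).mono (by norm_num))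
  · exact (ha.trans (near_one_of_adj hab)).trans hb.symm

/-- A starting position for the game, together with connections between the cores. -/
theorem exists_fabric [Finite W] (hW : Wt G μ ε) (hball : ∀ v, μ ((nb G)^[5] {v}) ≤ ε) (n : ℕ)
    (hμ : 1 ≤ μ Set.univ) (hn : (n * n + 4 * n + 6) * ε ≤ 1 / 2)
    (hε : ε * (4 * 2 ^ n) ≤ 1 / 2 / (4 * 2 ^ n)) :
    ∃ K PP, Fabric G n K PP ∧ ∀ m, 0 < m →
      Good G μ (SparseBlob G (fun X => ∃ a < n, X = K a) (Region G n K PP)) m 2 1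
        (Region G n K PP) (1 / 2 / (4 * 2 ^ n) / (4 * 2 ^ n)) (Finset.range n) (fun _ => 2)
        (fun _ => 1) := by
  have hpos := hW.pos
  have hnn : (0 : ℝ) ≤ n := Nat.cast_nonneg n
  have hnε : 0 ≤ n * ε := mul_nonneg hnn hpos.le
  have hnnε : 0 ≤ n * n * ε := mul_nonneg (mul_nonneg hnn hnn) hpos.le
  obtain ⟨K, hK⟩ := exists_cores hW hball n (by linarith)
  have hKK : ∀ a < n, ∀ b < n, b ≠ a → AC G (K a) (K b) := fun a ha b hb hba =>
    ac_iff.2 fun x hx h => (hK a ha).2.2.2 b hb hba x hx (subset_nb h)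
  -- the generic vertices
  set Bad : Set W := ⋃ a ∈ Finset.range n, (nb G (nb G (nb G (K a))))ᶜ ∪ nb G (nb G (K a)) with hBad
  have hBadμ : μ Bad ≤ n * (4 * ε) := by
    have := hW.biUnion_le (Finset.range n)
      (fun a => (nb G (nb G (nb G (K a))))ᶜ ∪ nb G (nb G (K a))) (4 * ε) (by
        intro a ha
        obtain ⟨-, h1, h2, -⟩ := hK a (Finset.mem_range.1 ha)
        have h3 := hW.compl_nb_lt (X := nb G (nb G (K a))) (by linarith)
        have h4 := hW.union_le (nb G (nb G (nb G (K a))))ᶜ (nb G (nb G (K a)))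
        linarith)
    rwa [Finset.card_range] at this
  set Gen : Set W := Badᶜ with hGen
  have hGenμ : 1 - n * (4 * ε) ≤ μ Gen := by
    have := hW.sub_le_diff Set.univ Bad
    rw [← Set.compl_eq_univ_sdiff] at this
    linarith
  have hGen' : ∀ e ∈ Gen, ∀ a < n, e ∈ nb G (nb G (nb G (K a))) ∧ e ∉ nb G (nb G (K a)) := by
    intro e he a ha
    have h1 : e ∉ (nb G (nb G (nb G (K a))))ᶜ ∪ nb G (nb G (K a)) := by
      intro h
      refine he ?_
      simp only [hBad, Set.mem_iUnion]
      exact ⟨a, Finset.mem_range.2 ha, h⟩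
    rw [Set.mem_union, not_or, Set.mem_compl_iff, not_not] at h1
    exact h1
  have hg : ∀ (a : ℕ) (e : W), ∃ f, a < n → e ∈ Gen → IsLine G (K a) e f := by
    intro a e
    by_cases h : a < n ∧ e ∈ Gen
    · obtain ⟨f, hf⟩ := exists_isLine (hGen' e h.2 a h.1).1 (hGen' e h.2 a h.1).2
      exact ⟨f, fun _ _ => hf⟩
    · exact ⟨fun _ => e, fun h1 h2 => (h ⟨h1, h2⟩).elim⟩
  choose g hg using hg
  have hgK : ∀ a < n, ∀ e ∈ Gen, ∀ b < n, b ≠ a → ∀ l ≤ 2, g a e l ∉ nb G (K b) :=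
    fun a ha e he b hb hba l hl => (hg a e ha he).notMem_other (hGen' e he b hb).2
      ((hK a ha).2.2.2 b hb hba) hl
  -- the connections
  set I : Finset (ℕ × ℕ) := Finset.range n ×ˢ Finset.range n with hI
  have hIcard : (I.card : ℝ) = n * n := by
    rw [hI, Finset.card_product, Finset.card_range]; push_cast; ring
  have hmemI : ∀ a < n, ∀ b < n, (a, b) ∈ I := fun a ha b hb =>
    Finset.mem_product.2 ⟨Finset.mem_range.2 ha, Finset.mem_range.2 hb⟩
  have hGenbig : I.card * ε + 1 / 2 ≤ μ Gen := by rw [hIcard]; nlinarith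
  obtain ⟨c, hcGen, hc⟩ := exists_far hW hball Gen I (by linarith)
    (hW.nonempty_of_pos (by
      have : 0 ≤ (I.card : ℝ) * ε := mul_nonneg (Nat.cast_nonneg _) hpos.le
      linarith))
  set PP : ℕ → ℕ → Set W := fun a b => seg (g a (c (a, b))) 2 ∪ seg (g b (c (a, b))) 2 with hPP
  have hPPnear : ∀ a < n, ∀ b < n, ∀ x ∈ PP a b, Near G 2 (c (a, b)) x := by
    rintro a ha b hb x (⟨l, hl, rfl⟩ | ⟨l, hl, rfl⟩)
    · exact (hg a _ ha (hcGen _ (hmemI a ha b hb))).near hl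
    · exact (hg b _ hb (hcGen _ (hmemI a ha b hb))).near hl
  have hfab : Fabric G n K PP := by
    constructor
    · exact fun a ha => (hK a ha).1.nonempty
    · intro a ha b hb
      have h1 := hg a _ ha (hcGen _ (hmemI a ha b hb))
      have h2 := hg b _ hb (hcGen _ (hmemI a ha b hb))
      exact (conn_seg h1.adj).union (conn_seg h2.adj)
        ⟨c (a, b), ⟨0, by norm_num, h1.zero.symm⟩, subset_nb ⟨0, by norm_num, h2.zero.symm⟩⟩
    · intro a ha b hb
      exact ⟨_, Or.inl ⟨2, le_rfl, rfl⟩, (hg a _ ha (hcGen _ (hmemI a ha b hb))).mem₂⟩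
    · intro a ha b hb
      exact ⟨_, Or.inr ⟨2, le_rfl, rfl⟩, (hg b _ hb (hcGen _ (hmemI a ha b hb))).mem₂⟩
    · intro a ha b hb d hd hda hdb
      refine (ac_iff.2 ?_ : AC G (K d) (PP a b)).symm
      rintro x (⟨l, hl, rfl⟩ | ⟨l, hl, rfl⟩)
      · exact hgK a ha _ (hcGen _ (hmemI a ha b hb)) d hd hda l hl
      · exact hgK b hb _ (hcGen _ (hmemI a ha b hb)) d hd hdb l hl
    · intro a ha b hb a' ha' b' hb' hne x hx y hy
      exact ac_of_not_near (hPPnear a ha b hb x hx) (hPPnear a' ha' b' hb' y hy)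
        (hc _ (hmemI a ha b hb) _ (hmemI a' ha' b' hb') hne)
  -- the starting sets
  set A : Set W := Gen \ ⋃ i ∈ I, (nb G)^[5] {c i} with hA
  have hAμ : 1 / 2 ≤ μ A := by
    have h1 := hW.biUnion_le I (fun i => (nb G)^[5] {c i}) ε fun i _ => hball (c i)
    have h2 := hW.sub_le_diff Gen (⋃ i ∈ I, (nb G)^[5] {c i})
    linarith
  have hθ1 : (1 : ℝ) / 2 / (4 * 2 ^ n) ≤ 1 / 2 := div_le_self (by norm_num) (by
    have : (1 : ℝ) ≤ 2 ^ n := one_le_pow₀ (by norm_num)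
    linarith)
  obtain ⟨S, hSA, hSμ, hSd⟩ := hW.exists_separate (Finset.range n) (fun _ => A) (fun _ e => e)
    (1 / 2) (fun _ _ => hAμ)
    (fun a _ y => (hW.mono (by rintro e ⟨-, rfl⟩; exact subset_nb rfl)).trans (hW.nb_le y))
    (by rw [Finset.card_range]; linarith)
  rw [Finset.card_range] at hSμ
  -- The first separation made the starting vertices of different objects distinct, and this one
  -- makes the middle vertices distinct. Fibres are light because all starting vertices of lines
  -- through a given middle vertex are its neighbours. Every other coincidence is excluded by
  -- distances to the cores.
  obtain ⟨T, hTS, hTμ, hTd⟩ := hW.exists_separate (Finset.range n) S (fun a e => g a e 1)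
    (1 / 2 / (4 * 2 ^ n)) hSμ
    (by
      intro a ha y
      refine (hW.mono ?_).trans (hW.nb_le y)
      rintro e ⟨he, rfl⟩
      have h1 := hg a e (Finset.mem_range.1 ha) (hSA a he).1
      have h2 := h1.adj₀
      rw [h1.zero] at h2
      exact mem_nb_singleton.2 (Or.inr h2.symm))
    (by rwa [Finset.card_range])
  rw [Finset.card_range] at hTμ
  have hTA : ∀ a, T a ⊆ A := fun a => (hTS a).trans (hSA a)
  have hline : ∀ a ∈ Finset.range n, ∀ e ∈ T a, IsLine G (K a) e (g a e) := fun a ha e he =>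
    hg a e (Finset.mem_range.1 ha) (hTA a he).1
  have hoff : ∀ a ∈ Finset.range n, ∀ b ∈ Finset.range n, a ≠ b → ∀ e ∈ T a, ∀ l ≤ 2,
      g a e l ∉ nb G (K b) := fun a ha b hb hab e he l hl =>
    hgK a (Finset.mem_range.1 ha) e (hTA a he).1 b (Finset.mem_range.1 hb) hab.symm l hl
  refine ⟨K, PP, hfab, fun m hm => ⟨T, K, g, ?_⟩⟩
  have hKReg : ∀ a < n, K a ⊆ Region G n K PP := fun a ha x hx => Or.inr ⟨a, ha, hx⟩
  constructor
  · exact hTμ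
  · exact fun _ _ => le_rfl
  · exact fun _ _ => le_rfl
  · exact fun a ha b hb hab => hKK a (Finset.mem_range.1 ha) b (Finset.mem_range.1 hb) hab.symm
  · intro a ha b hb hab e he l hl
    refine (ac_iff.2 ?_ : AC G (K b) {g a e l}).symm
    rintro _ rfl
    exact hoff a ha b hb hab e he l hl
  · exact fun a ha e he l hl => (hline a ha e he).ac_self hl
  · intro a ha e he
    have h1 := hline a ha e he
    have ha' := Finset.mem_range.1 ha
    -- The core is the first blob of its object; this is why the game starts at rank one.
    exact ⟨∅ ∪ K a, by simp, (RC.base _).blob (by simpa using hm)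
      ⟨(hK a ha').1, ⟨K a, subset_rfl, a, ha', rfl⟩, hKReg a ha'⟩ h1.adj₂ h1.notMem₂
      ac_empty_left⟩
  · intro a ha b hb hab e he e' he' l hl l' hl' heq
    have h1 := hline a ha e he
    have h2 := hline b hb e' he'
    have h3 := hoff a ha b hb hab e he l hl
    have h4 := hoff b hb a ha hab.symm e' he' l' hl'
    have h5 := (hGen' e (hTA a he).1 b (Finset.mem_range.1 hb)).2
    have h6 := (hGen' e' (hTA b he').1 a (Finset.mem_range.1 ha)).2
    have hcase : ∀ i ≤ 2, i = 0 ∨ i = 1 ∨ i = 2 := by omega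
    rcases hcase l hl with rfl | rfl | rfl <;> rcases hcase l' hl' with rfl | rfl | rfl
    · rw [h1.zero, h2.zero] at heq
      exact hSd a ha b hb hab e (hTS a he) e' (hTS b he') heq
    · rw [h1.zero] at heq
      exact h5 (heq ▸ h2.mem₁)
    · exact h3 (heq ▸ h2.mem₂)
    · rw [h2.zero] at heq
      exact h6 (heq ▸ h1.mem₁)
    · exact hTd a ha b hb hab e he e' he' heq
    · exact h3 (heq ▸ h2.mem₂)
    · exact h4 (heq ▸ h1.mem₂)
    · exact h4 (heq ▸ h1.mem₂)
    · exact h3 (heq ▸ h2.mem₂)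
  · exact fun a ha e he e' he' l hl l' hl' heq =>
      (hline a ha e he).inner (hline a ha e' he') hl hl' heq
  · exact fun a ha e he => (hline a ha e he).zero
  · exact fun a ha e he l hl => (hline a ha e he).adj l hl
  · intro a ha e he l hl
    refine Or.inl fun a' ha' b' hb' => ?_
    rintro _ rfl y hy
    refine ac_of_not_near ((hline a ha e he).near hl) (hPPnear a' ha' b' hb' y hy) fun h => ?_
    refine (hTA a he).2 ?_
    simp only [Set.mem_iUnion]
    exact ⟨(a', b'), hmemI a' ha' b' hb', h.symm⟩
  · exact fun a ha => hKReg a (Finset.mem_range.1 ha)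

end Channels

/-- If balls are light, then the required configuration exists. -/
theorem exists_conf_of_sparse {V : Type u} [Finite V] (f κ : V → ℕ) (hf : Function.Injective f)
    (hκ : Function.Injective κ) (B : V → V → Prop) (hB : ∀ u w, B u w → f u < f w) :
    ∃ c : ℝ, 0 < c ∧ ∀ (W : Type v) [Finite W] (G : SimpleGraph W) (μ : Set W → ℝ)
      (ε : ℝ), Wt G μ ε → 1 ≤ μ Set.univ → ε ≤ c → (∀ v, μ ((nb G)^[5] {v}) ≤ ε) →
      ∃ q Q, Conf (fun u w => f u + 1 = f w ∨ f w + 1 = f u) B G q Q := by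
  classical
  obtain ⟨_⟩ := nonempty_fintype V
  set N := Finset.univ.sup f + 1 with hN
  set m := Finset.univ.sup κ + 1 with hm
  have hfN : ∀ u, f u < N := fun u => Nat.lt_succ_of_le (Finset.le_sup (f := f) (Finset.mem_univ u))
  have hκm : ∀ u, κ u < m := fun u => Nat.lt_succ_of_le (Finset.le_sup (f := κ) (Finset.mem_univ u))
  obtain ⟨n, F, hgame⟩ := Game.exists_rank ℕ m (N * (m + 1)) 2 1
  set θ : ℝ := 1 / 2 / (4 * 2 ^ n) / (4 * 2 ^ n) with hθ
  have hθpos : 0 < θ := by positivity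
  have hC : (0 : ℝ) < n * n + 4 * n + 6 := by positivity
  refine ⟨min (1 / 2 / (n * n + 4 * n + 6)) (θ / 12 ^ F / 8), by positivity,
    fun W _ G μ ε hW hμ hεc hball => ?_⟩
  have hpos := hW.pos
  have hε1 := hεc.trans (min_le_left _ _)
  have hε2 := hεc.trans (min_le_right _ _)
  rw [le_div_iff₀ hC] at hε1
  have hε3 : 8 * ε ≤ θ / 12 ^ F := by linarith
  have hε4 : ε ≤ θ := by
    have : θ / 12 ^ F ≤ θ := div_le_self hθpos.le (one_le_pow₀ (by norm_num))
    linarith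
  obtain ⟨K, PP, hfab, hgood⟩ := exists_fabric hW hball n hμ (by linarith)
    (by rwa [hθ, le_div_iff₀ (by positivity)] at hε4)
  obtain ⟨n', J, p, r, hn, ⟨S, U, ln, hlay⟩, j, hj, hR⟩ := hgame F _
    (sparse_game hW hball (ι := ℕ) (θ := θ) (m := m) (F := F) (Nat.succ_pos _) hε3) 0 _ _ _
    (by rw [pow_zero, div_one]; exact hgood m (Nat.succ_pos _))
    (by simp) (by simp) (by omega)
  obtain ⟨e, he⟩ := hW.nonempty_of_pos (X := S j) (lt_of_lt_of_le (by positivity) (hlay.heavy j hj))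
  obtain ⟨D, hD, hrc⟩ := hlay.rc j hj e he
  obtain ⟨q, X, hcat⟩ := hrc.exists_caterpillar hR
  have hDR := hD.trans (hlay.UReg j hj)
  -- Choose a core in every blob. Distinct blobs are anticomplete, so they receive distinct cores,
  -- and the prepared connection of two cores joins their blobs.
  have htag : ∀ i κ', ∃ a, i < N → κ' < m → a < n ∧ K a ⊆ X i κ' := by
    intro i κ'
    by_cases h : i < N ∧ κ' < m
    · obtain ⟨-, ⟨_, hsub, a, ha, rfl⟩, -⟩ := hcat.blob i h.1 κ' h.2
      exact ⟨a, fun _ _ => ⟨ha, hsub⟩⟩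
    · exact ⟨0, fun h1 h2 => (h ⟨h1, h2⟩).elim⟩
  choose tag htag using htag
  have htag_ne : ∀ i < N, ∀ κ₁ < m, ∀ i' < N, ∀ κ₂ < m, (i, κ₁) ≠ (i', κ₂) →
      tag i κ₁ ≠ tag i' κ₂ := by
    intro i hi κ₁ h1 i' hi' κ₂ h2 hne heq
    obtain ⟨ha, hsub⟩ := htag i κ₁ hi h1
    obtain ⟨-, hsub'⟩ := htag i' κ₂ hi' h2
    obtain ⟨x, hx⟩ := hfab.nonempty _ ha
    exact (hcat.ac i hi κ₁ h1 i' hi' κ₂ h2 hne x (hsub hx) x (hsub' (heq ▸ hx))).1 rfl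
  -- what meets a connection lies in a core at one of its ends
  have hReg : ∀ x ∈ D, ∀ a < n, ∀ b < n, x ∉ K a → x ∉ K b → AC G {x} (PP a b) := by
    intro x hx a ha b hb hxa hxb
    rcases hDR hx with h | ⟨d, hd, hxd⟩
    · exact h a ha b hb
    · refine (hfab.acK a ha b hb d hd ?_ ?_).symm.singleton_of_mem hxd
      · rintro rfl; exact hxa hxd
      · rintro rfl; exact hxb hxd
  set a : V → V → ℕ := fun u w => tag (f u) (κ w) with ha
  have haw : ∀ u w, a u w < n ∧ K (a u w) ⊆ X (f u) (κ w) := fun u w => htag _ _ (hfN u) (hκm w)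
  have hXac : ∀ u w u' w', (u, w) ≠ (u', w') → AC G (X (f u) (κ w)) (X (f u') (κ w')) := by
    intro u w u' w' hne
    refine hcat.ac _ (hfN _) _ (hκm _) _ (hfN _) _ (hκm _) fun h => hne ?_
    rw [Prod.mk.injEq] at h
    exact Prod.ext (hf h.1) (hκ h.2)
  have hane : ∀ u w u' w', (u, w) ≠ (u', w') → a u w ≠ a u' w' := by
    intro u w u' w' hne
    refine htag_ne _ (hfN _) _ (hκm _) _ (hfN _) _ (hκm _) fun h => hne ?_
    rw [Prod.mk.injEq] at h
    exact Prod.ext (hf h.1) (hκ h.2)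
  have hqPP : ∀ v u w, AC G {q (f v)} (PP (a u w) (a w u)) := fun v u w =>
    hReg _ (hcat.mem _ (hfN v)) _ (haw u w).1 _ (haw w u).1
      (fun h => hcat.notMem _ (hfN u) _ (hκm w) _ (hfN v) ((haw u w).2 h))
      (fun h => hcat.notMem _ (hfN w) _ (hκm u) _ (hfN v) ((haw w u).2 h))
  have hXPP : ∀ u w u' w', (u, w) ≠ (u', w') → (u, w) ≠ (w', u') →
      AC G (X (f u) (κ w)) (PP (a u' w') (a w' u')) := by
    intro u w u' w' h1 h2
    refine ac_of_forall_singleton fun x hx => ?_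
    refine hReg x (hcat.sub _ (hfN u) _ (hκm w) hx) _ (haw u' w').1 _ (haw w' u').1 ?_ ?_
    · exact fun h => (hXac u w u' w' h1 x hx x ((haw u' w').2 h)).1 rfl
    · exact fun h => (hXac u w w' u' h2 x hx x ((haw w' u').2 h)).1 rfl
  refine ⟨fun v => q (f v), fun u w => X (f u) (κ w) ∪ PP (a u w) (a w u) ∪ X (f w) (κ u),
    ⟨?_, ?_, ?_, ?_, ?_, ?_, ?_, ?_⟩⟩
  · intro u w huw
    by_contra hne
    rcases lt_or_gt_of_ne (hf.ne hne) with h | h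
    · exact hcat.ne _ _ h (hfN _) huw
    · exact hcat.ne _ _ h (hfN _) huw.symm
  · exact fun u w huw => hcat.path _ (hfN _) _ (hfN _) (hf.ne huw)
  · intro u w _
    have h1 := (hcat.blob _ (hfN u) _ (hκm w)).1
    have h2 := (hcat.blob _ (hfN w) _ (hκm u)).1
    have h3 := hfab.conn _ (haw u w).1 _ (haw w u).1
    obtain ⟨x, hx, hxK⟩ := hfab.left _ (haw u w).1 _ (haw w u).1
    obtain ⟨y, hy, hyK⟩ := hfab.right _ (haw u w).1 _ (haw w u).1
    have h4 := (h3.union h1 ⟨x, hx, nb_mono (haw u w).2 hxK⟩).union h2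
      ⟨y, Or.inl hy, nb_mono (haw w u).2 hyK⟩
    rwa [Set.union_comm (PP _ _)] at h4
  · intro u w _
    obtain ⟨x, hx, h⟩ := hcat.adj _ (hfN u) _ (hκm w)
    exact ⟨x, Or.inl (Or.inl hx), h⟩
  · intro u w _
    obtain ⟨x, hx, h⟩ := hcat.adj _ (hfN w) _ (hκm u)
    exact ⟨x, Or.inr hx, h⟩
  · rintro u w _ v ((h | h) | h)
    · exact hcat.notMem _ (hfN _) _ (hκm _) _ (hfN _) h
    · exact (hqPP v u w _ rfl _ h).1 rfl
    · exact hcat.notMem _ (hfN _) _ (hκm _) _ (hfN _) h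
  · rintro u w _ v hvu hvw x ((h | h) | h)
    · exact hcat.not_adj _ (hfN _) _ (hκm _) _ (hfN _) (hf.ne hvu) x h
    · exact (hqPP v u w _ rfl _ h).2
    · exact hcat.not_adj _ (hfN _) _ (hκm _) _ (hfN _) (hf.ne hvw) x h
  · intro u w u' w' h h' hne
    have h1 := hB _ _ h
    have h2 := hB _ _ h'
    have e1 : (u, w) ≠ (w', u') := by
      intro h3
      rw [Prod.mk.injEq] at h3
      rw [h3.1, h3.2] at h1
      omega
    have e2 : (w, u) ≠ (u', w') := fun h3 => e1 (by
      rw [Prod.mk.injEq] at h3 ⊢; exact ⟨h3.2, h3.1⟩)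
    have e3 : (w, u) ≠ (w', u') := fun h3 => hne (by
      rw [Prod.mk.injEq] at h3 ⊢; exact ⟨h3.2, h3.1⟩)
    refine AC.union_left (AC.union_left ?_ ?_) ?_
    · exact AC.union_right (AC.union_right (hXac _ _ _ _ hne) (hXPP _ _ _ _ hne e1))
        (hXac _ _ _ _ e1)
    · refine AC.union_right (AC.union_right (hXPP _ _ _ _ hne.symm e2.symm).symm ?_)
        (hXPP _ _ _ _ e1.symm e3.symm).symm
      refine hfab.ac _ (haw _ _).1 _ (haw _ _).1 _ (haw _ _).1 _ (haw _ _).1 fun h3 => ?_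
      rw [Prod.mk.injEq] at h3
      exact hane _ _ _ _ hne h3.1
    · exact AC.union_right (AC.union_right (hXac _ _ _ _ e2) (hXPP _ _ _ _ e2 e3))
        (hXac _ _ _ _ e3)

/-! ### Chordless paths in connected sets. -/

section Walks

variable {W : Type v} {G : SimpleGraph W}

theorem Conn.reachable {T : Set W} (hT : Conn G T) (x y : T) : (G.induce T).Reachable x y := by
  by_contra hxy
  obtain ⟨a, ⟨a', ha, rfl⟩, b, hb, hab⟩ := hT.2
    (Subtype.val '' {z : T | (G.induce T).Reachable x z}) (by rintro _ ⟨z, -, rfl⟩; exact z.2)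
    ⟨x, x, SimpleGraph.Reachable.refl _, rfl⟩
    ⟨y, y.2, by
      rintro ⟨z, hz, hzy⟩
      rw [Subtype.ext hzy] at hz
      exact hxy hz⟩
  refine hb.2 ⟨⟨b, hb.1⟩, ?_, rfl⟩
  exact SimpleGraph.Reachable.trans ha
    (SimpleGraph.Adj.reachable (G := G.induce T) (v := ⟨b, hb.1⟩) hab)

/-- A chord would shorten the path. -/
theorem isChordless_of_length_eq_dist {u w : W} (p : G.Walk u w) (hp : p.length = G.dist u w) :
    p.IsChordless := by
  rw [SimpleGraph.Walk.isChordless_iff_forall_mem_edges]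
  have key : ∀ i j, i < j → j ≤ p.length → G.Adj (p.getVert i) (p.getVert j) →
      s(p.getVert i, p.getVert j) ∈ p.edges := by
    intro i j hij hj hadj
    have h1 := SimpleGraph.dist_le ((p.take i).append (SimpleGraph.Walk.cons hadj (p.drop j)))
    rw [SimpleGraph.Walk.length_append, SimpleGraph.Walk.length_cons,
      SimpleGraph.Walk.take_length, SimpleGraph.Walk.drop_length, ← hp] at h1
    have h2 : j = i + 1 := by omega
    subst h2
    exact (p.mk_mem_edges_iff_exists).2 ⟨i, by omega, rfl⟩
  intro x y hx hy hxy
  obtain ⟨i, rfl, hi⟩ := SimpleGraph.Walk.mem_support_iff_exists_getVert.1 hx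
  obtain ⟨j, rfl, hj⟩ := SimpleGraph.Walk.mem_support_iff_exists_getVert.1 hy
  rcases lt_trichotomy i j with h | rfl | h
  · exact key i j h hj hxy
  · exact (G.irrefl hxy).elim
  · rw [Sym2.eq_swap]; exact key j i h hi hxy.symm

/-- Two vertices of a connected set are joined inside it by a chordless path. -/
theorem Conn.exists_chordless {T : Set W} (hT : Conn G T) {u w : W} (hu : u ∈ T) (hw : w ∈ T) :
    ∃ p : G.Walk u w, p.IsPath ∧ p.IsChordless ∧ ∀ x ∈ p.support, x ∈ T := by
  suffices H : ∀ x y : T, ∃ p : G.Walk ((SimpleGraph.Embedding.induce (G := G) T).toHom x)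
      ((SimpleGraph.Embedding.induce (G := G) T).toHom y),
      p.IsPath ∧ p.IsChordless ∧ ∀ x ∈ p.support, x ∈ T from H ⟨u, hu⟩ ⟨w, hw⟩
  intro x y
  obtain ⟨p, hp⟩ := (hT.reachable x y).exists_walk_length_eq_dist
  have h1 := p.isPath_of_length_eq_dist hp
  have h2 := isChordless_of_length_eq_dist p hp
  have hsup : ∀ x, x ∈ (p.map (SimpleGraph.Embedding.induce (G := G) T).toHom).support →
      ∃ h : x ∈ T, ⟨x, h⟩ ∈ p.support := by
    intro x hx
    rw [SimpleGraph.Walk.support_map] at hx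
    obtain ⟨y, hy, rfl⟩ := List.mem_map.1 hx
    exact ⟨y.2, hy⟩
  refine ⟨p.map (SimpleGraph.Embedding.induce (G := G) T).toHom,
    SimpleGraph.Walk.IsPath.map (SimpleGraph.Embedding.induce (G := G) T).injective h1, ?_,
    fun x hx => (hsup x hx).1⟩
  rw [SimpleGraph.Walk.isChordless_iff_forall_mem_edges] at h2 ⊢
  intro x y hx hy hxy
  obtain ⟨hxT, hx'⟩ := hsup x hx
  obtain ⟨hyT, hy'⟩ := hsup y hy
  have h3 := h2 hx' hy' (SimpleGraph.induce_adj.2 hxy)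
  rw [SimpleGraph.Walk.edges_map]
  exact List.mem_map.2 ⟨_, h3, rfl⟩

theorem length_induce {S : Set W} {u w : W} (p : G.Walk u w) (hp : ∀ x ∈ p.support, x ∈ S) :
    (p.induce S hp).length = p.length := by
  induction p with
  | nil => rfl
  | cons h p ih => simp [ih]

theorem mk_mem_edges_induce {S : Set W} {u w : W} (p : G.Walk u w)
    (hp : ∀ x ∈ p.support, x ∈ S) (x y : S) (h : s(x.1, y.1) ∈ p.edges) :
    s(x, y) ∈ (p.induce S hp).edges := by
  induction p with
  | nil => simp at h
  | cons hadj p ih =>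
    rw [SimpleGraph.Walk.edges_cons, List.mem_cons] at h
    rw [SimpleGraph.Walk.induce_cons, SimpleGraph.Walk.edges_cons, List.mem_cons]
    rcases h with h | h
    · left
      simpa [Sym2.eq_iff, Subtype.ext_iff] using h
    · exact Or.inr (ih _ h)

end Walks

/-! ### From a configuration to a filleting. -/

section Filleting

variable {V : Type u} {W : Type v} {H : SimpleGraph V} {s t : V}

/-- For an edge outside `P`, a chordless path is taken in the connected set together with its ends;
it has length at least two because those ends are not adjacent. The non-adjacencies of the
configuration confine every edge of the induced subgraph to the vertex set of a single path, and
chordlessness makes it an edge of that path. -/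
theorem Conf.exists_filleting (P : H.Walk s t) (f : V → ℕ) (hf : Function.Injective f)
    {A : V → V → Prop} (hA : ∀ u w, u ≠ w → (s(u, w) ∈ P.edges ↔ A u w)) {G : SimpleGraph W}
    {q : V → W} {Q : V → V → Set W}
    (h : Conf A (fun u w => H.Adj u w ∧ s(u, w) ∉ P.edges ∧ f u < f w) G q Q) :
    ∃ S : Set W, IsFilleting P (G.induce S) := by
  classical
  have hadj : ∀ u w, u ≠ w → (G.Adj (q u) (q w) ↔ s(u, w) ∈ P.edges) := fun u w huw =>
    (h.adj u w huw).trans (hA u w huw).symm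
  have hex : ∀ u w (_ : H.Adj u w) (_ : f u < f w), ∃ p : G.Walk (q u) (q w), p.IsPath ∧
      p.IsChordless ∧ (∀ x ∈ p.support, x = q u ∨ x = q w ∨ (s(u, w) ∉ P.edges ∧ x ∈ Q u w)) ∧
      (s(u, w) ∈ P.edges → p.length = 1) ∧ (s(u, w) ∉ P.edges → 2 ≤ p.length) := by
    intro u w huw hlt
    by_cases hP : s(u, w) ∈ P.edges
    · have h1 := (hadj u w huw.ne).2 hP
      refine ⟨h1.toWalk, ?_, h1.isChordless_toWalk, ?_, fun _ => rfl, fun h2 => (h2 hP).elim⟩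
      · simp [SimpleGraph.Adj.toWalk, h1.ne]
      · intro x hx
        simp only [SimpleGraph.Adj.toWalk, SimpleGraph.Walk.support_cons,
          SimpleGraph.Walk.support_nil, List.mem_cons, List.not_mem_nil, or_false] at hx
        tauto
    · have hB : H.Adj u w ∧ s(u, w) ∉ P.edges ∧ f u < f w := ⟨huw, hP, hlt⟩
      obtain ⟨x, hx, hux⟩ := h.left u w hB
      obtain ⟨y, hy, hwy⟩ := h.right u w hB
      have hT : Conn G (insert (q u) (insert (q w) (Q u w))) :=
        ((h.conn u w hB).insert ⟨y, hy, hwy.symm⟩).insert ⟨x, Or.inr hx, hux.symm⟩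
      obtain ⟨p, hp, hpc, hps⟩ := hT.exists_chordless (u := q u) (w := q w) (Or.inl rfl)
        (Or.inr (Or.inl rfl))
      refine ⟨p, hp, hpc, ?_, fun h2 => (hP h2).elim, fun _ => ?_⟩
      · intro z hz
        rcases hps z hz with rfl | rfl | hz
        · exact Or.inl rfl
        · exact Or.inr (Or.inl rfl)
        · exact Or.inr (Or.inr ⟨hP, hz⟩)
      · by_contra hlen
        have h3 : p.length = 0 ∨ p.length = 1 := by omega
        rcases h3 with h3 | h3
        · exact huw.ne (h.inj (SimpleGraph.Walk.eq_of_length_eq_zero h3))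
        · exact hP ((hadj u w huw.ne).1 (SimpleGraph.Walk.adj_of_length_eq_one h3))
  choose p hpath hchord hsupp hlen1 hlen2 using hex
  set S : Set W := {x | (∃ v, x = q v) ∨ ∃ u w h hlt, x ∈ (p u w h hlt).support} with hS
  have hqS : ∀ v, q v ∈ S := fun v => Or.inl ⟨v, rfl⟩
  have hpS : ∀ u w h hlt, ∀ x ∈ (p u w h hlt).support, x ∈ S := fun u w h hlt x hx =>
    Or.inr ⟨u, w, h, hlt, hx⟩
  set br : V → S := fun v => ⟨q v, hqS v⟩ with hbr
  have hbrinj : Function.Injective br := fun u w huw => h.inj (congrArg Subtype.val huw)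
  set pS : ∀ u w, H.Adj u w → f u < f w → (G.induce S).Walk (br u) (br w) := fun u w h hlt =>
    (p u w h hlt).induce S (hpS u w h hlt) with hpSdef
  have hmap : ∀ u w h hlt, (pS u w h hlt).map (SimpleGraph.Embedding.induce (G := G) S).toHom =
      p u w h hlt := fun u w h hlt => SimpleGraph.Walk.map_induce _ _
  have hpSpath : ∀ u w h hlt, (pS u w h hlt).IsPath := fun u w h hlt =>
    SimpleGraph.Walk.IsPath.of_map (f := (SimpleGraph.Embedding.induce (G := G) S).toHom)
      (by rw [hmap]; exact hpath u w h hlt)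
  have hpSlen : ∀ u w h hlt, (pS u w h hlt).length = (p u w h hlt).length :=
    fun u w h hlt => length_induce _ _
  have hpSsupp : ∀ u w h hlt (x : S), x ∈ (pS u w h hlt).support ↔
      x.1 ∈ (p u w h hlt).support := by
    intro u w h hlt x
    simp only [hpSdef, SimpleGraph.Walk.support_induce, List.mem_attachWith]
  have hpSedge : ∀ u w h hlt (x y : S), x.1 ∈ (p u w h hlt).support →
      y.1 ∈ (p u w h hlt).support → G.Adj x y → s(x, y) ∈ (pS u w h hlt).edges := by
    intro u w h hlt x y hx hy hxy
    exact mk_mem_edges_induce _ _ _ _ ((hchord u w h hlt).mem_edges hx hy hxy)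
  -- orient each edge of `H`
  have hlt' : ∀ {u w}, H.Adj u w → ¬ f u < f w → f w < f u := fun huw hn =>
    lt_of_le_of_ne (not_lt.1 hn) (hf.ne huw.ne.symm)
  set path : ∀ a b : V, H.Adj a b → (G.induce S).Walk (br a) (br b) := fun a b hab =>
    if hlt : f a < f b then pS a b hab hlt else (pS b a hab.symm (hlt' hab hlt)).reverse
    with hpathdef
  have hpos : ∀ {a b} (hab : H.Adj a b) (hlt : f a < f b), path a b hab = pS a b hab hlt :=
    fun hab hlt => dif_pos hlt
  have hneg : ∀ {a b} (hab : H.Adj a b) (hlt : f b < f a),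
      path a b hab = (pS b a hab.symm hlt).reverse := fun hab hlt => dif_neg (not_lt.2 hlt.le)
  have hsymm : ∀ {a b} (hab : H.Adj a b), path b a hab.symm = (path a b hab).reverse := by
    intro a b hab
    rcases lt_or_gt_of_ne (hf.ne hab.ne) with hlt | hlt
    · rw [hpos hab hlt, hneg hab.symm hlt]
    · rw [hneg hab hlt, hpos hab.symm hlt, SimpleGraph.Walk.reverse_reverse]
  -- reduction to the positively oriented edges
  have hred : ∀ {a b} (hab : H.Adj a b), ∃ u w, ∃ (huw : H.Adj u w) (hlt : f u < f w),
      s(a, b) = s(u, w) ∧ (path a b hab).length = (p u w huw hlt).length ∧ (path a b hab).IsPath ∧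
      ∀ x : S, x ∈ (path a b hab).support ↔ x.1 ∈ (p u w huw hlt).support := by
    intro a b hab
    rcases lt_or_gt_of_ne (hf.ne hab.ne) with hlt | hlt
    · refine ⟨a, b, hab, hlt, rfl, ?_, ?_, ?_⟩
      · rw [hpos hab hlt, hpSlen]
      · rw [hpos hab hlt]; exact hpSpath _ _ _ _
      · rw [hpos hab hlt]; exact hpSsupp _ _ _ _
    · refine ⟨b, a, hab.symm, hlt, Sym2.eq_swap, ?_, ?_, ?_⟩
      · rw [hneg hab hlt, SimpleGraph.Walk.length_reverse, hpSlen]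
      · rw [hneg hab hlt]; exact (hpSpath _ _ _ _).reverse
      · intro x
        rw [hneg hab hlt, SimpleGraph.Walk.support_reverse, List.mem_reverse]
        exact hpSsupp _ _ _ _ x
  have hqsupp : ∀ u w huw hlt v, q v ∈ (p u w huw hlt).support → v = u ∨ v = w := by
    intro u w huw hlt v hv
    rcases hsupp u w huw hlt _ hv with h1 | h1 | ⟨h1, h2⟩
    · exact Or.inl (h.inj h1)
    · exact Or.inr (h.inj h1)
    · exact (h.notMem u w ⟨huw, h1, hlt⟩ v h2).elim
  have hdata : ∀ x : S, (∃ v, x.1 = q v) ∨ ∃ u w huw hlt, x.1 ∈ (p u w huw hlt).support ∧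
      s(u, w) ∉ P.edges ∧ x.1 ∈ Q u w := by
    rintro ⟨x, hx | ⟨u, w, huw, hlt, hx⟩⟩
    · exact Or.inl hx
    · rcases hsupp u w huw hlt x hx with h1 | h1 | h1
      · exact Or.inl ⟨u, h1⟩
      · exact Or.inl ⟨w, h1⟩
      · exact Or.inr ⟨u, w, huw, hlt, hx, h1⟩
  have hcommon : ∀ x y : S, G.Adj x y → ∃ u w huw hlt, x.1 ∈ (p u w huw hlt).support ∧
      y.1 ∈ (p u w huw hlt).support := by
    have hmixed : ∀ x y : S, G.Adj x y → (∃ v, x.1 = q v) → (∃ u w huw hlt,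
        y.1 ∈ (p u w huw hlt).support ∧ s(u, w) ∉ P.edges ∧ y.1 ∈ Q u w) →
        ∃ u w huw hlt, x.1 ∈ (p u w huw hlt).support ∧ y.1 ∈ (p u w huw hlt).support := by
      rintro x y hxy ⟨v, hv⟩ ⟨u, w, huw, hlt, hy, hP, hyQ⟩
      refine ⟨u, w, huw, hlt, ?_, hy⟩
      rw [hv] at hxy ⊢
      by_cases hvu : v = u
      · subst hvu; exact SimpleGraph.Walk.start_mem_support _
      · by_cases hvw : v = w
        · subst hvw; exact SimpleGraph.Walk.end_mem_support _
        · exact (h.not_adj u w ⟨huw, hP, hlt⟩ v hvu hvw _ hyQ hxy).elim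
    intro x y hxy
    rcases hdata x with hx | hx <;> rcases hdata y with hy | hy
    · obtain ⟨v, hv⟩ := hx
      obtain ⟨v', hv'⟩ := hy
      rw [hv, hv'] at hxy ⊢
      have hne : v ≠ v' := by rintro rfl; exact G.irrefl hxy
      have hH : H.Adj v v' := P.adj_of_mem_edges ((hadj v v' hne).1 hxy)
      rcases lt_or_gt_of_ne (hf.ne hne) with hlt | hlt
      · exact ⟨v, v', hH, hlt, SimpleGraph.Walk.start_mem_support _,
          SimpleGraph.Walk.end_mem_support _⟩
      · exact ⟨v', v, hH.symm, hlt, SimpleGraph.Walk.end_mem_support _,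
          SimpleGraph.Walk.start_mem_support _⟩
    · exact hmixed x y hxy hx hy
    · obtain ⟨u, w, huw, hlt, h1, h2⟩ := hmixed y x hxy.symm hy hx
      exact ⟨u, w, huw, hlt, h2, h1⟩
    · obtain ⟨u, w, huw, hlt, hx, hP, hxQ⟩ := hx
      obtain ⟨u', w', huw', hlt', hy, hP', hyQ⟩ := hy
      by_cases heq : (u, w) = (u', w')
      · rw [Prod.mk.injEq] at heq
        obtain ⟨rfl, rfl⟩ := heq
        exact ⟨u, w, huw, hlt, hx, hy⟩
      · exact ((h.ac u w u' w' ⟨huw, hP, hlt⟩ ⟨huw', hP', hlt'⟩ heq _ hxQ _ hyQ).2 hxy).elim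
  refine ⟨S, ⟨⟨br, hbrinj⟩, fun {a b} hab => path a b hab, ?_, hsymm, ?_, ?_, ?_, ?_⟩, ?_⟩
  · intro a b hab
    obtain ⟨u, w, huw, hlt, -, -, h1, -⟩ := hred hab
    exact h1
  · intro a b hab c hc
    obtain ⟨u, w, huw, hlt, heq, -, -, h1⟩ := hred hab
    have h2 := hqsupp u w huw hlt c ((h1 _).1 hc)
    rw [Sym2.eq_iff] at heq
    rcases heq with ⟨rfl, rfl⟩ | ⟨rfl, rfl⟩ <;> tauto
  · intro a b c d hab hcd hne x hx hx'
    obtain ⟨u, w, huw, hlt, heq, -, -, h1⟩ := hred hab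
    obtain ⟨u', w', huw', hlt', heq', -, -, h1'⟩ := hred hcd
    have hx1 := (h1 x).1 hx
    have hx2 := (h1' x).1 hx'
    rcases hsupp u w huw hlt _ hx1 with h2 | h2 | ⟨hP, h2⟩
    · exact ⟨u, Subtype.ext h2.symm⟩
    · exact ⟨w, Subtype.ext h2.symm⟩
    · rcases hsupp u' w' huw' hlt' _ hx2 with h3 | h3 | ⟨hP', h3⟩
      · exact ⟨u', Subtype.ext h3.symm⟩
      · exact ⟨w', Subtype.ext h3.symm⟩
      · refine ((h.ac u w u' w' ⟨huw, hP, hlt⟩ ⟨huw', hP', hlt'⟩ ?_ _ h2 _ h3).1 rfl).elim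
        intro h4
        rw [Prod.mk.injEq] at h4
        rw [heq, heq', h4.1, h4.2] at hne
        exact hne rfl
  · intro x
    rcases hdata x with ⟨v, hv⟩ | ⟨u, w, huw, hlt, hx, -⟩
    · exact Or.inl ⟨v, Subtype.ext hv.symm⟩
    · refine Or.inr ⟨u, w, huw, ?_⟩
      rw [hpos huw hlt]
      exact (hpSsupp _ _ _ _ x).2 hx
  · intro e he
    induction e using Sym2.ind with
    | _ x y =>
      rw [SimpleGraph.mem_edgeSet, SimpleGraph.induce_adj] at he
      obtain ⟨u, w, huw, hlt, hx, hy⟩ := hcommon x y he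
      refine ⟨u, w, huw, ?_⟩
      rw [hpos huw hlt]
      exact hpSedge u w huw hlt x y hx hy he
  · intro a b hab
    obtain ⟨u, w, huw, hlt, heq, h1, -⟩ := hred hab
    simp only [heq]
    rw [h1]
    exact ⟨hlen1 u w huw hlt, hlen2 u w huw hlt⟩

end Filleting

/-- The vertices of a graph can be placed on a line so that precisely the edges of a given path
join consecutive places. -/
theorem exists_positions {V : Type u} [Finite V] {H : SimpleGraph V} {s t : V} (P : H.Walk s t)
    (hP : P.IsPath) : ∃ f : V → ℕ, Function.Injective f ∧
      ∀ u w, u ≠ w → (s(u, w) ∈ P.edges ↔ f u + 1 = f w ∨ f w + 1 = f u) := by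
  classical
  obtain ⟨κ, hκ⟩ := exists_injective_nat V
  -- Vertices off the path get places of one parity, after a gap beyond the end of the path, so that
  -- no unwanted pair is consecutive.
  set f : V → ℕ := fun v => if v ∈ P.support then P.support.idxOf v else P.length + 2 + 2 * κ v
    with hf
  have hin : ∀ v ∈ P.support, f v ≤ P.length ∧ P.getVert (f v) = v := by
    intro v hv
    have h1 : f v = P.support.idxOf v := if_pos hv
    have h2 := List.idxOf_lt_length_iff.2 hv
    rw [SimpleGraph.Walk.length_support] at h2
    rw [h1]
    exact ⟨by omega, P.getVert_support_idxOf hv⟩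
  have hout : ∀ v, v ∉ P.support → f v = P.length + 2 + 2 * κ v := fun v hv => if_neg hv
  have hget : ∀ i ≤ P.length, f (P.getVert i) = i := by
    intro i hi
    obtain ⟨h1, h2⟩ := hin _ (P.getVert_mem_support i)
    exact hP.getVert_injOn h1 hi h2
  have hstep : ∀ u w, f u + 1 = f w → s(u, w) ∈ P.edges := by
    intro u w h
    by_cases hu : u ∈ P.support <;> by_cases hw : w ∈ P.support
    · obtain ⟨h1, h2⟩ := hin u hu
      obtain ⟨h3, h4⟩ := hin w hw
      refine P.mk_mem_edges_iff_exists.2 ⟨f u, by omega, ?_⟩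
      rw [h2, h, h4]
    · have h1 := hin u hu
      have h2 := hout w hw
      omega
    · have h1 := hin w hw
      have h2 := hout u hu
      omega
    · have h1 := hout u hu
      have h2 := hout w hw
      omega
  refine ⟨f, ?_, ?_⟩
  · intro u w h
    by_cases hu : u ∈ P.support <;> by_cases hw : w ∈ P.support
    · rw [← (hin u hu).2, h, (hin w hw).2]
    · have h1 := hin u hu
      have h2 := hout w hw
      omega
    · have h1 := hin w hw
      have h2 := hout u hu
      omega
    · have h1 := hout u hu
      have h2 := hout w hw
      exact hκ (by omega)
  · intro u w _
    constructor
    · intro h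
      obtain ⟨i, hi, heq⟩ := P.mk_mem_edges_iff_exists.1 h
      have h1 := hget i (by omega)
      have h2 := hget (i + 1) (by omega)
      rw [Sym2.eq_iff] at heq
      rcases heq with ⟨rfl, rfl⟩ | ⟨rfl, rfl⟩
      · left; omega
      · right; omega
    · rintro (h | h)
      · exact hstep u w h
      · rw [Sym2.eq_swap]; exact hstep w u h

/-! ### Passing to a heavy induced subgraph. -/

section Induce

variable {W : Type v} {G : SimpleGraph W} {T : Set W}

theorem image_nb_induce (X : Set T) :
    Subtype.val '' nb (G.induce T) X = nb G (Subtype.val '' X) ∩ T := by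
  ext y
  constructor
  · rintro ⟨y, ⟨x, hx, rfl | h⟩, rfl⟩
    · exact ⟨subset_nb ⟨_, hx, rfl⟩, y.2⟩
    · exact ⟨mem_nb_of_adj ⟨x, hx, rfl⟩ h, y.2⟩
  · rintro ⟨⟨_, ⟨x, hx, rfl⟩, rfl | h⟩, hy⟩
    · exact ⟨x, subset_nb hx, rfl⟩
    · exact ⟨⟨y, hy⟩, mem_nb_of_adj hx (SimpleGraph.induce_adj.2 h), rfl⟩

theorem image_iterate_nb_induce (v : T) (k : ℕ) :
    Subtype.val '' (nb (G.induce T))^[k] {v} = ball G T v k := by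
  induction k with
  | zero => simp [ball]
  | succ k ih => rw [Function.iterate_succ_apply', image_nb_induce, ih]; rfl

theorem AC.image {A B : Set T} (h : AC (G.induce T) A B) :
    AC G (Subtype.val '' A) (Subtype.val '' B) := by
  rintro _ ⟨a, ha, rfl⟩ _ ⟨b, hb, rfl⟩
  obtain ⟨h1, h2⟩ := h a ha b hb
  exact ⟨fun e => h1 (Subtype.ext e), fun e => h2 (SimpleGraph.induce_adj.2 e)⟩

theorem Conn.image {X : Set T} (h : Conn (G.induce T) X) : Conn G (Subtype.val '' X) := by
  refine ⟨h.1.image _, fun A hA hne hne' => ?_⟩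
  obtain ⟨a, ha, b, hb, hab⟩ := h.2 {x | x ∈ X ∧ x.1 ∈ A} (fun x hx => hx.1)
    (by
      obtain ⟨_, ha⟩ := hne
      obtain ⟨x, hx, rfl⟩ := hA ha
      exact ⟨x, hx, ha⟩)
    (by
      obtain ⟨_, ⟨x, hx, rfl⟩, hb⟩ := hne'
      exact ⟨x, hx, fun h => hb h.2⟩)
  exact ⟨a, ha.2, b, ⟨⟨b, hb.1, rfl⟩, fun h => hb.2 ⟨hb.1, h⟩⟩, hab⟩

theorem Conf.image {V : Type u} {A B : V → V → Prop} {q : V → T} {Q : V → V → Set T}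
    (h : Conf A B (G.induce T) q Q) :
    Conf A B G (fun v => (q v).1) (fun u w => Subtype.val '' Q u w) where
  inj _ _ huw := h.inj (Subtype.ext huw)
  adj := h.adj
  conn u w huw := (h.conn u w huw).image
  left u w huw := by
    obtain ⟨x, hx, hadj⟩ := h.left u w huw
    exact ⟨x, ⟨x, hx, rfl⟩, hadj⟩
  right u w huw := by
    obtain ⟨x, hx, hadj⟩ := h.right u w huw
    exact ⟨x, ⟨x, hx, rfl⟩, hadj⟩
  notMem u w huw v := by
    rintro ⟨x, hx, heq⟩
    exact h.notMem u w huw v (Subtype.ext heq ▸ hx)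
  not_adj u w huw v hvu hvw := by
    rintro _ ⟨x, hx, rfl⟩ hadj
    exact h.not_adj u w huw v hvu hvw x hx hadj
  ac u w u' w' huw huw' hne := (h.ac u w u' w' huw huw' hne).image

/-- Rescaling makes the whole subgraph weigh one at the price of dividing `ε` by `μ T`. -/
theorem Wt.induce {μ : Set W → ℝ} {ε : ℝ} (h : Wt G μ ε) (hT : 0 < μ T) :
    Wt (G.induce T) (fun X => μ (Subtype.val '' X) / μ T) (ε / μ T) where
  empty := by simp [h.empty]
  mono hXY := by
    have := h.mono (Set.image_mono (f := (Subtype.val : T → W)) hXY)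
    gcongr
  union_le X Y := by
    rw [← add_div, Set.image_union]
    have := h.union_le (Subtype.val '' X) (Subtype.val '' Y)
    gcongr
  nb_le x := by
    have h1 : μ (Subtype.val '' nb (G.induce T) {x}) ≤ ε := by
      rw [image_nb_induce, Set.image_singleton]
      exact (h.mono Set.inter_subset_left).trans (h.nb_le _)
    gcongr
  ac A B hAB := by
    rcases h.ac _ _ hAB.image with h1 | h1
    · left; gcongr
    · right; gcongr

end Induce

theorem IsCoherent.wt {W : Type v} {G : SimpleGraph W} {μ : Set W → ℝ} {ε : ℝ} (hμ : IsMass μ)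
    (h : IsCoherent G μ ε) : Wt G μ (2 * ε) := by
  have hunion : ∀ X Y : Set W, μ (X ∪ Y) ≤ μ X + μ Y := by
    intro X Y
    have h1 := hμ.subadditive X (Y \ X) Set.disjoint_sdiff_right
    have h2 := hμ.mono (Y \ X) Y Set.sdiff_subset
    rw [Set.union_sdiff_self] at h1
    linarith
  have hac : ∀ A B : Set W, AC G A B → μ A < ε ∨ μ B < ε := fun A B hAB =>
    min_lt_iff.1 (h.min_lt A B ⟨hAB.disjoint, fun a ha b hb => (hAB a ha b hb).2⟩)
  have hε : 0 < ε := by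
    rcases hac ∅ ∅ ac_empty_left with h1 | h1 <;> rwa [hμ.empty] at h1
  refine ⟨hμ.empty, fun hXY => hμ.mono _ _ hXY, hunion, fun x => ?_, fun A B hAB => ?_⟩
  · have h1 : nb G {x} = {x} ∪ G.neighborSet x := by
      ext y
      rw [mem_nb_singleton]
      rfl
    rw [h1]
    have := hunion {x} (G.neighborSet x)
    have := h.vertex_lt x
    have := h.neighborSet_lt x
    linarith
  · rcases hac A B hAB with h1 | h1
    · left; linarith
    · right; linarith

end PureInduced

theorem mainTheorem1 {V : Type u} [Finite V] (H : SimpleGraph V) {s t : V}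
    (P : H.Walk s t) (hP : P.IsPath) :
    ∃ ε : ℝ, 0 < ε ∧
      ∀ (W : Type v) [Finite W] (G : SimpleGraph W) (μ : Set W → ℝ),
        PureInduced.IsMass μ → PureInduced.IsCoherent G μ ε →
          ∃ S : Set W, PureInduced.IsFilleting P (G.induce S) := by
  obtain ⟨f, hf, hfP⟩ := PureInduced.exists_positions P hP
  obtain ⟨κ, hκ⟩ := exists_injective_nat V
  set B : V → V → Prop := fun u w => H.Adj u w ∧ s(u, w) ∉ P.edges ∧ f u < f w
  have hB : ∀ u w, B u w → f u < f w := fun u w h => h.2.2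
  obtain ⟨δ, c, hδ, hc, hdense⟩ := PureInduced.exists_conf_of_dense.{u, v} f κ hf hκ B hB
  obtain ⟨c', hc', hsparse⟩ := PureInduced.exists_conf_of_sparse.{u, v} f κ hf hκ B hB
  -- The half pays for closed neighbourhoods, where vertex and neighbour bounds add up. The factor
  -- `δ` pays for rescaling to a set of weight at least `δ` in the sparse case.
  refine ⟨min c (c' * δ) / 2, by positivity, fun W _ G μ hμ hG => ?_⟩
  have hW := PureInduced.IsCoherent.wt hμ hG
  rw [mul_div_cancel₀ _ (two_ne_zero' ℝ)] at hW
  set ε := min c (c' * δ)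
  suffices h : ∃ q Q, PureInduced.Conf (fun u w => f u + 1 = f w ∨ f w + 1 = f u) B G q Q by
    obtain ⟨q, Q, h⟩ := h
    exact h.exists_filleting P f hf hfP
  by_cases hball : ∀ A, δ ≤ μ A → ∃ v ∈ A, ε ≤ μ (PureInduced.ball G A v 5)
  · exact hdense W G μ ε hW hμ.univ.ge (min_le_left _ _) hball
  · push Not at hball
    obtain ⟨A, hA, hball⟩ := hball
    have hApos : 0 < μ A := hδ.trans_le hA
    -- Failure of the dense alternative gives a heavy `A` in which every ball of radius five, taken
    -- inside `A`, is light; these are exactly the balls of `G.induce A`.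
    obtain ⟨q, Q, h⟩ := hsparse A (G.induce A) (fun X => μ (Subtype.val '' X) / μ A) (ε / μ A)
      (hW.induce hApos)
      (by
        rw [Set.image_univ, Subtype.range_coe, div_self hApos.ne'])
      (by
        rw [div_le_iff₀ hApos]
        exact (min_le_right _ _).trans (by gcongr))
      (by
        intro v
        have := (hball v v.2).le
        rw [← PureInduced.image_iterate_nb_induce] at this
        gcongr)
    exact ⟨_, _, h.image⟩
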